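/- Let $\mathcal A\subset\mathbb R^N$ be a finite set of nonzero, pairwise non-collinear vectors $\alpha$ with multiplicities $m_\alpha\in\mathbb Z_{\ge0}$; put $(x,y)=\sum_i x_iy_i$ on $\mathbb C^N$, $|m|=\sum_\alpha m_\alpha$ and $A_m(x)=\prod_{\alpha\in\mathcal A}(\alpha,x)^{m_\alpha}$. A function $f$ on $\mathbb C^N$ is called quasi-invariant if for every $\alpha\in\mathcal A$ and $s=1,\dots,m_\alpha$ the derivative $\partial_\alpha^{2s-1}f$, $\partial_\alpha=(\alpha,\partial/\partial x)$, vanishes on the hyperplane $(\alpha,x)=0$. Let $\mathcal Q_{\mathcal A}\subset\mathbb C[x_1,\dots,x_N]$ be the space of quasi-invariant polynomials and $\mathcal Q_{\mathcal A}[d]$ its homogeneous part of degree $d$. Let $$L=\Delta-\sum_{\alpha\in\mathcal A}\frac{2m_\alpha}{(\alpha,x)}\partial_\alpha,\qquad E=\sum_{i=1}^N x_i\partial_i,\qquad \mathcal L^{\mathcal H}=L-E .$$ Assume that $\mathcal A$ admits a Baker--Akhiezer function $\phi$ with $\phi(0,0)\neq0$, that is, a function $\phi(x,\lambda)=P(x,\lambda)e^{(x,\lambda)}$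 on $\mathbb C^N\times\mathbb C^N$, where $P$ is a polynomial in $x$ of degree at most $|m|$ with coefficients entire in $\lambda$ and with component of degree $|m|$ in $x$ equal to $A_m(x)A_m(\lambda)$, such that $\phi(\cdot,\lambda)$ is quasi-invariant for every $\lambda$. For $p\in\mathcal Q_{\mathcal A}[k]$ let $L_p=p(\partial_1,\dots,\partial_N)+(\text{terms of order}<k)$ be the unique differential operator with rational coefficients, homogeneous of degree $-k$, such that $[L_p,L]=0$; extend $p\mapsto L_p$ linearly to $\mathcal Q_{\mathcal A}$, and set $\langle p,q\rangle_m=\phi(0,0)^{-1}(L_pq)(0)$ for $p,q\in\mathcal Q_{\mathcal A}$. Let $F(x,\lambda)=\phi(x,\lambda)e^{-(\lambda,\lambda)/2}$, let $F_k(x,\cdot)$ be the homogeneous component of degree $k$ of its Taylor expansion in $\lambda$ at $0$, and define $$H_q(x)=\langle F(x,\cdot),q\rangle_m=\sum_{k\ge0}\langle F_k(x,\cdot),q\rangle_m,\qquad q\in\mathcal Q_{\mathcal A}$$ (only finitely many terms are nonzero). **Proposition.** The operator $L$ maps $\mathcal Q_{\mathcal A}$ to itself and acts on it locally nilpotently.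 For every $d\ge0$ and $q\in\mathcal Q_{\mathcal A}[d]$, $$H_q=e^{-L/2}q=\sum_{n\ge0}\frac{(-1/2)^n}{n!}L^nq .$$ Moreover $H_q$ is a quasi-invariant polynomial of the form $$H_q=q+\sum_{n=1}^{\lfloor d/2\rfloor}H_q^{(d-2n)},\qquad H_q^{(d-2n)}\in\mathcal Q_{\mathcal A}[d-2n],$$ it satisfies $\mathcal L^{\mathcal H}H_q=-d\,H_q$, and it is the only polynomial $H\in\mathcal Q_{\mathcal A}$ with $\mathcal L^{\mathcal H}H=-d\,H$ that is the sum of $q$ and of terms of degree less than $d$ (in particular, the only solution of the displayed form). -/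

import Mathlib

open scoped BigOperators

noncomputable section

namespace AHermite

/-- A finite collection of nonzero, pairwise non-collinear vectors of `ℝ^N` with multiplicities. -/
structure Configuration (N : ℕ) where
  /-- the vectors -/
  vectors : Finset (Fin N → ℝ)
  /-- the multiplicities (only the values on `vectors` matter) -/
  mult : (Fin N → ℝ) → ℕ
  ne_zero : ∀ α ∈ vectors, α ≠ 0
  non_collinear : ∀ α ∈ vectors, ∀ β ∈ vectors, α ≠ β → LinearIndependent ℝ ![α, β]

variable {N : ℕ}

/-- A real vector regarded as a vector of `ℂ^N`. -/
def cvec (α : Fin N → ℝ) : Fin N → ℂ := fun i => (α i : ℂ)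

/-- The complex bilinear (not Hermitian) product `(x, y) = ∑ x_i y_i` on `ℂ^N`. -/
def bil (x y : Fin N → ℂ) : ℂ := ∑ i, x i * y i

/-- The linear form `x ↦ (α, x)` as a polynomial. -/
def linForm (α : Fin N → ℝ) : MvPolynomial (Fin N) ℂ :=
  ∑ i, MvPolynomial.C (α i : ℂ) * MvPolynomial.X i

/-- `|m| = ∑ m_α`. -/
def Configuration.totalMult (A : Configuration N) : ℕ := ∑ α ∈ A.vectors, A.mult α

/-- `A_m(x) = ∏ (α, x)^{m_α}`. -/
def Configuration.poly (A : Configuration N) : MvPolynomial (Fin N) ℂ :=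
  ∏ α ∈ A.vectors, linForm α ^ A.mult α

/-- For each `α` and each `s = 1, …, m_α`, the odd normal derivative `∂_α^{2s-1} f` vanishes on the
hyperplane `(α, x) = 0`. -/
def QuasiInvariantFun (A : Configuration N) (f : (Fin N → ℂ) → ℂ) : Prop :=
  ∀ α ∈ A.vectors, ∀ s : ℕ, 1 ≤ s → s ≤ A.mult α → ∀ x : Fin N → ℂ, bil (cvec α) x = 0 →
    iteratedDeriv (2 * s - 1) (fun t : ℂ => f (x + t • cvec α)) 0 = 0

/-- Membership in the space `Q_A` of quasi-invariant polynomials. -/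
def QuasiInvariant (A : Configuration N) (q : MvPolynomial (Fin N) ℂ) : Prop :=
  QuasiInvariantFun A (fun x => MvPolynomial.eval x q)

/-- Membership in `Q_A[d]`: homogeneous quasi-invariants of degree `d`. -/
def HomQuasiInvariant (A : Configuration N) (d : ℕ) (q : MvPolynomial (Fin N) ℂ) : Prop :=
  QuasiInvariant A q ∧ q.IsHomogeneous d

/-- `φ(x, λ)` is a Baker--Akhiezer function of `A`: it equals `P(x, λ) e^{(x, λ)}`, where `P` is a
polynomial in `x` with coefficients entire in `λ`, of degree at most `|m|` in `x` and with component
of degree `|m|` in `x` equal to `A_m(x) A_m(λ)`; and `φ(·, λ)` satisfies the vanishing conditions on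
the hyperplanes. -/
structure IsBakerAkhiezer (A : Configuration N) (φ : (Fin N → ℂ) → (Fin N → ℂ) → ℂ) : Prop where
  form : ∃ P : (Fin N → ℂ) → MvPolynomial (Fin N) ℂ,
    (∀ ν : Fin N →₀ ℕ, Differentiable ℂ (fun l => (P l).coeff ν)) ∧
    (∀ l, (P l).totalDegree ≤ A.totalMult) ∧
    (∀ l, MvPolynomial.homogeneousComponent A.totalMult (P l) =
      MvPolynomial.C (MvPolynomial.eval l A.poly) * A.poly) ∧
    (∀ x l, φ x l = MvPolynomial.eval x (P l) * Complex.exp (bil x l))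
  vanishing : ∀ l, QuasiInvariantFun A (fun x => φ x l)

/-! ### Differential operators with rational coefficients -/

/-- The field `ℂ(x_1, …, x_N)`. -/
abbrev RatFun (N : ℕ) : Type := FractionRing (MvPolynomial (Fin N) ℂ)

/-- A polynomial as a rational function. -/
abbrev toRat : MvPolynomial (Fin N) ℂ →+* RatFun N :=
  algebraMap (MvPolynomial (Fin N) ℂ) (RatFun N)

instance : Algebra.FormallyEtale (MvPolynomial (Fin N) ℂ) (RatFun N) :=
  Algebra.FormallyEtale.of_isLocalization (nonZeroDivisors (MvPolynomial (Fin N) ℂ))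

/-- `∂_i` on polynomials, with values in rational functions. -/
def partialAux (i : Fin N) : Derivation ℂ (MvPolynomial (Fin N) ℂ) (RatFun N) :=
  (Algebra.linearMap (MvPolynomial (Fin N) ℂ) (RatFun N)).compDer (MvPolynomial.pderiv i)

/-- The partial derivative `∂_i` on rational functions: the (unique) derivation of `ℂ(x)` that
extends `∂_i` on polynomials (see `partialRat_toRat`). -/
def partialRat (i : Fin N) : Derivation ℂ (RatFun N) (RatFun N) :=
  (((partialAux i).liftKaehlerDifferential.liftBaseChange (RatFun N)).comp
    (KaehlerDifferential.tensorKaehlerEquivOfFormallyEtale ℂ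
      (MvPolynomial (Fin N) ℂ) (RatFun N)).symm.toLinearMap).compDer
    (KaehlerDifferential.D ℂ (RatFun N))

theorem partialRat_toRat (i : Fin N) (p : MvPolynomial (Fin N) ℂ) :
    partialRat i (toRat p) = toRat (MvPolynomial.pderiv i p) := by
  simp [partialRat, partialAux,
    KaehlerDifferential.tensorKaehlerEquivOfFormallyEtale_symm_D_algebraMap]

/-- `∂_i` as a `ℂ`-linear operator on rational functions. -/
def pd (i : Fin N) : Module.End ℂ (RatFun N) := (partialRat i).toLinearMap

/-- Multiplication by a rational function as an operator. -/
def mulOp (f : RatFun N) : Module.End ℂ (RatFun N) := LinearMap.mulLeft ℂ f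

/-- `∂_α = (α, ∂/∂x)`. -/
def pdDir (α : Fin N → ℝ) : Module.End ℂ (RatFun N) := ∑ i, (α i : ℂ) • pd i

/-- `∂^ν = ∂_1^{ν_1} ⋯ ∂_N^{ν_N}`. -/
def pdMulti (ν : Fin N →₀ ℕ) : Module.End ℂ (RatFun N) :=
  (List.ofFn fun i => pd i ^ ν i).prod

/-- The differential operator `∑ a_ν ∂^ν` with symbol `∑ a_ν ξ^ν ∈ ℂ(x)[ξ]`. -/
def opOfSymbol (a : MvPolynomial (Fin N) (RatFun N)) : Module.End ℂ (RatFun N) :=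
  ∑ ν ∈ a.support, mulOp (a.coeff ν) * pdMulti ν

/-- The rational Calogero--Moser operator `L = Δ - ∑ 2 m_α / (α, x) ∂_α`. -/
def opL (A : Configuration N) : Module.End ℂ (RatFun N) :=
  (∑ i, pd i ^ 2) -
    ∑ α ∈ A.vectors, mulOp (2 * (A.mult α : RatFun N) / toRat (linForm α)) * pdDir α

/-- The Euler operator `E = ∑ x_i ∂_i`. -/
def opE : Module.End ℂ (RatFun N) := ∑ i, mulOp (toRat (MvPolynomial.X i)) * pd i

/-- `L^H = L - E`. -/
def opLH (A : Configuration N) : Module.End ℂ (RatFun N) := opL A - opE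

/-- `e^{-L/2} f = ∑ (-1/2)^n / n! L^n f`; the sum is finite whenever `L` acts locally nilpotently
on `f`. -/
def expNegHalfL (A : Configuration N) (f : RatFun N) : RatFun N :=
  ∑ᶠ n : ℕ, ((-1 / 2 : ℂ) ^ n / (n.factorial : ℂ)) • (opL A ^ n) f

/-- `f` is a homogeneous rational function of degree `n ∈ ℤ`. -/
def HomRat (f : RatFun N) (n : ℤ) : Prop :=
  ∃ (i j : ℕ) (p r : MvPolynomial (Fin N) ℂ), p.IsHomogeneous i ∧ r.IsHomogeneous j ∧ r ≠ 0 ∧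
    (i : ℤ) - j = n ∧ f = toRat p / toRat r

/-! ### Quantum integrals, the bilinear form and the Hermite polynomials -/

/-- `D = q(∂) + lower order terms` is a differential operator with rational coefficients, homogeneous
of degree `-d`, with `[D, L] = 0`. For `q ∈ Q_A[d]` this characterises the quantum integral `L_q`. -/
def IsQuantumIntegral (A : Configuration N) (d : ℕ) (q : MvPolynomial (Fin N) ℂ)
    (D : Module.End ℂ (RatFun N)) : Prop :=
  (∃ a : MvPolynomial (Fin N) (RatFun N),
    D = opOfSymbol a ∧ a.totalDegree ≤ d ∧
    (∀ ν : Fin N →₀ ℕ, ν.degree = d → a.coeff ν = toRat (MvPolynomial.C (q.coeff ν))) ∧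
    (∀ ν : Fin N →₀ ℕ, HomRat (a.coeff ν) ((ν.degree : ℤ) - d))) ∧
  D * opL A = opL A * D

/-- The quantum integral `L_q`: for homogeneous `q` the operator characterised by
`IsQuantumIntegral`, extended linearly through the homogeneous components of `q`. -/
def quantumIntegral (A : Configuration N) (q : MvPolynomial (Fin N) ℂ) :
    Module.End ℂ (RatFun N) :=
  ∑ k ∈ Finset.range (q.totalDegree + 1),
    Classical.epsilon (IsQuantumIntegral A k (MvPolynomial.homogeneousComponent k q))

/-- The value at `x = 0` of a rational function that is a polynomial (and `0` for any other). -/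
def evalZero : RatFun N → ℂ :=
  Function.extend (toRat : MvPolynomial (Fin N) ℂ → RatFun N)
    (fun p => MvPolynomial.eval 0 p) (fun _ => 0)

/-- `(p, q)_m = (L_p q)(0)`. -/
def form (A : Configuration N) (p q : MvPolynomial (Fin N) ℂ) : ℂ :=
  evalZero (quantumIntegral A p (toRat q))

/-- `⟨p, q⟩_m = φ(0, 0)⁻¹ (p, q)_m`. -/
def nform (A : Configuration N) (φ : (Fin N → ℂ) → (Fin N → ℂ) → ℂ)
    (p q : MvPolynomial (Fin N) ℂ) : ℂ :=
  (φ 0 0)⁻¹ * form A p q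

/-- The homogeneous Taylor polynomial of degree `k` of `f` at `0`, that is the polynomial
`v ↦ (1 / k!) D^k f(0)(v, …, v)`. -/
def taylorComponent (f : (Fin N → ℂ) → ℂ) (k : ℕ) : MvPolynomial (Fin N) ℂ :=
  ∑ s : Fin k → Fin N,
    MvPolynomial.C ((k.factorial : ℂ)⁻¹ *
      iteratedFDeriv ℂ k f 0 (fun j => Pi.single (s j) (1 : ℂ))) *
    ∏ j, MvPolynomial.X (s j)

/-- The generating function `F(x, λ) = φ(x, λ) e^{-λ²/2}`. -/
def genFun (φ : (Fin N → ℂ) → (Fin N → ℂ) → ℂ) (x l : Fin N → ℂ) : ℂ :=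
  φ x l * Complex.exp (-(bil l l) / 2)

/-- `H_q(x) = ⟨F(x, ·), q⟩_m`, where the form is extended to the entire function `F(x, ·)` through
its expansion into homogeneous polynomials (only the term of degree `d` contributes for
`q ∈ Q_A[d]`). -/
def hermite (A : Configuration N) (φ : (Fin N → ℂ) → (Fin N → ℂ) → ℂ)
    (q : MvPolynomial (Fin N) ℂ) (x : Fin N → ℂ) : ℂ :=
  ∑ᶠ k : ℕ, nform A φ (taylorComponent (genFun φ x) k) q

/-- `H = q + ∑_{n=1}^{⌊d/2⌋} H^{(d-2n)}` with `H^{(d-2n)} ∈ Q_A[d-2n]`. -/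
def HasHermiteForm (A : Configuration N) (d : ℕ) (q H : MvPolynomial (Fin N) ℂ) : Prop :=
  ∃ h : ℕ → MvPolynomial (Fin N) ℂ,
    (∀ n, 1 ≤ n → n ≤ d / 2 → HomQuasiInvariant A (d - 2 * n) (h n)) ∧
    H = q + ∑ n ∈ Finset.Icc 1 (d / 2), h n

/-- `H = q + ` terms of degree less than `d`. -/
def HasLeadingTerm (d : ℕ) (q H : MvPolynomial (Fin N) ℂ) : Prop :=
  ∀ k, d ≤ k →
    MvPolynomial.homogeneousComponent k H = MvPolynomial.homogeneousComponent k q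

end AHermite

end

noncomputable section

namespace AHermite

variable {N : ℕ}

open MvPolynomial

section

/-! Write B_k(x,λ) for the component of φ of degree k in x. The proposition follows from three
facts. (i) φ is polynomially bihomogeneous, symmetric in x and λ, and an eigenfunction: B_k has
bidegree (k,k), B_k(x,λ) = B_k(λ,x), and L B_{k+2} = (λ,λ) B_k in x (`IsExpansion.symm`,
`IsExpansion.lhat_comp`). (ii) For homogeneous p in Q_A the integral L_p exists, is unique, maps Q_A
to itself, and acts on φ as multiplication by p(λ) for generic λ
(`IsExpansion.quantumIntegral_spec`). (iii) The polynomials B_d(·,λ) with λ generic span Q_A[d]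
(`IsExpansion.mem_span`). By (i), F_d(x,λ) = ∑ (-1/2)^n/n! (λ,λ)^n B_{d-2n}(x,λ), which is the value
at x of e^{-L/2} B_d(·,λ). By (ii), pairing F_d(x,·) with q = B_d(·,λ) returns this same number; by
(iii) and linearity H_q = e^{-L/2} q for every q of degree d. The other F_k pair to zero for degree
reasons. The eigenvalue equation is a telescoping sum, since L lowers degrees by two; uniqueness
holds because L - E is triangular for the degree, with entry -k ≠ -d in degree k < d.

Facts (i) and (ii) rest on one uniqueness principle: for generic λ a quasi-invariant P(x) e^{(x,λ)}
has top coefficient divisible by A_m, so it vanishes if deg P < |m| (`clin_pow_dvd_top`,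
`Configuration.Generic.eq_zero`). Applied to a rescaling of λ, it shows that the coefficients of P
are homogeneous in λ, hence, being entire, polynomial (`IsBakerAkhiezer.exists_expansion`). Applied
to L acting in λ, which keeps quasi-invariance in x, it gives the eigenvalue equation in λ; the
unknown factor is found at x = 0, where φ(0,0) ≠ 0 is used (`IsExpansion.twist_atX`). Following that
equation along each hyperplane shows that the cofactors of A_m are quasi-invariant
(`IsExpansion.locus`), and this makes L preserve Q_A (`Configuration.Locus.exists_lhat`). Then the
equation in x and the symmetry follow. Finally L_p is ad_L^d(p)/(2^d d!): one more commutator would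
lower degrees by more than its order, so it is zero (`IsExpansion.exists_integral`).

Almost everything is formal. A product P e^{(x,y)} is encoded as a power series over the polynomial
ring whose indeterminate records the degree in x, so that its coefficients are the homogeneous
components, and L is replaced by A_m L, which acts on polynomials. -/

/-- Polynomials on `ℂ^N`. -/
abbrev Poly (N : ℕ) : Type := MvPolynomial (Fin N) ℂ

/-! ### Linear forms, gradients and the Laplacian -/

/-- The linear form `x ↦ (y, x)`. -/
def clin (y : Fin N → ℂ) : Poly N := ∑ i, C (y i) * X i

theorem linForm_eq (α : Fin N → ℝ) : linForm α = clin (cvec α) := rfl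

theorem bil_comm (x y : Fin N → ℂ) : bil x y = bil y x := by
  simp [bil, mul_comm]

theorem bil_add_right (x y z : Fin N → ℂ) : bil x (y + z) = bil x y + bil x z := by
  simp [bil, mul_add, Finset.sum_add_distrib]

theorem bil_smul_right (x y : Fin N → ℂ) (c : ℂ) : bil x (c • y) = c * bil x y := by
  simp only [bil, Pi.smul_apply, smul_eq_mul, Finset.mul_sum]
  exact Finset.sum_congr rfl fun i _ => by ring

theorem bil_smul_left (x y : Fin N → ℂ) (c : ℂ) : bil (c • x) y = c * bil x y := by
  rw [bil_comm, bil_smul_right, bil_comm]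

theorem bil_sub_right (x y z : Fin N → ℂ) : bil x (y - z) = bil x y - bil x z := by
  simp [bil, mul_sub, Finset.sum_sub_distrib]

theorem eval_clin (x y : Fin N → ℂ) : eval x (clin y) = bil y x := by
  simp [clin, bil]

theorem pderiv_clin (y : Fin N → ℂ) (i : Fin N) : pderiv i (clin y) = C (y i) := by
  classical
  simp [clin, pderiv_X, Pi.single_apply]

theorem clin_isHomogeneous (y : Fin N → ℂ) : (clin y).IsHomogeneous 1 := by
  refine IsHomogeneous.sum _ _ _ fun i _ => ?_
  simpa using (isHomogeneous_C (Fin N) (y i)).mul (isHomogeneous_X ℂ i)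

/-- The derivation `g ↦ (∇f, ∇g)`. -/
def gam (f : Poly N) : Derivation ℂ (Poly N) (Poly N) := ∑ i, pderiv i f • pderiv i

theorem gam_apply (f g : Poly N) : gam f g = ∑ i, pderiv i f * pderiv i g := by
  have h : ∀ s : Finset (Fin N), (∑ i ∈ s, pderiv i f • pderiv i : Derivation ℂ (Poly N) (Poly N)) g
      = ∑ i ∈ s, pderiv i f * pderiv i g := by
    classical
    intro s
    induction s using Finset.induction_on with
    | empty => simp
    | insert a s ha ih => rw [Finset.sum_insert ha, Finset.sum_insert ha, Derivation.add_apply, ih]; rfl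
  exact h _

theorem gam_comm (f g : Poly N) : gam f g = gam g f := by
  simp [gam_apply, mul_comm]

theorem gam_sub_left (f g h : Poly N) : gam (f - g) h = gam f h - gam g h := by
  rw [gam_comm, map_sub, gam_comm, gam_comm h g]

theorem gam_mul_right (f g h : Poly N) : gam f (g * h) = g * gam f h + h * gam f g := by
  rw [Derivation.leibniz, smul_eq_mul, smul_eq_mul]

theorem gam_mul_left (f g h : Poly N) : gam (f * g) h = f * gam g h + g * gam f h := by
  rw [gam_comm, gam_mul_right, gam_comm, gam_comm h f]

theorem gam_pow_right (f g : Poly N) (n : ℕ) : g * gam f (g ^ n) = n * g ^ n * gam f g := by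
  cases n with
  | zero => simp
  | succ n =>
    rw [Derivation.leibniz_pow]
    simp only [Nat.add_sub_cancel, smul_eq_mul, nsmul_eq_mul]
    ring

theorem gam_pow_left (f g : Poly N) (n : ℕ) : g * gam (g ^ n) f = n * g ^ n * gam g f := by
  rw [gam_comm, gam_pow_right, gam_comm]

theorem gam_clin_clin (x y : Fin N → ℂ) : gam (clin x) (clin y) = C (bil x y) := by
  simp [gam_apply, pderiv_clin, bil]

theorem gam_clin (y : Fin N → ℂ) (f : Poly N) : gam (clin y) f = ∑ i, C (y i) * pderiv i f := by
  simp [gam_apply, pderiv_clin]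

/-- The Laplace operator. -/
def lap : Poly N →ₗ[ℂ] Poly N := ∑ i, (pderiv i).toLinearMap ∘ₗ (pderiv i).toLinearMap

theorem lap_apply (f : Poly N) : lap f = ∑ i, pderiv i (pderiv i f) := by
  simp [lap]

theorem lap_mul (f g : Poly N) : lap (f * g) = f * lap g + 2 * gam f g + g * lap f := by
  simp only [lap_apply, gam_apply, Finset.mul_sum, ← Finset.sum_add_distrib]
  refine Finset.sum_congr rfl fun i _ => ?_
  simp only [Derivation.leibniz, smul_eq_mul, map_add]
  ring

theorem lap_clin (y : Fin N → ℂ) : lap (clin y) = 0 := by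
  simp [lap_apply, pderiv_clin]

theorem lap_C (c : ℂ) : lap (C c : Poly N) = 0 := by
  simp [lap_apply]

theorem lap_clin_pow (y : Fin N → ℂ) (n : ℕ) :
    clin y ^ 2 * lap (clin y ^ n) = C (bil y y * (n * (n - 1))) * clin y ^ n := by
  induction n with
  | zero =>
    rw [pow_zero, ← C_1, lap_C]
    simp
  | succ n ih =>
    have h := gam_pow_left (clin y) (clin y) n
    rw [gam_clin_clin] at h
    rw [pow_succ (clin y) n, lap_mul, lap_clin]
    have : clin y ^ 2 * (clin y ^ n * 0 + 2 * gam (clin y ^ n) (clin y) + clin y * lap (clin y ^ n))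
      = 2 * clin y * (clin y * gam (clin y ^ n) (clin y))
        + clin y * (clin y ^ 2 * lap (clin y ^ n)) := by ring
    rw [this, h, ih]
    simp only [map_mul, map_sub, map_natCast, map_one, Nat.cast_add, Nat.cast_one, map_add]
    ring

/-! ### Shears along a vector: the projection to a hyperplane and the reflection -/

/-- Substitution `x ↦ x - c (a, x) a`. -/
def shear (a : Fin N → ℂ) (c : ℂ) : Poly N →ₐ[ℂ] Poly N :=
  aeval fun i => X i - C (c * a i) * clin a

theorem shear_X (a : Fin N → ℂ) (c : ℂ) (i : Fin N) :
    shear a c (X i) = X i - C (c * a i) * clin a := by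
  simp [shear]

theorem eval_shear (a x : Fin N → ℂ) (c : ℂ) (f : Poly N) :
    eval x (shear a c f) = eval (x - (c * bil a x) • a) f := by
  induction f using MvPolynomial.induction_on with
  | C r => simp [shear]
  | add p q hp hq => simp [hp, hq]
  | mul_X p i hp =>
    simp only [map_mul, hp, shear_X, map_sub, eval_X, eval_C, eval_clin, Pi.sub_apply,
      Pi.smul_apply, smul_eq_mul]
    ring

/-- Each variable moves by a multiple of (a,x), so the substitution is the identity modulo (a,x). -/
theorem clin_dvd_sub_shear (a : Fin N → ℂ) (c : ℂ) (f : Poly N) : clin a ∣ f - shear a c f := by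
  induction f using MvPolynomial.induction_on with
  | C r => simp [shear]
  | add p q hp hq =>
    rw [map_add, add_sub_add_comm]
    exact dvd_add hp hq
  | mul_X p i hp =>
    have : p * X i - shear a c (p * X i) =
      (p - shear a c p) * X i + shear a c p * (C (c * a i) * clin a) := by
      rw [map_mul, shear_X]; ring
    rw [this]
    exact dvd_add (hp.mul_right _) ((dvd_mul_left _ _).mul_left _)

theorem shear_clin (a y : Fin N → ℂ) (c : ℂ) :
    shear a c (clin y) = clin y - C (c * bil a y) * clin a := by
  apply MvPolynomial.funext
  intro x
  rw [eval_shear, eval_clin, bil_sub_right, bil_smul_right, map_sub, eval_clin, map_mul, eval_C,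
    eval_clin, bil_comm y a]
  ring

/-- For c = 1/(a,a) the shear is the orthogonal projection onto the hyperplane, so it plays the role
of restriction to the hyperplane while staying inside the same polynomial ring. -/
theorem clin_dvd_iff_shear {a : Fin N → ℂ} (ha : bil a a ≠ 0) (h : Poly N) :
    clin a ∣ h ↔ shear a (1 / bil a a) h = 0 := by
  constructor
  · rintro ⟨g, rfl⟩
    rw [map_mul, shear_clin, one_div_mul_cancel ha]
    simp
  · intro h0
    have := clin_dvd_sub_shear a (1 / bil a a) h
    rwa [h0, sub_zero] at this

theorem clin_dvd_iff {a : Fin N → ℂ} (ha : bil a a ≠ 0) (h : Poly N) :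
    clin a ∣ h ↔ ∀ x, bil a x = 0 → eval x h = 0 := by
  constructor
  · rintro ⟨g, rfl⟩ x hx
    rw [map_mul, eval_clin, hx, zero_mul]
  · intro hx
    rw [clin_dvd_iff_shear ha]
    apply MvPolynomial.funext
    intro x
    rw [eval_shear, map_zero]
    apply hx
    rw [bil_sub_right, bil_smul_right]
    field_simp
    ring

theorem clin_ne_zero {a : Fin N → ℂ} (ha : bil a a ≠ 0) : clin a ≠ 0 := by
  intro h
  apply ha
  rw [← eval_clin, h, map_zero]

/-- The ideal of (a,x) is the kernel of an endomorphism of a domain. -/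
theorem clin_prime {a : Fin N → ℂ} (ha : bil a a ≠ 0) : Prime (clin a) := by
  refine ⟨clin_ne_zero ha, ?_, ?_⟩
  · intro h
    have := (clin_dvd_iff_shear ha 1).1 h.dvd
    simp at this
  · intro f g h
    rw [clin_dvd_iff_shear ha, map_mul, mul_eq_zero] at h
    rwa [clin_dvd_iff_shear ha, clin_dvd_iff_shear ha]

/-- The orthogonal reflection in the hyperplane `(a, x) = 0`, acting on polynomials. -/
def refl (a : Fin N → ℂ) : Poly N →ₐ[ℂ] Poly N := shear a (2 / bil a a)

theorem clin_dvd_sub_refl (a : Fin N → ℂ) (f : Poly N) : clin a ∣ f - refl a f :=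
  clin_dvd_sub_shear _ _ _

theorem refl_clin_self {a : Fin N → ℂ} (ha : bil a a ≠ 0) : refl a (clin a) = -clin a := by
  rw [refl, shear_clin, div_mul_cancel₀ _ ha, map_ofNat]
  ring

theorem refl_clin_of_orthogonal {a y : Fin N → ℂ} (hy : bil a y = 0) :
    refl a (clin y) = clin y := by
  rw [refl, shear_clin, hy]
  simp

theorem eval_refl (a x : Fin N → ℂ) (f : Poly N) :
    eval x (refl a f) = eval (x - (2 / bil a a * bil a x) • a) f :=
  eval_shear _ _ _ _

theorem refl_refl {a : Fin N → ℂ} (ha : bil a a ≠ 0) (f : Poly N) : refl a (refl a f) = f := by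
  apply MvPolynomial.funext
  intro x
  rw [eval_refl, eval_refl]
  congr 2
  rw [bil_sub_right, bil_smul_right, sub_sub, ← add_smul]
  have : 2 / bil a a * bil a x + 2 / bil a a * (bil a x - 2 / bil a a * bil a x * bil a a) = 0 := by
    field_simp
    ring
  rw [this, zero_smul, sub_zero]

theorem pderiv_shear (a : Fin N → ℂ) (c : ℂ) (i : Fin N) (f : Poly N) :
    pderiv i (shear a c f) = shear a c (pderiv i f) - C (c * a i) * shear a c (gam (clin a) f) := by
  classical
  induction f using MvPolynomial.induction_on with
  | C r => simp [shear]
  | add p q hp hq => simp only [map_add, hp, hq]; ring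
  | mul_X p j hp =>
    have hX : pderiv i (shear a c (X j)) =
        pderiv i (X j : Poly N) - C (c * a i) * C (a j) := by
      rw [shear_X, map_sub, pderiv_C_mul, pderiv_clin, ← C_mul, ← C_mul]
      congr 2; ring
    have hg : gam (clin a) (X j : Poly N) = C (a j) := by
      simp [gam_clin, pderiv_X, Pi.single_apply]
    have hp1 : shear a c (pderiv i (X j : Poly N)) = pderiv i (X j) := by
      rw [pderiv_X]
      by_cases h : i = j
      · subst h; simp
      · simp [Ne.symm h]
    have hC : shear a c (C (a j)) = C (a j) := by simp [shear]
    rw [map_mul, Derivation.leibniz, Derivation.leibniz, gam_mul_right]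
    simp only [smul_eq_mul, map_add, map_mul, hX, hp, hg, hp1, hC]
    ring

theorem pderiv_pderiv_comm (i j : Fin N) (f : Poly N) :
    pderiv i (pderiv j f) = pderiv j (pderiv i f) := by
  classical
  have h : ⁅(pderiv i : Derivation ℂ (Poly N) (Poly N)),
      (pderiv j : Derivation ℂ (Poly N) (Poly N))⁆ = 0 := by
    apply MvPolynomial.derivation_ext
    intro k
    simp [Derivation.commutator_apply, pderiv_X, Pi.single_apply, apply_ite]
  have h' := DFunLike.congr_fun h f
  rwa [Derivation.commutator_apply, Derivation.zero_apply, sub_eq_zero] at h'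

theorem gam_clin_pderiv (a : Fin N → ℂ) (f : Poly N) (i : Fin N) :
    gam (clin a) (pderiv i f) = pderiv i (gam (clin a) f) := by
  rw [gam_clin, gam_clin, map_sum]
  refine Finset.sum_congr rfl fun j _ => ?_
  rw [pderiv_C_mul, pderiv_pderiv_comm]

theorem C_two_div_mul {a : Fin N → ℂ} (ha : bil a a ≠ 0) :
    (C (2 / bil a a) * C (2 / bil a a) * C (bil a a) : Poly N) = 2 * C (2 / bil a a) := by
  rw [← map_ofNat (C : ℂ →+* Poly N) 2]
  simp only [← C_mul]
  congr 1; field_simp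

theorem sum_refl_pderiv (a : Fin N → ℂ) (f : Poly N) :
    ∑ i, C (a i) * refl a (pderiv i f) = refl a (gam (clin a) f) := by
  rw [gam_clin, map_sum]
  refine Finset.sum_congr rfl fun i _ => ?_
  simp [refl, shear]

theorem sum_C_mul_C (a : Fin N → ℂ) :
    (∑ i, C (a i) * C (a i) : Poly N) = C (bil a a) := by
  simp [bil]

/-- The reflection is an isometry. In coordinates, the two cross terms of the chain rule cancel
against the quadratic one because c²(a,a) = 2c for c = 2/(a,a). -/
theorem gam_refl {a : Fin N → ℂ} (ha : bil a a ≠ 0) (f g : Poly N) :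
    gam (refl a f) (refl a g) = refl a (gam f g) := by
  have hk := C_two_div_mul ha
  have h1 := sum_refl_pderiv a
  have h2 := sum_C_mul_C a
  have h3 : refl a (gam f g) = ∑ i, refl a (pderiv i f) * refl a (pderiv i g) := by
    simp [gam_apply]
  rw [gam_apply, h3]
  have h4 : ∀ i, pderiv i (refl a f) * pderiv i (refl a g) =
    refl a (pderiv i f) * refl a (pderiv i g)
    - C (2 / bil a a) * refl a (gam (clin a) g) * (C (a i) * refl a (pderiv i f))
    - C (2 / bil a a) * refl a (gam (clin a) f) * (C (a i) * refl a (pderiv i g))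
    + C (2 / bil a a) * C (2 / bil a a) * refl a (gam (clin a) f) * refl a (gam (clin a) g)
      * (C (a i) * C (a i)) := by
    intro i
    rw [refl, pderiv_shear, pderiv_shear, C_mul]
    ring
  simp only [h4, Finset.sum_add_distrib, Finset.sum_sub_distrib, ← Finset.mul_sum, h1, h2]
  linear_combination refl a (gam (clin a) f) * refl a (gam (clin a) g) * hk

theorem gam_clin_refl {a : Fin N → ℂ} (ha : bil a a ≠ 0) (f : Poly N) :
    gam (clin a) (refl a f) = -refl a (gam (clin a) f) := by
  have := gam_refl ha (clin a) f
  rw [refl_clin_self ha] at this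
  rw [← this, ← neg_one_mul (clin a), show (-1 : Poly N) = C (-1) by simp, gam_mul_left]
  simp [gam_apply]

theorem lap_refl {a : Fin N → ℂ} (ha : bil a a ≠ 0) (f : Poly N) :
    lap (refl a f) = refl a (lap f) := by
  have hcomm := gam_clin_pderiv a f
  have hk := C_two_div_mul ha
  have h1 := sum_refl_pderiv a
  have h2 := sum_C_mul_C a
  have h3 : refl a (lap f) = ∑ i, refl a (pderiv i (pderiv i f)) := by
    simp [lap_apply]
  rw [lap_apply, h3]
  have h4 : ∀ i, pderiv i (pderiv i (refl a f)) = refl a (pderiv i (pderiv i f))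
    - 2 * C (2 / bil a a) * (C (a i) * refl a (pderiv i (gam (clin a) f)))
    + C (2 / bil a a) * C (2 / bil a a) * refl a (gam (clin a) (gam (clin a) f))
      * (C (a i) * C (a i)) := by
    intro i
    rw [refl, pderiv_shear, map_sub, pderiv_shear, pderiv_C_mul, pderiv_shear, C_mul, hcomm]
    ring
  simp only [h4, Finset.sum_add_distrib, Finset.sum_sub_distrib, ← Finset.mul_sum, h1, h2]
  linear_combination refl a (gam (clin a) (gam (clin a) f)) * hk

end

section

/-! ### Restriction to lines -/

/-- Restriction of a polynomial to the line `t ↦ x + t a`. -/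
def line (x a : Fin N → ℂ) : Poly N →ₐ[ℂ] Polynomial ℂ :=
  aeval fun i => Polynomial.C (x i) + Polynomial.C (a i) * Polynomial.X

theorem eval_line (x a : Fin N → ℂ) (t : ℂ) (f : Poly N) :
    (line x a f).eval t = eval (x + t • a) f := by
  induction f using MvPolynomial.induction_on with
  | C r => simp [line]
  | add p q hp hq => simp [hp, hq]
  | mul_X p i hp =>
    simp only [map_mul, Polynomial.eval_mul, hp, eval_X, Pi.add_apply, Pi.smul_apply, smul_eq_mul]
    congr 1
    simp only [line, aeval_X, Polynomial.eval_add, Polynomial.eval_mul, Polynomial.eval_C,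
      Polynomial.eval_X]
    ring

theorem line_clin (x a y : Fin N → ℂ) :
    line x a (clin y) = Polynomial.C (bil y x) + Polynomial.C (bil y a) * Polynomial.X := by
  apply Polynomial.funext
  intro t
  rw [eval_line, eval_clin, bil_add_right, bil_smul_right]
  simp only [Polynomial.eval_add, Polynomial.eval_mul, Polynomial.eval_C, Polynomial.eval_X]
  ring

theorem line_refl {a x : Fin N → ℂ} (ha : bil a a ≠ 0) (hx : bil a x = 0) (f : Poly N) :
    line x a (refl a f) = (line x a f).comp (-Polynomial.X) := by
  apply Polynomial.funext
  intro t
  rw [eval_line, eval_refl, Polynomial.eval_comp, eval_line]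
  congr 2
  rw [bil_add_right, bil_smul_right, hx, add_sub_assoc, ← sub_smul]
  congr 2
  simp
  field_simp
  ring

/-- The order of vanishing along a hyperplane can be tested on the normal lines: (a,x) restricts to
(a,a)t, a unit times t, on each of them, and one factor is split off at a time. -/
theorem clin_pow_dvd_iff {a : Fin N → ℂ} (ha : bil a a ≠ 0) (n : ℕ) (h : Poly N) :
    clin a ^ n ∣ h ↔ ∀ x, bil a x = 0 → Polynomial.X ^ n ∣ line x a h := by
  constructor
  · rintro ⟨g, rfl⟩ x hx
    rw [map_mul, map_pow, line_clin, hx, map_zero, zero_add, mul_pow, mul_assoc]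
    exact (dvd_mul_right _ _).mul_left _
  · intro hx
    induction n generalizing h with
    | zero => simp
    | succ n ih =>
      have h1 : clin a ∣ h := by
        rw [clin_dvd_iff ha]
        intro x h0
        have := (Polynomial.X_pow_dvd_iff.1 (hx x h0)) 0 (Nat.succ_pos n)
        rw [Polynomial.coeff_zero_eq_eval_zero, eval_line] at this
        simpa using this
      obtain ⟨g, rfl⟩ := h1
      rw [pow_succ, mul_comm]
      refine mul_dvd_mul_left _ (ih g fun x h0 => ?_)
      have := hx x h0
      rw [map_mul, line_clin, h0, map_zero, zero_add, mul_assoc, pow_succ, mul_comm _ Polynomial.X,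
        (Polynomial.isUnit_C.2 (isUnit_iff_ne_zero.2 ha)).dvd_mul_left] at this
      exact (mul_dvd_mul_iff_left Polynomial.X_ne_zero).1 this

/-! ### The algebra of quasi-invariants -/

/-- Polynomials quasi-invariant of order `m` with respect to the reflection along `a`. -/
def quasiInv (a : Fin N → ℂ) (m : ℕ) : Subalgebra ℂ (Poly N) where
  carrier := {f | clin a ^ (2 * m + 1) ∣ f - refl a f}
  mul_mem' {f g} hf hg := by
    have : f * g - refl a (f * g) = (f - refl a f) * g + refl a f * (g - refl a g) := by
      rw [map_mul]; ring
    rw [Set.mem_ofPred_eq, this]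
    exact dvd_add (Dvd.dvd.mul_right hf _) (Dvd.dvd.mul_left hg _)
  add_mem' {f g} hf hg := by
    rw [Set.mem_ofPred_eq, map_add, add_sub_add_comm]
    exact dvd_add hf hg
  algebraMap_mem' c := by simp

theorem mem_quasiInv {a : Fin N → ℂ} {m : ℕ} {f : Poly N} :
    f ∈ quasiInv a m ↔ clin a ^ (2 * m + 1) ∣ f - refl a f := Iff.rfl

/-- On a normal line the reflection is t ↦ -t, so f - s f doubles the odd coefficients and kills the
even ones. -/
theorem mem_quasiInv_iff_coeff {a : Fin N → ℂ} (ha : bil a a ≠ 0) {m : ℕ} {f : Poly N} :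
    f ∈ quasiInv a m ↔ ∀ x, bil a x = 0 → ∀ r < 2 * m, Odd r → (line x a f).coeff r = 0 := by
  rw [mem_quasiInv, clin_pow_dvd_iff ha]
  refine forall₂_congr fun x hx => ?_
  rw [map_sub, line_refl ha hx, Polynomial.X_pow_dvd_iff]
  have hc : ∀ r, (line x a f - (line x a f).comp (-Polynomial.X)).coeff r =
      (line x a f).coeff r * (1 - (-1) ^ r) := by
    intro r
    have : (-Polynomial.X : Polynomial ℂ) = Polynomial.C (-1) * Polynomial.X := by simp
    rw [Polynomial.coeff_sub, this, Polynomial.comp_C_mul_X_coeff]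
    ring
  constructor
  · intro h r hr ho
    have := h r (by omega)
    rw [hc, ho.neg_one_pow] at this
    norm_num at this
    exact this
  · intro h r hr
    rw [hc]
    rcases Nat.even_or_odd r with he | ho
    · simp [he.neg_one_pow]
    -- The bound r < 2m+1 improves to r < 2m for odd r, since 2m is even.
    · rw [h r (by obtain ⟨k, hk⟩ := ho; omega) ho, zero_mul]

theorem refl_eq_mem_quasiInv {a : Fin N → ℂ} {m : ℕ} {f : Poly N} (h : refl a f = f) :
    f ∈ quasiInv a m := by
  rw [mem_quasiInv, h, sub_self]
  exact dvd_zero _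

theorem isHomogeneous_shear {a : Fin N → ℂ} {c : ℂ} {f : Poly N} {k : ℕ}
    (hf : f.IsHomogeneous k) : (shear a c f).IsHomogeneous k := by
  have := hf.aeval (n := 1) (fun i => X i - C (c * a i) * clin a) fun i =>
    (isHomogeneous_X ℂ i).sub ((clin_isHomogeneous a).C_mul _)
  simpa [shear] using this

theorem homogeneousComponent_refl (a : Fin N → ℂ) (f : Poly N) (k : ℕ) :
    homogeneousComponent k (refl a f) = refl a (homogeneousComponent k f) := by
  conv_lhs => rw [← sum_homogeneousComponent f, map_sum, map_sum]
  by_cases hk : k ∈ Finset.range (f.totalDegree + 1)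
  · rw [Finset.sum_eq_single_of_mem k hk]
    · exact homogeneousComponent_eq_self
        (isHomogeneous_shear (homogeneousComponent_isHomogeneous _ _))
    · intro j _ hj
      rw [refl, homogeneousComponent_of_mem
        (isHomogeneous_shear (homogeneousComponent_isHomogeneous j f)), if_neg hj.symm]
  · rw [homogeneousComponent_eq_zero k f (by simpa using hk), map_zero]
    refine Finset.sum_eq_zero fun j hj => ?_
    rw [refl, homogeneousComponent_of_mem
        (isHomogeneous_shear (homogeneousComponent_isHomogeneous j f)), if_neg]
    rintro rfl
    exact hk hj

-- A principal ideal with homogeneous generator is a homogeneous ideal.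
attribute [local instance] MvPolynomial.gradedAlgebra in
theorem IsHomogeneous.dvd_homogeneousComponent {g : Poly N} {n : ℕ} (hg : g.IsHomogeneous n)
    {f : Poly N} (h : g ∣ f) (k : ℕ) : g ∣ homogeneousComponent k f := by
  rw [← Ideal.mem_span_singleton] at h ⊢
  refine homogeneousComponent_mem_of_mem (Ideal.homogeneous_span _ _ ?_) h k
  rintro x rfl
  exact ⟨n, hg⟩

theorem homogeneousComponent_mem_quasiInv {a : Fin N → ℂ} {m : ℕ} {f : Poly N}
    (hf : f ∈ quasiInv a m) (k : ℕ) : homogeneousComponent k f ∈ quasiInv a m := by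
  rw [mem_quasiInv] at hf ⊢
  rw [← homogeneousComponent_refl, ← map_sub]
  exact IsHomogeneous.dvd_homogeneousComponent ((clin_isHomogeneous a).pow _) hf k

/-! ### Taylor coefficients of functions of one variable -/

/-- `s` is the Taylor series of the smooth function `g` at `0`. -/
def HasTaylor (g : ℂ → ℂ) (s : PowerSeries ℂ) : Prop :=
  ContDiff ℂ ⊤ g ∧ ∀ k, iteratedDeriv k g 0 = (k.factorial : ℂ) * PowerSeries.coeff k s

theorem HasTaylor.mul {f g : ℂ → ℂ} {s t : PowerSeries ℂ} (hf : HasTaylor f s)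
    (hg : HasTaylor g t) : HasTaylor (fun x => f x * g x) (s * t) := by
  refine ⟨hf.1.mul hg.1, fun k => ?_⟩
  rw [iteratedDeriv_fun_mul (hf.1.contDiffAt.of_le le_top) (hg.1.contDiffAt.of_le le_top),
    PowerSeries.coeff_mul, Finset.Nat.sum_antidiagonal_eq_sum_range_succ_mk, Finset.mul_sum]
  refine Finset.sum_congr rfl fun i hi => ?_
  have hi : i ≤ k := by simpa [Nat.lt_succ_iff] using hi
  rw [hf.2, hg.2, ← Nat.choose_mul_factorial_mul_factorial hi]
  push_cast
  ring

theorem hasTaylor_polynomial (p : Polynomial ℂ) : HasTaylor (fun t => p.eval t) p := by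
  refine ⟨by simpa using p.contDiff_aeval (𝕜 := ℂ) ⊤, fun k => ?_⟩
  have : ∀ k : ℕ, iteratedDeriv k (fun t => p.eval t) =
      fun t => (Polynomial.derivative^[k] p).eval t := by
    intro k
    induction k with
    | zero => simp
    | succ k ih =>
      rw [iteratedDeriv_succ, ih, Function.iterate_succ_apply']
      funext t
      exact Polynomial.deriv _
  rw [this]
  beta_reduce
  rw [← Polynomial.coeff_zero_eq_eval_zero, Polynomial.coeff_iterate_derivative]
  simp [Nat.descFactorial_self]

theorem hasTaylor_exp (c : ℂ) :
    HasTaylor (fun t => Complex.exp (c * t)) (PowerSeries.rescale c (PowerSeries.exp ℂ)) := by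
  refine ⟨by fun_prop, fun k => ?_⟩
  rw [iteratedDeriv_cexp_const_mul]
  have := Nat.cast_ne_zero (R := ℂ).2 k.factorial_ne_zero
  simp [PowerSeries.coeff_rescale, PowerSeries.coeff_exp]
  field_simp

theorem Configuration.bil_self_ne_zero (A : Configuration N) {α : Fin N → ℝ}
    (hα : α ∈ A.vectors) : bil (cvec α) (cvec α) ≠ 0 := by
  have h : bil (cvec α) (cvec α) = ((∑ i, α i * α i : ℝ) : ℂ) := by
    simp [bil, cvec]
  rw [h, Complex.ofReal_ne_zero]
  intro h0
  rw [Finset.sum_eq_zero_iff_of_nonneg fun i _ => mul_self_nonneg _] at h0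
  exact A.ne_zero α hα (funext fun i => by simpa using h0 i (Finset.mem_univ i))

/-- The algebra `Q_A` of quasi-invariant polynomials. -/
def Configuration.quasi (A : Configuration N) : Subalgebra ℂ (Poly N) :=
  ⨅ α : A.vectors, quasiInv (cvec α.1) (A.mult α.1)

theorem Configuration.mem_quasi {A : Configuration N} {f : Poly N} :
    f ∈ A.quasi ↔ ∀ α ∈ A.vectors, f ∈ quasiInv (cvec α) (A.mult α) := by
  simp [Configuration.quasi, Algebra.mem_iInf]

theorem homogeneousComponent_mem_quasi {A : Configuration N} {f : Poly N} (hf : f ∈ A.quasi)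
    (k : ℕ) : homogeneousComponent k f ∈ A.quasi := by
  rw [Configuration.mem_quasi] at hf ⊢
  exact fun α hα => homogeneousComponent_mem_quasiInv (hf α hα) k

/-- Passage from the analytic definition to divisibility: ∂_α^{2s-1} f at a point of the hyperplane
is (2s-1)! times a Taylor coefficient on the normal line. -/
theorem quasiInvariant_iff {A : Configuration N} {f : Poly N} :
    QuasiInvariant A f ↔ f ∈ A.quasi := by
  rw [Configuration.mem_quasi]
  refine forall₂_congr fun α hα => ?_
  rw [mem_quasiInv_iff_coeff (A.bil_self_ne_zero hα)]
  have key : ∀ (x : Fin N → ℂ) (n : ℕ),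
      iteratedDeriv n (fun t : ℂ => eval (x + t • cvec α) f) 0 = 0 ↔
        (line x (cvec α) f).coeff n = 0 := by
    intro x n
    have h := (hasTaylor_polynomial (line x (cvec α) f)).2 n
    simp only [eval_line, Polynomial.coeff_coe] at h
    rw [h, mul_eq_zero, or_iff_right (Nat.cast_ne_zero.2 n.factorial_ne_zero)]
  simp only [key]
  constructor
  · rintro h x hx r hr ⟨k, rfl⟩
    exact h (k + 1) (by omega) (by omega) x hx
  · intro h s h1 h2 x hx
    exact h x hx _ (by omega) ⟨s - 1, by omega⟩

end

/-! ### The operator A_m L on quasi-invariants -/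

section

theorem pow_dvd_gam {a : Fin N → ℂ} {n : ℕ} {h : Poly N} (hd : clin a ^ (n + 1) ∣ h)
    (f : Poly N) : clin a ^ n ∣ gam f h := by
  obtain ⟨g, rfl⟩ := hd
  rw [gam_mul_right, Derivation.leibniz_pow]
  simp only [Nat.add_sub_cancel, smul_eq_mul, nsmul_eq_mul]
  refine dvd_add ?_ ?_
  · rw [pow_succ, mul_assoc]; exact dvd_mul_right _ _
  · exact ((dvd_mul_right _ _).mul_left _).mul_left _

/-- With g = ∂_a f, the derivative of f - s f is g + s g because ∂_a anticommutes with s, so (a,x)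
divides g + s g. It always divides g - s g, hence 2g. -/
theorem clin_dvd_gam_of_mem_quasiInv {a : Fin N → ℂ} (ha : bil a a ≠ 0) {m : ℕ} (hm : m ≠ 0)
    {f : Poly N} (hf : f ∈ quasiInv a m) : clin a ∣ gam (clin a) f := by
  have h1 : clin a ∣ gam (clin a) f + refl a (gam (clin a) f) := by
    have : gam (clin a) f + refl a (gam (clin a) f) = gam (clin a) (f - refl a f) := by
      rw [map_sub, gam_clin_refl ha, sub_neg_eq_add]
    rw [this]
    have := pow_dvd_gam (n := 1) ((pow_dvd_pow _ (by omega)).trans hf) (clin a)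
    rwa [pow_one] at this
  have h2 := dvd_add h1 (clin_dvd_sub_refl a (gam (clin a) f))
  rw [add_add_sub_cancel, ← two_mul, show (2 : Poly N) = C 2 from (map_ofNat C 2).symm] at h2
  rcases (clin_prime ha).dvd_or_dvd h2 with h3 | h3
  · exact absurd (isUnit_of_dvd_unit h3 ((isUnit_iff_ne_zero.2 two_ne_zero).map C))
      (clin_prime ha).not_isUnit
  · exact h3

/-- `A L`, where `L` is the Calogero--Moser operator with `A` as its gauge factor. -/
def lhat (p : Poly N) : Poly N →ₗ[ℂ] Poly N :=
  LinearMap.mulLeft ℂ p ∘ₗ lap - (2 : ℂ) • (gam p).toLinearMap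

theorem lhat_apply (p f : Poly N) : lhat p f = p * lap f - 2 * gam p f := by
  simp [lhat, two_smul, two_mul]

/-- Expansion of `ℓ² L_ℓ (ℓ^n h)` in powers of `ℓ = (a, x)`. -/
theorem lap_sub_gam_clin_pow_mul (a : Fin N → ℂ) (n m : ℕ) (h : Poly N) :
    clin a ^ 2 * lap (clin a ^ n * h) - 2 * (m : Poly N) * (clin a * gam (clin a) (clin a ^ n * h)) =
      clin a ^ n * (C (bil a a * (n * ((n : ℂ) - 1 - 2 * m))) * h +
        clin a * (clin a * lap h + (2 * (n : Poly N) - 2 * (m : Poly N)) * gam (clin a) h)) := by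
  have h1 := gam_pow_left h (clin a) n
  have h2 := gam_pow_right (clin a) (clin a) n
  have h3 := lap_clin_pow a n
  rw [gam_clin_clin] at h2
  rw [lap_mul, gam_mul_right]
  simp only [map_mul, map_sub, map_natCast, map_one, map_ofNat] at *
  linear_combination (2 * clin a) * h1 - 2 * m * h * h2 + h * h3

variable (A : Configuration N)

/-- The cofactor of `(α, x)^{m_α}` in `A_m`. -/
def Configuration.cofactor (α : Fin N → ℝ) : Poly N :=
  ∏ β ∈ A.vectors.erase α, linForm β ^ A.mult β

/-- All cofactors of `A_m` are quasi-invariant. -/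
def Configuration.Locus : Prop :=
  ∀ α ∈ A.vectors, A.cofactor α ∈ quasiInv (cvec α) (A.mult α)

variable {A}

theorem Configuration.poly_eq {α : Fin N → ℝ} (hα : α ∈ A.vectors) :
    A.poly = clin (cvec α) ^ A.mult α * A.cofactor α := by
  rw [Configuration.poly, Configuration.cofactor, ← Finset.mul_prod_erase _ _ hα, linForm_eq]

theorem Configuration.poly_ne_zero : A.poly ≠ 0 :=
  Finset.prod_ne_zero_iff.2 fun _ hα => pow_ne_zero _ (clin_ne_zero (A.bil_self_ne_zero hα))

theorem Configuration.poly_isHomogeneous : A.poly.IsHomogeneous A.totalMult := by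
  refine IsHomogeneous.prod _ _ _ fun α _ => ?_
  simpa [linForm_eq] using (clin_isHomogeneous (cvec α)).pow (A.mult α)

/-- If (α,x) divided (β,x), the component of β orthogonal to α would lie in the hyperplane and be
isotropic. It is a real vector, so it would be zero, against non-collinearity. -/
theorem clin_not_dvd_clin {α β : Fin N → ℝ} (hα : α ∈ A.vectors) (hβ : β ∈ A.vectors)
    (h : α ≠ β) : ¬ clin (cvec α) ∣ clin (cvec β) := by
  rw [clin_dvd_iff (A.bil_self_ne_zero hα)]
  intro hv
  set k := bil (cvec α) (cvec β) / bil (cvec α) (cvec α)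
  have hk := A.bil_self_ne_zero hα
  have h0 : cvec β - k • cvec α = 0 := by
    by_contra hne
    -- Reality of the coefficient is what excludes nonzero isotropic vectors of ℂ^N.
    have hreal : ∃ r : ℝ, k = r := by
      refine ⟨(∑ i, α i * β i) / ∑ i, α i * α i, ?_⟩
      simp [k, bil, cvec]
    obtain ⟨r, hr⟩ := hreal
    have h1 : bil (cvec α) (cvec β - k • cvec α) = 0 := by
      rw [bil_sub_right, bil_smul_right]; simp only [k]; field_simp; ring
    have h2 := hv _ h1
    rw [eval_clin] at h2
    have h3 : bil (cvec β - k • cvec α) (cvec β - k • cvec α) = 0 := by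
      have h1' := h1
      rw [bil_comm] at h1'
      rw [bil_comm] at h2
      rw [bil_sub_right, h2, bil_smul_right, h1']
      simp
    apply hne
    have h4 : cvec β - k • cvec α = cvec (β - r • α) := by
      funext i; simp [cvec, hr]
    rw [h4] at h3 ⊢
    have h5 : bil (cvec (β - r • α)) (cvec (β - r • α)) =
        ((∑ i, (β - r • α) i * (β - r • α) i : ℝ) : ℂ) := by simp [bil, cvec]
    rw [h5, Complex.ofReal_eq_zero,
      Finset.sum_eq_zero_iff_of_nonneg fun i _ => mul_self_nonneg _] at h3
    funext i
    have := h3 i (Finset.mem_univ i)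
    rw [mul_self_eq_zero] at this
    simp [cvec, this]
  have hlin := A.non_collinear α hα β hβ h
  rw [LinearIndependent.pair_iff] at hlin
  have hr : k = (k.re : ℂ) := by
    have : k = (((∑ i, α i * β i) / ∑ i, α i * α i : ℝ) : ℂ) := by
      simp [k, bil, cvec]
    rw [this, Complex.ofReal_re]
  have := hlin (-k.re) 1 (by
    funext i
    have h1 := congr_fun h0 i
    rw [hr] at h1
    simp only [cvec, Pi.sub_apply, Pi.smul_apply, smul_eq_mul, Pi.zero_apply] at h1
    have h2 : β i - k.re * α i = 0 := by exact_mod_cast h1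
    simp only [Pi.add_apply, Pi.smul_apply, smul_eq_mul, Pi.zero_apply]
    linarith)
  exact one_ne_zero this.2

theorem not_dvd_cofactor {α : Fin N → ℝ} (hα : α ∈ A.vectors) :
    ¬ clin (cvec α) ∣ A.cofactor α := by
  intro h
  have hp := clin_prime (A.bil_self_ne_zero hα)
  obtain ⟨β, hβ, hd⟩ := (Prime.dvd_finsetProd_iff hp _).1 h
  have hβ' := Finset.mem_erase.1 hβ
  exact clin_not_dvd_clin hα hβ'.2 hβ'.1.symm (hp.dvd_of_dvd_pow hd)

/-- The logarithmic derivative of the product has only simple poles along the hyperplanes, and the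
vanishing of ∂_β f cancels them. -/
theorem prod_dvd_gam {f : Poly N} (s : Finset (Fin N → ℝ)) (m : (Fin N → ℝ) → ℕ)
    (h : ∀ β ∈ s, m β ≠ 0 → clin (cvec β) ∣ gam (clin (cvec β)) f) :
    (∏ β ∈ s, linForm β ^ m β) ∣ gam (∏ β ∈ s, linForm β ^ m β) f := by
  classical
  induction s using Finset.induction_on with
  | empty => simp [gam_apply]
  | insert β s hβ ih =>
    rw [Finset.prod_insert hβ, gam_mul_left]
    refine dvd_add (mul_dvd_mul_left _ (ih fun γ hγ => h γ (Finset.mem_insert_of_mem hγ))) ?_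
    rw [mul_comm]
    refine mul_dvd_mul_left _ ?_
    rcases hm : m β with _ | n
    · simp
    · rw [linForm_eq, gam_comm, Derivation.leibniz_pow]
      simp only [Nat.add_sub_cancel, smul_eq_mul, nsmul_eq_mul]
      rw [pow_succ, gam_comm]
      exact (mul_dvd_mul_left _ (h β (Finset.mem_insert_self _ _) (by omega))).mul_left _

theorem poly_dvd_lhat {f : Poly N} (hf : f ∈ A.quasi) : A.poly ∣ lhat A.poly f := by
  rw [lhat_apply]
  refine dvd_sub (dvd_mul_right _ _) (Dvd.dvd.mul_left (prod_dvd_gam _ _ fun β hβ hm => ?_) _)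
  exact clin_dvd_gam_of_mem_quasiInv (A.bil_self_ne_zero hβ) hm
    (Configuration.mem_quasi.1 hf β hβ)

/-- An anti-invariant polynomial vanishes to odd order along the mirror: after removal of an even
power of (a,x) the quotient is still anti-invariant, so it vanishes there. -/
theorem pow_dvd_of_odd {a : Fin N → ℂ} (ha : bil a a ≠ 0) {n : ℕ} {u : Poly N}
    (hu : refl a u = -u) (h : clin a ^ (2 * n) ∣ u) : clin a ^ (2 * n + 1) ∣ u := by
  obtain ⟨g, rfl⟩ := h
  rw [map_mul, map_pow, refl_clin_self ha, Even.neg_pow ⟨n, two_mul n⟩, ← mul_neg] at hu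
  have hg := mul_left_cancel₀ (pow_ne_zero _ (clin_ne_zero ha)) hu
  rw [pow_succ]
  refine mul_dvd_mul_left _ ?_
  have h1 := clin_dvd_sub_refl a g
  rw [hg, sub_neg_eq_add, ← two_mul, show (2 : Poly N) = C 2 from (map_ofNat C 2).symm] at h1
  rcases (clin_prime ha).dvd_or_dvd h1 with h3 | h3
  · exact absurd (isUnit_of_dvd_unit h3 ((isUnit_iff_ne_zero.2 two_ne_zero).map C))
      (clin_prime ha).not_isUnit
  · exact h3

theorem mul_eq_lhat_reduce {a : Fin N → ℂ} (ha : bil a a ≠ 0) {m : ℕ} {B f g : Poly N}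
    (hg : clin a ^ m * B * g = lhat (clin a ^ m * B) f) :
    clin a * B * g = clin a * B * lap f - 2 * (m : Poly N) * B * gam (clin a) f - 2 * clin a * gam B f := by
  have h1 := gam_pow_left f (clin a) m
  rw [lhat_apply, gam_mul_left] at hg
  apply mul_left_cancel₀ (pow_ne_zero m (clin_ne_zero ha))
  linear_combination clin a * hg - 2 * B * h1

/-- Compare the equation for g with its reflection. Since f - s f = (a,x)^{2m+1} h and 2m+1 is a
root of the indicial polynomial n(n-1-2m), the singular part of L does not lower this order; the
terms with B differ by multiples of (a,x)^{2m} because B is quasi-invariant. Hence (a,x)^{2m}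
divides g - s g, and oddness gives one more factor. -/
theorem mem_quasiInv_of_lhat {a : Fin N → ℂ} (ha : bil a a ≠ 0) {m : ℕ} {B f g : Poly N}
    (hB : B ∈ quasiInv a m) (hBd : ¬ clin a ∣ B) (hf : f ∈ quasiInv a m)
    (hg : clin a ^ m * B * g = lhat (clin a ^ m * B) f) : g ∈ quasiInv a m := by
  have hp := clin_prime ha
  have h1 := mul_eq_lhat_reduce ha hg
  have h2 := congrArg (refl a) h1
  simp only [map_mul, map_sub, map_ofNat, map_natCast, refl_clin_self ha, ← lap_refl ha,
    ← gam_refl ha] at h2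
  have h3 := gam_clin_refl ha f
  rw [← gam_refl ha, refl_clin_self ha] at h3
  set B' := refl a B
  set f' := refl a f
  set g' := refl a g
  have hBd' : ¬ clin a ∣ B' := by
    intro h
    apply hBd
    have := dvd_add (clin_dvd_sub_refl a B) h
    rwa [sub_add_cancel] at this
  have hBB : clin a ^ (2 * m + 1) ∣ B' - B := by
    rw [← neg_sub]; exact (dvd_neg.2 hB)
  obtain ⟨h, hh⟩ := hf
  have hL : clin a ^ (2 * m + 1) ∣
      clin a * lap (f - f') - 2 * (m : Poly N) * gam (clin a) (f - f') := by
    rw [← mul_dvd_mul_iff_left (clin_ne_zero ha)]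
    have := lap_sub_gam_clin_pow_mul a (2 * m + 1) m h
    rw [show (f - f' : Poly N) = _ from hh]
    have e : clin a * (clin a * lap (clin a ^ (2 * m + 1) * h) -
        2 * (m : Poly N) * gam (clin a) (clin a ^ (2 * m + 1) * h)) = clin a * clin a ^ (2 * m + 1) *
        (clin a * lap h + (2 * ((2 * m + 1 : ℕ) : Poly N) - 2 * (m : Poly N)) * gam (clin a) h) := by
      -- The indicial polynomial n(n-1-2m) vanishes at n = 2m+1; without this only (a,x)^{2m} could
      -- be split off after cancelling one factor.
      have z : (C (bil a a * ((2 * m + 1 : ℕ) * (((2 * m + 1 : ℕ) : ℂ) - 1 - 2 * m))) : Poly N)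
          = 0 := by
        rw [← C_0]; congr 1; push_cast; ring
      rw [z] at this
      linear_combination this
    rw [e]
    exact dvd_mul_right _ _
  have hG : clin a ^ (2 * m) ∣ (B' - B) * gam B f + B * gam (B - B') f + B * gam B' (f - f') := by
    refine dvd_add (dvd_add ?_ ?_) ?_
    · exact ((pow_dvd_pow _ (by omega)).trans hBB).mul_right _
    · rw [gam_comm]; exact (pow_dvd_gam hB _).mul_left _
    · exact (pow_dvd_gam ⟨h, hh⟩ _).mul_left _
  -- B' times the equation plus B times its reflection; the sum is sorted into the singular operator
  -- on f - f' and first-order terms that each contain one of the small differences.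
  have hE : clin a * (B * B' * (g - g')) =
      B * B' * (clin a * lap (f - f') - 2 * (m : Poly N) * gam (clin a) (f - f')) -
        2 * (clin a * ((B' - B) * gam B f + B * gam (B - B') f + B * gam B' (f - f'))) := by
    have h4 : gam (clin a) f' = - gam (-clin a) f' := by
      rw [← zero_sub (clin a), gam_sub_left]; simp [gam_apply]
    simp only [map_sub, gam_sub_left]
    linear_combination B' * h1 + B * h2 - 2 * (m : Poly N) * B * B' * h4
  have hd : clin a ^ (2 * m + 1) ∣ clin a * (B * B' * (g - g')) := by
    rw [hE]
    refine dvd_sub (hL.mul_left _) (Dvd.dvd.mul_left ?_ _)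
    rw [pow_succ, mul_comm]
    exact mul_dvd_mul_left _ hG
  rw [pow_succ', mul_dvd_mul_iff_left (clin_ne_zero ha)] at hd
  have hd' := hp.pow_dvd_of_dvd_mul_left _ (by
    rw [hp.dvd_mul, not_or]; exact ⟨hBd, hBd'⟩) hd
  exact pow_dvd_of_odd ha (by rw [map_sub, refl_refl ha]; ring) hd'

/-- On the locus the Calogero--Moser operator preserves the quasi-invariants. -/
theorem Configuration.Locus.exists_lhat (hA : A.Locus) {f : Poly N} (hf : f ∈ A.quasi) :
    ∃ g ∈ A.quasi, A.poly * g = lhat A.poly f := by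
  obtain ⟨g, hg⟩ := poly_dvd_lhat hf
  refine ⟨g, Configuration.mem_quasi.2 fun α hα => ?_, hg.symm⟩
  rw [A.poly_eq hα] at hg
  exact mem_quasiInv_of_lhat (A.bil_self_ne_zero hα) (hA α hα) (not_dvd_cofactor hα)
    (Configuration.mem_quasi.1 hf α hα) hg.symm

end

section

/-! ### Exponential series -/

section ExpSer

variable {R S : Type*} [CommRing R] [Algebra ℚ R] [CommRing S] [Algebra ℚ S]

/-- The series `∑ u^n / n! X^n`. -/
def expSer (u : R) : PowerSeries R := PowerSeries.rescale u (PowerSeries.exp R)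

theorem coeff_expSer (u : R) (n : ℕ) :
    PowerSeries.coeff n (expSer u) = u ^ n * algebraMap ℚ R (1 / n.factorial) := by
  rw [expSer, PowerSeries.coeff_rescale, PowerSeries.coeff_exp]

theorem expSer_mul_expSer (u v : R) : expSer u * expSer v = expSer (u + v) :=
  PowerSeries.exp_mul_exp_eq_exp_add u v

theorem expSer_zero : expSer (0 : R) = 1 := by
  rw [expSer, PowerSeries.rescale_zero_apply, PowerSeries.constantCoeff_exp, map_one]

theorem expSer_mul_expSer_neg (u : R) : expSer u * expSer (-u) = 1 := by
  rw [expSer_mul_expSer, add_neg_cancel, expSer_zero]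

theorem map_expSer (f : R →+* S) (u : R) : PowerSeries.map f (expSer u) = expSer (f u) := by
  ext n
  rw [PowerSeries.coeff_map, coeff_expSer, coeff_expSer, map_mul, map_pow]
  congr 1
  simp

theorem mul_expSer_right_cancel {s t : PowerSeries R} {u : R} (h : s * expSer u = t * expSer u) :
    s = t := by
  have := congrArg (· * expSer (-u)) h
  simpa only [mul_assoc, expSer_mul_expSer_neg, mul_one] using this

end ExpSer

section Coefficientwise

variable {R S : Type*} [CommRing R] [Algebra ℂ R] [CommRing S] [Algebra ℂ S]

/-- Coefficientwise application of a linear map to a power series. -/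
def cw (f : R →ₗ[ℂ] S) (s : PowerSeries R) : PowerSeries S :=
  PowerSeries.mk fun n => f (PowerSeries.coeff n s)

theorem coeff_cw (f : R →ₗ[ℂ] S) (s : PowerSeries R) (n : ℕ) :
    PowerSeries.coeff n (cw f s) = f (PowerSeries.coeff n s) := by
  simp [cw]

/-- A derivation of the coefficients extends to power series by acting trivially on the
indeterminate. -/
theorem cw_derivation_mul (D : Derivation ℂ R R) (s t : PowerSeries R) :
    cw D.toLinearMap (s * t) = cw D.toLinearMap s * t + s * cw D.toLinearMap t := by
  ext n
  simp only [coeff_cw, map_add, PowerSeries.coeff_mul, map_sum, Derivation.coeFn_coe,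
    Derivation.leibniz, smul_eq_mul, Finset.sum_add_distrib]
  rw [add_comm]
  congr 1
  exact Finset.sum_congr rfl fun i _ => mul_comm _ _

theorem cw_mulLeft (a : R) (s : PowerSeries R) :
    cw (LinearMap.mulLeft ℂ a) s = PowerSeries.C a * s := by
  ext n
  simp [coeff_cw]

theorem cw_derivation_expSer (D : Derivation ℂ R R) (u : R) [Algebra ℚ R] :
    cw D.toLinearMap (expSer u) = PowerSeries.X * PowerSeries.C (D u) * expSer u := by
  ext n
  rw [coeff_cw, mul_assoc]
  cases n with
  | zero => simp [coeff_expSer]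
  | succ n =>
    rw [PowerSeries.coeff_succ_X_mul, PowerSeries.coeff_C_mul, coeff_expSer, coeff_expSer,
      Derivation.coeFn_coe, Derivation.leibniz, Derivation.leibniz_pow]
    have h1 : D (algebraMap ℚ R (1 / (n + 1).factorial)) = 0 := by
      have : algebraMap ℚ R (1 / (n + 1).factorial) =
          algebraMap ℂ R (algebraMap ℚ ℂ (1 / (n + 1).factorial)) := by
        rw [← RingHom.comp_apply]
        exact congrArg (fun f : ℚ →+* R => f _) (Subsingleton.elim _ _)
      rw [this, Derivation.map_algebraMap]
    have h2 : algebraMap ℚ R (1 / n.factorial) =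
        (n + 1 : ℕ) * algebraMap ℚ R (1 / (n + 1).factorial) := by
      rw [← map_natCast (algebraMap ℚ R), ← map_mul]
      congr 1
      have := Nat.cast_ne_zero (R := ℚ).2 n.factorial_ne_zero
      have := Nat.cast_ne_zero (R := ℚ).2 n.succ_ne_zero
      rw [Nat.factorial_succ]
      push_cast
      field_simp
    rw [h1, h2]
    simp only [smul_eq_mul, nsmul_eq_mul, Nat.add_sub_cancel]
    ring

end Coefficientwise

/-! ### The Calogero–Moser operator conjugated by an exponential -/

theorem cw_lap (s : PowerSeries (Poly N)) :
    cw lap s = ∑ i, cw (pderiv i).toLinearMap (cw (pderiv i).toLinearMap s) := by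
  ext n : 1
  rw [map_sum]
  simp [coeff_cw, lap_apply]

theorem cw_gam (p : Poly N) (s : PowerSeries (Poly N)) :
    cw (gam p).toLinearMap s =
      ∑ i, PowerSeries.C (pderiv i p) * cw (pderiv i).toLinearMap s := by
  ext n : 1
  rw [map_sum]
  simp [coeff_cw, gam_apply]

theorem cw_lhat (p : Poly N) (s : PowerSeries (Poly N)) :
    cw (lhat p) s = PowerSeries.C p * cw lap s - 2 * cw (gam p).toLinearMap s := by
  ext n : 1
  have : (2 : PowerSeries (Poly N)) = PowerSeries.C 2 := (map_ofNat PowerSeries.C 2).symm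
  rw [this]
  simp [coeff_cw, lhat_apply]

/-- Conjugation of `L̂` by `e^{(x, y)}`. -/
def twist (p : Poly N) (y : Fin N → ℂ) (s : PowerSeries (Poly N)) : PowerSeries (Poly N) :=
  cw (lhat p) s + 2 * (PowerSeries.X * (PowerSeries.C p * cw (gam (clin y)).toLinearMap s -
    PowerSeries.C (gam p (clin y)) * s))

/-- Differentiating the exponential brings down y_i together with one factor of the degree-recording
indeterminate. Thus `twist` being zero says that s e^{(x,y)} is an eigenfunction of L with
eigenvalue (y,y), the factor X² recording that L lowers degrees by two. -/
theorem cw_lhat_mul_expSer (p : Poly N) (y : Fin N → ℂ) (s : PowerSeries (Poly N)) :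
    cw (lhat p) (s * expSer (clin y)) =
      (twist p y s + PowerSeries.X ^ 2 * PowerSeries.C (p * C (bil y y)) * s) *
        expSer (clin y) := by
  have h1 : ∀ i, cw (pderiv i).toLinearMap (s * expSer (clin y)) =
      (cw (pderiv i).toLinearMap s + PowerSeries.X * PowerSeries.C (C (y i)) * s) *
        expSer (clin y) := by
    intro i
    rw [cw_derivation_mul, cw_derivation_expSer, pderiv_clin]
    ring
  have hX : ∀ i : Fin N, cw (pderiv i).toLinearMap (PowerSeries.X * PowerSeries.C (C (y i)) * s) =
      PowerSeries.X * PowerSeries.C (C (y i)) * cw (pderiv i).toLinearMap s := by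
    intro i
    ext n : 1
    rw [mul_assoc, mul_assoc]
    cases n with
    | zero => simp [coeff_cw]
    | succ n => simp [coeff_cw, PowerSeries.coeff_succ_X_mul]
  have h2 : ∀ i, cw (pderiv i).toLinearMap (cw (pderiv i).toLinearMap (s * expSer (clin y))) =
      (cw (pderiv i).toLinearMap (cw (pderiv i).toLinearMap s) +
        2 * (PowerSeries.X * (PowerSeries.C (C (y i)) * cw (pderiv i).toLinearMap s)) +
        PowerSeries.X ^ 2 * s * PowerSeries.C (C (y i) * C (y i))) * expSer (clin y) := by
    intro i
    have hadd : ∀ s t : PowerSeries (Poly N), cw (pderiv i).toLinearMap (s + t) =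
        cw (pderiv i).toLinearMap s + cw (pderiv i).toLinearMap t := by
      intro s t; ext n : 1; simp [coeff_cw]
    rw [h1, cw_derivation_mul, hadd, hX, cw_derivation_expSer, pderiv_clin, map_mul]
    ring
  have hy : (∑ i, PowerSeries.C (C (y i) * C (y i)) : PowerSeries (Poly N)) =
      PowerSeries.C (C (bil y y)) := by
    rw [← map_sum, sum_C_mul_C]
  have h3 : cw lap (s * expSer (clin y)) = (cw lap s +
      2 * (PowerSeries.X * cw (gam (clin y)).toLinearMap s) +
      PowerSeries.X ^ 2 * s * PowerSeries.C (C (bil y y))) * expSer (clin y) := by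
    rw [cw_lap, cw_lap, cw_gam]
    simp only [h2, pderiv_clin]
    rw [← Finset.sum_mul, Finset.sum_add_distrib, Finset.sum_add_distrib, ← Finset.mul_sum,
      ← Finset.mul_sum, ← Finset.mul_sum, hy]
  have h4 := cw_derivation_mul (gam p) s (expSer (clin y))
  rw [cw_derivation_expSer] at h4
  rw [twist, cw_lhat, cw_lhat, h3, h4, map_mul]
  ring

/-! ### Vanishing of polynomial multiples of exponentials -/

-- The condition says that H = R(t)e^{zt} - R(-t)e^{-zt} is O(t^{2m+1}). Since deg R < m, applying
-- (d/dt - z)^m kills the first term and leaves O(t^{m+1}); what remains is a polynomial of degree <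
-- m times e^{-zt}, so it is zero. On that polynomial the operator is d/dt - 2z, which is injective
-- on polynomials for z ≠ 0; hence R = 0.
open PowerSeries in
theorem powerSeries_eq_zero_of_odd {m : ℕ} {z : ℂ} (hz : z ≠ 0) {R : PowerSeries ℂ}
    (hR : ∀ b, m ≤ b → PowerSeries.coeff b R = 0)
    (h : ∀ r < 2 * m, Odd r → PowerSeries.coeff r (R * expSer z) = 0) : R = 0 := by
  have hD : ∀ c : ℂ, d⁄dX ℂ (expSer c) = PowerSeries.C c * expSer c := by
    intro c
    ext n
    rw [coeff_derivative, coeff_expSer, PowerSeries.coeff_C_mul, coeff_expSer, Nat.factorial_succ]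
    have := Nat.cast_ne_zero (R := ℂ).2 n.factorial_ne_zero
    have : (n : ℂ) + 1 ≠ 0 := Nat.cast_add_one_ne_zero n
    simp only [one_div, map_inv₀, map_natCast]
    push_cast
    field_simp
    ring
  set R' := rescale (-1 : ℂ) R
  set H := R * expSer z - R' * expSer (-z) with hH
  have hneg : rescale (-1 : ℂ) (expSer z) = expSer (-z) := by
    rw [expSer, expSer, rescale_rescale]; simp
  have hHc : ∀ r < 2 * m + 1, PowerSeries.coeff r H = 0 := by
    intro r hr
    have e : PowerSeries.coeff r H = PowerSeries.coeff r (R * expSer z) * (1 - (-1) ^ r) := by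
      rw [hH, ← hneg, ← map_mul, map_sub, coeff_rescale]; ring
    rw [e]
    rcases Nat.even_or_odd r with he | ho
    · simp [he.neg_one_pow]
    · rw [h r (by obtain ⟨k, hk⟩ := ho; omega) ho, zero_mul]
  let T : PowerSeries ℂ → PowerSeries ℂ := fun f => d⁄dX ℂ f - PowerSeries.C z * f
  have hT : ∀ j, T^[j] H = (d⁄dX ℂ)^[j] R * expSer z -
      (fun f => d⁄dX ℂ f - PowerSeries.C (2 * z) * f)^[j] R' * expSer (-z) := by
    intro j
    induction j with
    | zero => rfl
    | succ j ih =>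
      rw [Function.iterate_succ_apply', ih, Function.iterate_succ_apply',
        Function.iterate_succ_apply']
      simp only [T, map_sub, Derivation.leibniz, hD, smul_eq_mul, map_mul, map_neg, map_ofNat]
      ring
  have hTc : ∀ j ≤ 2 * m, ∀ r < 2 * m + 1 - j, PowerSeries.coeff r (T^[j] H) = 0 := by
    intro j
    induction j with
    | zero => simpa using hHc
    | succ j ih =>
      intro hj r hr
      rw [Function.iterate_succ_apply']
      simp only [T, map_sub, coeff_derivative, PowerSeries.coeff_C_mul]
      rw [ih (by omega) _ (by omega), ih (by omega) _ (by omega)]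
      ring
  have hRm : (d⁄dX ℂ)^[m] R = 0 := by
    ext n
    rw [PowerSeries.coeff_iterate_derivative, hR _ (by omega)]
    simp
  have hbig : ∀ j b, m ≤ b → PowerSeries.coeff b
      ((fun f => d⁄dX ℂ f - PowerSeries.C (2 * z) * f)^[j] R') = 0 := by
    intro j
    induction j with
    | zero => intro b hb; simp [R', hR b hb]
    | succ j ih =>
      intro b hb
      rw [Function.iterate_succ_apply']
      simp only [map_sub, coeff_derivative, PowerSeries.coeff_C_mul]
      rw [ih _ (by omega), ih _ hb]
      ring
  have hzero : (fun f => d⁄dX ℂ f - PowerSeries.C (2 * z) * f)^[m] R' = 0 := by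
    have e : (fun f => d⁄dX ℂ f - PowerSeries.C (2 * z) * f)^[m] R' = -(T^[m] H * expSer z) := by
      rw [hT, hRm, zero_mul, zero_sub, neg_mul, neg_neg, mul_assoc, expSer_mul_expSer,
        neg_add_cancel, expSer_zero, mul_one]
    ext b
    rcases le_or_gt m b with hb | hb
    · rw [hbig m b hb, map_zero]
    · rw [e, map_neg, PowerSeries.coeff_mul, Finset.sum_eq_zero, neg_zero, map_zero]
      rintro ⟨i, j⟩ hij
      rw [Finset.HasAntidiagonal.mem_antidiagonal] at hij
      simp only at hij ⊢
      rw [hTc m (by omega) i (by omega), zero_mul]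
  -- Comparing coefficients from the top down: the coefficient of t^n in S is a multiple of that of
  -- t^{n+1}.
  have hinj : ∀ S : PowerSeries ℂ, (∀ b, m ≤ b → PowerSeries.coeff b S = 0) →
      d⁄dX ℂ S - PowerSeries.C (2 * z) * S = 0 → S = 0 := by
    intro S hS h0
    have hstep : ∀ n, PowerSeries.coeff (n + 1) S = 0 → PowerSeries.coeff n S = 0 := by
      intro n hn
      have := congrArg (PowerSeries.coeff n) h0
      rw [map_sub, coeff_derivative, PowerSeries.coeff_C_mul, hn, zero_mul, zero_sub, map_zero, neg_eq_zero,
        mul_eq_zero] at this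
      exact this.resolve_left (mul_ne_zero two_ne_zero hz)
    ext n
    rw [map_zero]
    have : ∀ k n, m ≤ n + k → PowerSeries.coeff n S = 0 := by
      intro k
      induction k with
      | zero => exact fun n hn => hS n hn
      | succ k ih => exact fun n hn => hstep n (ih (n + 1) (by omega))
    exact this m n (by omega)
  have hall : ∀ j, (fun f => d⁄dX ℂ f - PowerSeries.C (2 * z) * f)^[j] R' = 0 → R' = 0 := by
    intro j
    induction j with
    | zero => exact id
    | succ j ih =>
      intro h0
      rw [Function.iterate_succ_apply'] at h0
      exact ih (hinj _ (hbig j) h0)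
  have hR0 := hall m hzero
  ext b
  have := congrArg (PowerSeries.coeff b) hR0
  simp only [R', coeff_rescale, map_zero, mul_eq_zero] at this
  rw [map_zero]
  exact this.resolve_left (pow_ne_zero _ (by norm_num))

theorem C_mul_expSer_coeff (r k : ℕ) (z : ℂ) (s : PowerSeries (Polynomial ℂ)) :
    (PowerSeries.coeff k (s * expSer (Polynomial.C z * Polynomial.X))).coeff r =
      ∑ j ∈ Finset.range (r + k + 1), if j ≤ r ∧ j ≤ k then
        (PowerSeries.coeff (k - j) s).coeff (r - j) * PowerSeries.coeff j (expSer z) else 0 := by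
  have hc : ∀ j, PowerSeries.coeff j (expSer (Polynomial.C z * Polynomial.X)) =
      Polynomial.C (PowerSeries.coeff j (expSer z)) * Polynomial.X ^ j := by
    intro j
    have : algebraMap ℚ (Polynomial ℂ) (1 / j.factorial) =
        Polynomial.C (algebraMap ℚ ℂ (1 / j.factorial)) := rfl
    rw [coeff_expSer, coeff_expSer, this, map_mul, map_pow]
    ring
  rw [mul_comm, PowerSeries.coeff_mul, Finset.Nat.sum_antidiagonal_eq_sum_range_succ_mk,
    Polynomial.finsetSum_coeff]
  symm
  rw [← Finset.sum_filter]
  have hsub : (Finset.range (r + k + 1)).filter (fun j => j ≤ r ∧ j ≤ k) =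
      (Finset.range (k + 1)).filter (fun j => j ≤ r) := by
    ext j; simp only [Finset.mem_filter, Finset.mem_range]; omega
  rw [hsub, Finset.sum_filter]
  refine Finset.sum_congr rfl fun j _ => ?_
  rw [hc, mul_assoc, Polynomial.coeff_C_mul, Polynomial.coeff_X_pow_mul']
  split_ifs
  · ring
  · simp

theorem coeff_mul_expSer_C_mem {k r : ℕ} {w : ℂ} {s : PowerSeries (Polynomial ℂ)}
    (h : ∀ k, (PowerSeries.coeff k s).coeff r = 0) :
    (PowerSeries.coeff k (s * expSer (Polynomial.C w))).coeff r = 0 := by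
  rw [PowerSeries.coeff_mul, Polynomial.finsetSum_coeff]
  refine Finset.sum_eq_zero fun ij _ => ?_
  have : PowerSeries.coeff ij.2 (expSer (Polynomial.C w)) =
      Polynomial.C (w ^ ij.2 * algebraMap ℚ ℂ (1 / ij.2.factorial)) := by
    rw [coeff_expSer, map_mul, map_pow]; rfl
  rw [this, Polynomial.coeff_mul_C, h, zero_mul]

/-- If all homogeneous components of `(∑_{i ≤ n} s_i) e^{(x, y)}` are quasi-invariant with respect
to `a` and `(a, y) ≠ 0`, then the top coefficient `s_n` is divisible by `(a, x)^m`. -/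
theorem clin_pow_dvd_top {a y : Fin N → ℂ} (ha : bil a a ≠ 0) (hy : bil y a ≠ 0) {m n : ℕ}
    {s : PowerSeries (Poly N)} (hs : ∀ i, n < i → PowerSeries.coeff i s = 0)
    (hq : ∀ k, PowerSeries.coeff k (s * expSer (clin y)) ∈ quasiInv a m) :
    clin a ^ m ∣ PowerSeries.coeff n s := by
  rw [clin_pow_dvd_iff ha]
  intro x hx
  rw [Polynomial.X_pow_dvd_iff]
  intro k hk
  set σ : PowerSeries (Polynomial ℂ) := PowerSeries.map (line x a).toRingHom s with hσ
  -- On the line x + ta the exponential splits into e^{(y,x)}, constant in t, and e^{(y,a)t}. The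
  -- first factor is divided out; it does not mix powers of t.
  have hG : ∀ j, ∀ r < 2 * m, Odd r → (PowerSeries.coeff j
      (σ * expSer (Polynomial.C (bil y a) * Polynomial.X))).coeff r = 0 := by
    intro j r hr ho
    have e : σ * expSer (Polynomial.C (bil y a) * Polynomial.X) =
        PowerSeries.map (line x a).toRingHom (s * expSer (clin y)) *
          expSer (Polynomial.C (-bil y x)) := by
      rw [map_mul, map_expSer]
      have : (line x a).toRingHom (clin y) = line x a (clin y) := rfl
      rw [this, line_clin, mul_assoc, expSer_mul_expSer]
      congr 2
      rw [map_neg]; ring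
    rw [e]
    refine coeff_mul_expSer_C_mem fun i => ?_
    rw [PowerSeries.coeff_map]
    exact (mem_quasiInv_iff_coeff ha).1 (hq i) x hx r hr ho
  -- The exponential in t raises the grading index i and the power b of t by the same amount, so the
  -- diagonals of constant i - b decouple. R is the diagonal i - b = n - k; its coefficient at b = k
  -- is the one to be killed, and for b ≥ m > k its index i exceeds n.
  let R : PowerSeries ℂ := PowerSeries.mk fun b =>
    if k ≤ n + b then (PowerSeries.coeff (n + b - k) σ).coeff b else 0
  have hR : R = 0 := by
    refine powerSeries_eq_zero_of_odd (m := m) hy (fun b hb => ?_) fun r hr ho => ?_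
    · simp only [R, PowerSeries.coeff_mk]
      rw [hσ, PowerSeries.coeff_map, hs _ (by omega)]
      simp
    · rw [mul_comm, PowerSeries.coeff_mul, Finset.Nat.sum_antidiagonal_eq_sum_range_succ_mk]
      rcases le_or_gt k (n + r) with hkr | hkr
      · have := hG (n + r - k) r hr ho
        rw [C_mul_expSer_coeff] at this
        rw [← this]
        have hsub : (Finset.range (r + 1)) ⊆ Finset.range (r + (n + r - k) + 1) := by
          intro j; simp only [Finset.mem_range]; omega
        rw [← Finset.sum_subset hsub]
        · refine Finset.sum_congr rfl fun j hj => ?_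
          have hj : j ≤ r := by simpa [Nat.lt_succ_iff] using hj
          simp only [R, PowerSeries.coeff_mk]
          by_cases h1 : k ≤ n + (r - j)
          · rw [if_pos h1, if_pos ⟨hj, by omega⟩, mul_comm,
              show n + (r - j) - k = n + r - k - j by omega]
          · rw [if_neg h1, if_neg (by omega), mul_zero]
        · intro j _ hj
          rw [if_neg]
          simp only [Finset.mem_range] at hj
          omega
      · refine Finset.sum_eq_zero fun j _ => ?_
        simp only [R, PowerSeries.coeff_mk]
        rw [if_neg (by omega), mul_zero]
  have := congrArg (PowerSeries.coeff k) hR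
  simp only [R, PowerSeries.coeff_mk, map_zero] at this
  rw [if_pos (by omega), Nat.add_sub_cancel, hσ, PowerSeries.coeff_map] at this
  exact this

end

/-! ### Generic spectral parameters and uniqueness -/

section

/-- A spectral parameter outside all hyperplanes of the configuration. -/
def Configuration.Generic (A : Configuration N) (y : Fin N → ℂ) : Prop :=
  ∀ α ∈ A.vectors, bil (cvec α) y ≠ 0

variable {A : Configuration N}

theorem prod_dvd_of_forall_dvd {f : Poly N} {s : Finset (Fin N → ℝ)} (hs : s ⊆ A.vectors)
    (h : ∀ α ∈ s, clin (cvec α) ^ A.mult α ∣ f) : (∏ α ∈ s, linForm α ^ A.mult α) ∣ f := by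
  classical
  induction s using Finset.induction_on with
  | empty => simp
  | insert β s hβ ih =>
    have hβA := hs (Finset.mem_insert_self β s)
    obtain ⟨g, rfl⟩ := ih (fun γ hγ => hs (Finset.mem_insert_of_mem hγ))
      fun γ hγ => h γ (Finset.mem_insert_of_mem hγ)
    rw [Finset.prod_insert hβ, mul_comm]
    refine mul_dvd_mul_left _ ?_
    have hp := clin_prime (A.bil_self_ne_zero hβA)
    refine hp.pow_dvd_of_dvd_mul_left _ (fun hd => ?_) (h β (Finset.mem_insert_self _ _))
    obtain ⟨γ, hγ, hd⟩ := (Prime.dvd_finsetProd_iff hp _).1 hd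
    exact clin_not_dvd_clin hβA (hs (Finset.mem_insert_of_mem hγ))
      (fun e => hβ (e ▸ hγ)) (hp.dvd_of_dvd_pow hd)

theorem Configuration.Generic.poly_dvd_top {y : Fin N → ℂ} (hy : A.Generic y) {n : ℕ}
    {s : PowerSeries (Poly N)} (hs : ∀ i, n < i → PowerSeries.coeff i s = 0)
    (hq : ∀ k, PowerSeries.coeff k (s * expSer (clin y)) ∈ A.quasi) :
    A.poly ∣ PowerSeries.coeff n s := by
  refine prod_dvd_of_forall_dvd (Finset.Subset.refl _) fun α hα => ?_
  refine clin_pow_dvd_top (A.bil_self_ne_zero hα) (by rw [bil_comm]; exact hy α hα) hs fun k => ?_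
  exact Configuration.mem_quasi.1 (hq k) α hα

/-- A quasi-invariant polynomial multiple of `e^{(x, y)}` of degree less than `|m|` vanishes. -/
theorem Configuration.Generic.eq_zero {y : Fin N → ℂ} (hy : A.Generic y)
    {s : PowerSeries (Poly N)} {n : ℕ} (hs : ∀ i, n < i → PowerSeries.coeff i s = 0)
    (hdeg : ∀ i, PowerSeries.coeff i s ≠ 0 → (PowerSeries.coeff i s).totalDegree < A.totalMult)
    (hq : ∀ k, PowerSeries.coeff k (s * expSer (clin y)) ∈ A.quasi) : s = 0 := by
  -- The top coefficient is a multiple of A_m, of degree |m|, but has smaller degree, so it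
  -- vanishes; then the next coefficient is the top one.
  have key : ∀ n, (∀ i, n < i → PowerSeries.coeff i s = 0) → PowerSeries.coeff n s = 0 := by
    intro n hs
    by_contra hne
    obtain ⟨g, hg⟩ := hy.poly_dvd_top hs hq
    have h1 := hdeg n hne
    rw [hg] at h1 hne
    rw [totalDegree_mul_of_isDomain (left_ne_zero_of_mul hne) (right_ne_zero_of_mul hne),
      A.poly_isHomogeneous.totalDegree A.poly_ne_zero] at h1
    omega
  have : ∀ k i, n ≤ i + k → PowerSeries.coeff i s = 0 := by
    intro k
    induction k with
    | zero =>
      intro i hi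
      rcases Nat.eq_or_lt_of_le hi with rfl | h
      · exact key _ (by simpa using hs)
      · exact hs i h
    | succ k ih =>
      exact fun i hi => key i fun j hj => ih j (by omega)
  ext i : 1
  rw [this n i (by omega), map_zero]

theorem exists_generic (A : Configuration N) : ∃ y, A.Generic y := by
  have h : (∏ α ∈ A.vectors, clin (cvec α)) ≠ (0 : Poly N) :=
    Finset.prod_ne_zero_iff.2 fun α hα => clin_ne_zero (A.bil_self_ne_zero hα)
  by_contra hne
  push Not at hne
  apply h
  apply MvPolynomial.funext
  intro y
  have := hne y
  rw [Configuration.Generic] at this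
  push Not at this
  obtain ⟨α, hα, h0⟩ := this
  rw [map_prod, map_zero]
  exact Finset.prod_eq_zero hα (by rw [eval_clin, h0])

/-- A polynomial function vanishing at all generic points vanishes. -/
theorem eq_zero_of_generic {f : Poly N} (h : ∀ y, A.Generic y → eval y f = 0) : f = 0 := by
  have hp : (∏ α ∈ A.vectors, clin (cvec α)) ≠ (0 : Poly N) :=
    Finset.prod_ne_zero_iff.2 fun α hα => clin_ne_zero (A.bil_self_ne_zero hα)
  refine (mul_eq_zero.1 ?_).resolve_left hp
  apply MvPolynomial.funext
  intro y
  rw [map_mul, map_zero]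
  by_cases hy : A.Generic y
  · rw [h y hy, mul_zero]
  · rw [Configuration.Generic] at hy
    push Not at hy
    obtain ⟨α, hα, h0⟩ := hy
    rw [map_prod, Finset.prod_eq_zero hα (by rw [eval_clin, h0]), zero_mul]

theorem Configuration.Generic.smul {y : Fin N → ℂ} (hy : A.Generic y) {c : ℂ} (hc : c ≠ 0) :
    A.Generic (c • y) := by
  intro α hα
  rw [bil_smul_right]
  exact mul_ne_zero hc (hy α hα)

theorem IsHomogeneous.eval_smul {f : Poly N} {k : ℕ} (hf : f.IsHomogeneous k) (c : ℂ)
    (x : Fin N → ℂ) : eval (c • x) f = c ^ k * eval x f := by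
  rw [eval_eq, eval_eq, Finset.mul_sum]
  refine Finset.sum_congr rfl fun d hd => ?_
  have h1 : ∑ i, d i = k := by
    rw [← Finsupp.degree_eq_sum]
    exact (hf.degree_eq_sum_deg_support hd).symm
  have h2 : ∏ i, (c • x) i ^ d i = c ^ k * ∏ i, x i ^ d i := by
    rw [← h1, ← Finset.prod_pow_eq_pow_sum, ← Finset.prod_mul_distrib]
    exact Finset.prod_congr rfl fun i _ => by simp [mul_pow]
  have h3 : ∀ y : Fin N → ℂ, ∏ i ∈ d.support, y i ^ d i = ∏ i, y i ^ d i := fun y =>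
    Finset.prod_subset (Finset.subset_univ _) fun i _ hi => by
      rw [Finsupp.notMem_support_iff.1 hi, pow_zero]
  rw [h3, h3, h2]
  ring

/-! ### From quasi-invariant functions to graded series -/

/-- The generating series of the homogeneous components of a polynomial. -/
def hcSer (P : Poly N) : PowerSeries (Poly N) :=
  PowerSeries.mk fun i => homogeneousComponent i P

theorem coeff_hcSer (P : Poly N) (i : ℕ) :
    PowerSeries.coeff i (hcSer P) = homogeneousComponent i P := by simp [hcSer]

theorem eval_sum_hcSer {P : Poly N} {n : ℕ} (hP : P.totalDegree ≤ n) (x : Fin N → ℂ) :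
    eval x P = ∑ i ∈ Finset.range (n + 1), eval x (homogeneousComponent i P) := by
  conv_lhs => rw [← sum_homogeneousComponent P, map_sum]
  refine Finset.sum_subset (fun i => by simp only [Finset.mem_range]; omega) fun i _ hi => ?_
  rw [homogeneousComponent_eq_zero _ _ (by simpa [Nat.lt_succ_iff] using hi), map_zero]

theorem coeff_mul_expSer_C_mul_X (r k : ℕ) (z : ℂ) (s : PowerSeries (Polynomial ℂ)) :
    (PowerSeries.coeff k (s * expSer (Polynomial.C z * Polynomial.X))).coeff r =
      ∑ p ∈ Finset.HasAntidiagonal.antidiagonal k, if p.2 ≤ r then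
        (PowerSeries.coeff p.1 s).coeff (r - p.2) * PowerSeries.coeff p.2 (expSer z) else 0 := by
  have hc : ∀ j, PowerSeries.coeff j (expSer (Polynomial.C z * Polynomial.X)) =
      Polynomial.C (PowerSeries.coeff j (expSer z)) * Polynomial.X ^ j := by
    intro j
    have : algebraMap ℚ (Polynomial ℂ) (1 / j.factorial) =
        Polynomial.C (algebraMap ℚ ℂ (1 / j.factorial)) := rfl
    rw [coeff_expSer, coeff_expSer, this, map_mul, map_pow]
    ring
  rw [PowerSeries.coeff_mul, Polynomial.finsetSum_coeff]
  refine Finset.sum_congr rfl fun p _ => ?_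
  rw [hc, mul_left_comm, Polynomial.coeff_C_mul, Polynomial.coeff_mul_X_pow']
  split_ifs
  · ring
  · simp

/-- The hyperplane is a cone, so the vanishing condition holds at τx for all τ. As a function of τ
it is, up to an exponential factor, a polynomial whose coefficients are the conditions on the
separate homogeneous components. -/
theorem coeff_hcSer_mul_expSer_mem_quasi {P : Poly N} {l : Fin N → ℂ}
    (h : QuasiInvariantFun A fun x => eval x P * Complex.exp (bil x l)) (k : ℕ) :
    PowerSeries.coeff k (hcSer P * expSer (clin l)) ∈ A.quasi := by
  rw [Configuration.mem_quasi]
  intro α hα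
  rw [mem_quasiInv_iff_coeff (A.bil_self_ne_zero hα)]
  intro x hx r hr ho
  set a := cvec α
  set n := P.totalDegree with hn
  set z := bil l a
  set σ : PowerSeries (Polynomial ℂ) := PowerSeries.map (line x a).toRingHom (hcSer P) with hσ
  have hσc : ∀ i, PowerSeries.coeff i σ = line x a (homogeneousComponent i P) := by
    intro i; rw [hσ, PowerSeries.coeff_map, coeff_hcSer]; rfl
  have e : PowerSeries.map (line x a).toRingHom (hcSer P * expSer (clin l)) =
      σ * expSer (Polynomial.C z * Polynomial.X) * expSer (Polynomial.C (bil l x)) := by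
    rw [map_mul, map_expSer]
    have : (line x a).toRingHom (clin l) = line x a (clin l) := rfl
    rw [this, line_clin, mul_assoc, expSer_mul_expSer, add_comm]
  have e' := congrArg (fun s => (PowerSeries.coeff k s).coeff r) e
  simp only [PowerSeries.coeff_map] at e'
  refine Eq.trans e' (coeff_mul_expSer_C_mem fun k => ?_)
  let c : ℕ × ℕ → ℂ := fun p => if p.2 ≤ r then
    (PowerSeries.coeff p.1 σ).coeff (r - p.2) * PowerSeries.coeff p.2 (expSer z) else 0
  -- At τx, with t rescaled to τt, the component of degree i contributes τ^i and the term of order j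
  -- of the exponential contributes τ^j; so the coefficient of τ^k concerns exactly the component of
  -- degree k of the product.
  let Q : Polynomial ℂ := ∑ p ∈ Finset.range (n + 1) ×ˢ Finset.range (r + 1),
    Polynomial.monomial (p.1 + p.2) (c p)
  have hQ : Q = 0 := by
    have hroot : ∀ τ : ℂ, τ ≠ 0 → Q.eval τ = 0 := by
      intro τ hτ
      let p : Polynomial ℂ := ∑ i ∈ Finset.range (n + 1),
        Polynomial.C (τ ^ i) * PowerSeries.coeff i σ
      have hF := (hasTaylor_polynomial p).mul (hasTaylor_exp (τ * z))
      have hq := h α hα ((r + 1) / 2) (by obtain ⟨j, rfl⟩ := ho; omega)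
        (by obtain ⟨j, rfl⟩ := ho; omega) (τ • x) (by rw [bil_smul_right, hx, mul_zero])
      rw [show 2 * ((r + 1) / 2) - 1 = r by obtain ⟨j, rfl⟩ := ho; omega] at hq
      set g : ℂ → ℂ := fun t => eval (τ • x + t • a) P * Complex.exp (bil (τ • x + t • a) l)
      have hgF : (fun t => g (τ * t)) = fun t => Complex.exp (τ * bil l x) *
          (p.eval t * Complex.exp (τ * z * t)) := by
        funext t
        have h1 : τ • x + (τ * t) • a = τ • (x + t • a) := by rw [smul_add, mul_smul]
        have h2 : bil (τ • (x + t • a)) l = τ * bil l x + τ * z * t := by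
          rw [bil_comm, bil_smul_right, bil_add_right, bil_smul_right]; ring
        have h3 : eval (τ • (x + t • a)) P = p.eval t := by
          rw [eval_sum_hcSer hn.ge, Polynomial.eval_finsetSum]
          refine Finset.sum_congr rfl fun i _ => ?_
          rw [IsHomogeneous.eval_smul (homogeneousComponent_isHomogeneous i P), hσc,
            Polynomial.eval_mul, Polynomial.eval_C, eval_line]
        simp only [g]
        rw [h1, h2, h3, Complex.exp_add]
        ring
      have hg : ContDiff ℂ r g := by
        have h4 : g = fun t => Complex.exp (τ * bil l x) *
            (p.eval (τ⁻¹ * t) * Complex.exp (τ * z * (τ⁻¹ * t))) := by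
          funext t
          have := congr_fun hgF (τ⁻¹ * t)
          rwa [mul_inv_cancel_left₀ hτ] at this
        rw [h4]
        exact contDiff_const.mul ((hF.1.of_le le_top).comp (by fun_prop))
      have h5 := congr_fun (iteratedDeriv_comp_const_mul hg τ) 0
      rw [mul_zero, hq, mul_zero, hgF, iteratedDeriv_const_mul_field, hF.2] at h5
      have h6 : PowerSeries.coeff r ((p : PowerSeries ℂ) * expSer (τ * z)) = 0 := by
        have := Nat.cast_ne_zero (R := ℂ).2 r.factorial_ne_zero
        rw [mul_eq_zero, mul_eq_zero] at h5
        exact (h5.resolve_left (Complex.exp_ne_zero _)).resolve_left this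
      rw [mul_comm, PowerSeries.coeff_mul, Finset.Nat.sum_antidiagonal_eq_sum_range_succ_mk] at h6
      rw [← h6, Polynomial.eval_finsetSum, Finset.sum_product_right]
      refine Finset.sum_congr rfl fun j hj => ?_
      have hj : j ≤ r := by simpa [Nat.lt_succ_iff] using hj
      simp only [Polynomial.coeff_coe, p, Polynomial.finsetSum_coeff, Finset.mul_sum]
      refine Finset.sum_congr rfl fun i _ => ?_
      rw [Polynomial.eval_monomial, Polynomial.coeff_C_mul]
      simp only [c]
      rw [if_pos hj, coeff_expSer, coeff_expSer, mul_pow, pow_add]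
      ring
    refine Polynomial.eq_zero_of_infinite_isRoot _ (Set.Infinite.mono ?_
      (Set.Finite.infinite_compl (Set.finite_singleton (0 : ℂ))))
    intro τ hτ
    exact hroot τ hτ
  have hc := congrArg (fun q => Polynomial.coeff q k) hQ
  simp only [Q, Polynomial.finsetSum_coeff, Polynomial.coeff_monomial, Polynomial.coeff_zero] at hc
  rw [coeff_mul_expSer_C_mul_X]
  refine Eq.trans ?_ ((Finset.sum_filter _ _).trans hc)
  refine Finset.sum_congr_of_eq_on_inter ?_ ?_ ?_
  · rintro ⟨i, j⟩ hij hn'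
    rw [Finset.HasAntidiagonal.mem_antidiagonal] at hij
    simp only [Finset.mem_filter, Finset.mem_product, Finset.mem_range, not_and] at hn'
    simp only at hij ⊢
    by_cases hj : j ≤ r
    · have hi : n < i := by
        by_contra hi
        exact hn' ⟨by omega, by omega⟩ hij
      rw [if_pos hj, hσc, homogeneousComponent_eq_zero _ _ hi]
      simp
    · rw [if_neg hj]
  · rintro ⟨i, j⟩ hij hn'
    rw [Finset.HasAntidiagonal.mem_antidiagonal] at hn'
    exact absurd (Finset.mem_filter.1 hij).2 hn'
  · intros; rfl

end

section

/-! ### Entire homogeneous functions are polynomials -/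

/-- Liouville's argument: the Cauchy estimates on circles of radius R → ∞ kill all derivatives at 0
of order above k. -/
theorem exists_polynomial_of_growth {g : ℂ → ℂ} (hg : Differentiable ℂ g) {B : ℝ} {k : ℕ}
    (hB : ∀ t, ‖g t‖ ≤ B * (1 + ‖t‖) ^ k) :
    ∃ p : Polynomial ℂ, p.natDegree ≤ k ∧ ∀ t, g t = p.eval t := by
  have h0 : ∀ n, k < n → iteratedDeriv n g 0 = 0 := by
    intro n hn
    rw [← norm_le_zero_iff]
    have hlim : Filter.Tendsto (fun R : ℝ => n.factorial * (B * (2 ^ k * R⁻¹))) Filter.atTop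
        (nhds (n.factorial * (B * (2 ^ k * 0)))) :=
      ((tendsto_inv_atTop_zero.const_mul _).const_mul _).const_mul _
    rw [mul_zero, mul_zero, mul_zero] at hlim
    refine ge_of_tendsto hlim ?_
    filter_upwards [Filter.eventually_ge_atTop (1 : ℝ)] with R hR
    have hR0 : 0 < R := by linarith
    have hBn : 0 ≤ B := by
      have := (norm_nonneg _).trans (hB 0)
      simpa using this
    refine (Complex.norm_iteratedDeriv_le_of_forall_mem_sphere_norm_le n hR0
      (C := B * (1 + R) ^ k) hg.diffContOnCl fun z hz => ?_).trans ?_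
    · have hz' : ‖z‖ = R := by simpa using hz
      rw [← hz']
      exact hB z
    · rw [mul_div_assoc, mul_div_assoc]
      have h1 : (1 + R) ^ k / R ^ n ≤ 2 ^ k * R⁻¹ := by
        have h2 : (1 + R) ^ k ≤ (2 * R) ^ k := pow_le_pow_left₀ (by linarith) (by linarith) k
        have h3 : R ^ (k + 1) ≤ R ^ n := pow_le_pow_right₀ hR hn
        rw [div_le_iff₀ (by positivity)]
        calc (1 + R) ^ k ≤ (2 * R) ^ k := h2
          _ = 2 ^ k * R⁻¹ * R ^ (k + 1) := by rw [mul_pow, pow_succ]; field_simp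
          _ ≤ _ := by gcongr
      gcongr
  refine ⟨∑ n ∈ Finset.range (k + 1), Polynomial.C ((n.factorial : ℂ)⁻¹ * iteratedDeriv n g 0) *
    Polynomial.X ^ n, ?_, fun t => ?_⟩
  · refine Polynomial.natDegree_sum_le_of_forall_le _ _ fun n hn => ?_
    exact (Polynomial.natDegree_C_mul_X_pow_le _ _).trans
      (by simpa [Nat.lt_succ_iff] using hn)
  · rw [← Complex.taylorSeries_eq_of_entire hg 0 t, Polynomial.eval_finsetSum]
    rw [tsum_eq_sum (s := Finset.range (k + 1))]
    · refine Finset.sum_congr rfl fun n _ => ?_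
      simp only [sub_zero, smul_eq_mul, Polynomial.eval_mul, Polynomial.eval_C,
        Polynomial.eval_pow, Polynomial.eval_X]
      ring
    · intro n hn
      rw [h0 n (by simpa [Nat.lt_succ_iff] using hn)]
      simp

/-- Because the degree bound k is uniform, Lagrange interpolation at the nodes 0, …, k replaces one
variable at a time by finitely many constants. The intermediate statement writes f as a finite sum
of polynomials times values of f with the variables in S frozen. -/
theorem exists_mvPolynomial_of_separately {f : (Fin N → ℂ) → ℂ} {k : ℕ}
    (h : ∀ x i, ∃ p : Polynomial ℂ, p.natDegree ≤ k ∧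
      ∀ t, f (Function.update x i t) = p.eval t) :
    ∃ p : Poly N, ∀ x, f x = eval x p := by
  classical
  have key : ∀ S : Finset (Fin N), ∃ (ι : Type) (_ : Fintype ι) (p : ι → Poly N)
      (c : ι → Fin N → ℂ), ∀ x, f x = ∑ i, eval x (p i) * f (S.piecewise (c i) x) := by
    intro S
    induction S using Finset.induction_on with
    | empty => exact ⟨Unit, inferInstance, fun _ => 1, fun _ => 0, fun x => by simp⟩
    | insert a S ha ih =>
      obtain ⟨ι, _, p, c, hp⟩ := ih
      have hL : ∀ y, f y = ∑ j ∈ Finset.range (k + 1), f (Function.update y a (j : ℂ)) *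
          (Lagrange.basis (Finset.range (k + 1)) (fun i : ℕ => (i : ℂ)) j).eval (y a) := by
        intro y
        obtain ⟨q, hq, hqe⟩ := h y a
        have hint := Lagrange.eq_interpolate_of_eval_eq (s := Finset.range (k + 1))
          (v := fun i : ℕ => (i : ℂ)) (f := q) (fun j => f (Function.update y a (j : ℂ)))
          (fun i _ j _ hij => Nat.cast_injective hij)
          (by
            rw [Finset.card_range]
            exact lt_of_le_of_lt Polynomial.degree_le_natDegree
              (by exact_mod_cast Nat.lt_succ_of_le hq))
          (fun i _ => (hqe i).symm)
        have h1 := hqe (y a)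
        rw [Function.update_eq_self] at h1
        rw [h1, hint, Lagrange.interpolate_apply, Polynomial.eval_finsetSum]
        simp
      refine ⟨ι × Fin (k + 1), inferInstance,
        fun ij => p ij.1 * Polynomial.aeval (X a)
          (Lagrange.basis (Finset.range (k + 1)) (fun i : ℕ => (i : ℂ)) ij.2),
        fun ij => Function.update (c ij.1) a (ij.2 : ℕ), fun x => ?_⟩
      rw [hp x, Fintype.sum_prod_type]
      refine Finset.sum_congr rfl fun i _ => ?_
      rw [hL, Finset.mul_sum, Finset.sum_range]
      refine Finset.sum_congr rfl fun j _ => ?_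
      have e1 : (S.piecewise (c i) x) a = x a := by simp [ha]
      have e2 : Function.update (S.piecewise (c i) x) a ((j : ℕ) : ℂ) =
          (insert a S).piecewise (Function.update (c i) a ((j : ℕ) : ℂ)) x := by
        funext b
        by_cases hb : b = a
        · subst hb; simp
        · simp [Finset.piecewise, hb]
      have e3 : ∀ q : Polynomial ℂ, eval x (Polynomial.aeval (X a : Poly N) q) = q.eval (x a) := by
        intro q
        have hid : (eval x).comp (algebraMap ℂ (Poly N)) = RingHom.id ℂ :=
          RingHom.ext fun c => by simp [algebraMap_eq]
        rw [Polynomial.aeval_def, Polynomial.hom_eval₂, eval_X, hid, Polynomial.eval₂_id]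
      rw [e1, e2, map_mul, e3]
      ring
  obtain ⟨ι, _, p, c, hp⟩ := key Finset.univ
  refine ⟨∑ i, p i * C (f (c i)), fun x => ?_⟩
  rw [hp x, map_sum]
  exact Finset.sum_congr rfl fun i _ => by simp

theorem exists_homogeneous_of_smul {f : (Fin N → ℂ) → ℂ} (hf : Differentiable ℂ f) {k : ℕ}
    (h : ∀ c : ℂ, c ≠ 0 → ∀ l, f (c • l) = c ^ k * f l) :
    ∃ p : Poly N, p.IsHomogeneous k ∧ ∀ l, f l = eval l p := by
  -- Homogeneity turns the bound on the unit ball into polynomial growth; scaling by 1+‖x‖ rather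
  -- than ‖x‖ avoids dividing by zero.
  obtain ⟨B, hB⟩ := (isCompact_closedBall (0 : Fin N → ℂ) 1).exists_bound_of_continuousOn
    hf.continuous.continuousOn
  have hB0 : 0 ≤ B := (norm_nonneg _).trans (hB 0 (by simp))
  have hgrow : ∀ x, ‖f x‖ ≤ B * (1 + ‖x‖) ^ k := by
    intro x
    have hc : ((1 + ‖x‖ : ℝ) : ℂ) ≠ 0 := by
      rw [Complex.ofReal_ne_zero]; positivity
    have e := h _ hc ((((1 + ‖x‖ : ℝ) : ℂ)⁻¹) • x)
    rw [smul_inv_smul₀ hc] at e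
    have hn : ‖((1 + ‖x‖ : ℝ) : ℂ)‖ = 1 + ‖x‖ := by
      rw [Complex.norm_real, Real.norm_of_nonneg (by positivity)]
    rw [e, norm_mul, norm_pow, hn, mul_comm]
    gcongr
    apply hB
    rw [mem_closedBall_zero_iff, norm_smul, norm_inv, hn, inv_mul_le_iff₀ (by positivity)]
    linarith
  obtain ⟨p, hp⟩ := exists_mvPolynomial_of_separately (f := f) (k := k) (by
    intro x i
    refine exists_polynomial_of_growth (B := B * (1 + ‖x‖) ^ k) ?_ fun t => ?_
    · refine hf.comp ?_
      rw [differentiable_pi]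
      intro j
      by_cases hj : j = i
      · subst hj; simp
      · simp [Function.update_of_ne hj]
    · refine (hgrow _).trans ?_
      rw [mul_assoc, ← mul_pow]
      gcongr
      have : ‖Function.update x i t‖ ≤ ‖x‖ + ‖t‖ := by
        rw [pi_norm_le_iff_of_nonneg (by positivity)]
        intro j
        by_cases hj : j = i
        · subst hj; simp
        · rw [Function.update_of_ne hj]
          exact (norm_le_pi_norm x j).trans (by simp)
      nlinarith [norm_nonneg x, norm_nonneg t])
  refine ⟨homogeneousComponent k p, homogeneousComponent_isHomogeneous _ _, fun l => ?_⟩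
  let q : Polynomial ℂ := (∑ i ∈ Finset.range (p.totalDegree + 1),
    Polynomial.monomial i (eval l (homogeneousComponent i p))) - Polynomial.monomial k (eval l p)
  have hq : q = 0 := by
    refine Polynomial.eq_zero_of_infinite_isRoot _ (Set.Infinite.mono ?_
      (Set.Finite.infinite_compl (Set.finite_singleton (0 : ℂ))))
    intro c hc
    have := h c hc l
    rw [hp, hp, eval_sum_hcSer le_rfl] at this
    simp only [IsHomogeneous.eval_smul (homogeneousComponent_isHomogeneous _ p)] at this
    simp only [q, Set.mem_ofPred_eq, Polynomial.IsRoot.def, Polynomial.eval_sub,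
      Polynomial.eval_finsetSum, Polynomial.eval_monomial]
    rw [sub_eq_zero, mul_comm (eval l p), ← this]
    exact Finset.sum_congr rfl fun i _ => mul_comm _ _
  have hk := congrArg (fun q => Polynomial.coeff q k) hq
  simp only [q, Polynomial.coeff_sub, Polynomial.finsetSum_coeff, Polynomial.coeff_monomial,
    if_true, Polynomial.coeff_zero, Finset.sum_ite_eq', Finset.mem_range] at hk
  rw [hp]
  rw [sub_eq_zero] at hk
  rw [← hk]
  split_ifs with hlt
  · rfl
  · rw [homogeneousComponent_eq_zero _ _ (by omega), map_zero]

end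

section

/-! ### Polynomials in two groups of variables -/

/-- Polynomials in `x` whose coefficients are polynomials in `λ`. -/
abbrev BiPoly (N : ℕ) : Type := MvPolynomial (Fin N) (Poly N)

/-- Specialisation of the spectral variable `λ`. -/
def atR (l : Fin N → ℂ) : BiPoly N →+* Poly N := map (eval l)

/-- Specialisation of the variable `x`. -/
def atX (x : Fin N → ℂ) : BiPoly N →+* Poly N := eval fun i => C (x i)

theorem eval_atR (x l : Fin N → ℂ) (F : BiPoly N) : eval x (atR l F) = eval l (atX x F) := by
  induction F using MvPolynomial.induction_on with
  | C r => simp [atR, atX]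
  | add p q hp hq => simp [hp, hq]
  | mul_X p i hp => rw [map_mul, map_mul, map_mul, map_mul, hp]; simp [atR, atX]

variable {A : Configuration N}

/-- A line with generic direction meets each hyperplane in a single point, so almost all of its
points are generic. -/
theorem eq_zero_of_generic_continuous {g : (Fin N → ℂ) → ℂ} (hg : Continuous g)
    (h : ∀ y, A.Generic y → g y = 0) (l : Fin N → ℂ) : g l = 0 := by
  obtain ⟨v, hv⟩ := exists_generic A
  set T : Set ℂ := ↑(A.vectors.image fun α => -(bil (cvec α) l) / bil (cvec α) v)
  have hT : Dense Tᶜ := Set.Countable.dense_compl ℂ (Finset.countable_toSet _)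
  have hz : (fun t : ℂ => g (l + t • v)) = fun _ => 0 := by
    refine Continuous.ext_on hT (hg.comp (by fun_prop)) continuous_const fun t ht => ?_
    refine h _ fun α hα h0 => ht ?_
    rw [bil_add_right, bil_smul_right] at h0
    simp only [T, Finset.coe_image, Set.mem_image]
    refine ⟨α, hα, ?_⟩
    have := hv α hα
    field_simp
    linear_combination -h0
  simpa using congr_fun hz 0

theorem clin_smul (c : ℂ) (y : Fin N → ℂ) : clin (c • y) = C c * clin y := by
  simp [clin, Finset.mul_sum, mul_assoc]

theorem expSer_clin_smul (c : ℂ) (y : Fin N → ℂ) :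
    expSer (clin (c • y)) = PowerSeries.rescale (C c) (expSer (clin y)) := by
  rw [clin_smul, expSer, expSer, PowerSeries.rescale_rescale, mul_comm]

/-- Bihomogeneous expansion of a Baker--Akhiezer function. -/
structure IsExpansion (A : Configuration N) (φ : (Fin N → ℂ) → (Fin N → ℂ) → ℂ)
    (F : ℕ → BiPoly N) : Prop where
  homR : ∀ i l, (atR l (F i)).IsHomogeneous i
  homX : ∀ i x, (atX x (F i)).IsHomogeneous i
  top : ∀ l, atR l (F A.totalMult) = C (eval l A.poly) * A.poly
  eq_zero : ∀ i, A.totalMult < i → F i = 0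
  form : ∀ x l, φ x l = (∑ i ∈ Finset.range (A.totalMult + 1), eval x (atR l (F i))) *
    Complex.exp (bil x l)
  quasi : ∀ l k, PowerSeries.coeff k
    (PowerSeries.mk (fun i => atR l (F i)) * expSer (clin l)) ∈ A.quasi

/-- Replacing λ by cλ corresponds to rescaling x by c: both sides are quasi-invariant multiples of
the same exponential with top coefficient A_m(cλ)A_m(x), so their difference has degree below |m|
and the uniqueness principle applies. -/
theorem hcSer_smul {P : (Fin N → ℂ) → Poly N}
    (hdeg : ∀ l, (P l).totalDegree ≤ A.totalMult)
    (htop : ∀ l, homogeneousComponent A.totalMult (P l) = C (eval l A.poly) * A.poly)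
    (hq : ∀ l k, PowerSeries.coeff k (hcSer (P l) * expSer (clin l)) ∈ A.quasi)
    {l : Fin N → ℂ} (hl : A.Generic l) {c : ℂ} (hc : c ≠ 0) :
    hcSer (P (c • l)) = PowerSeries.rescale (C c) (hcSer (P l)) := by
  rw [← sub_eq_zero]
  have hco : ∀ i, PowerSeries.coeff i (hcSer (P (c • l)) - PowerSeries.rescale (C c) (hcSer (P l)))
      = homogeneousComponent i (P (c • l)) - C c ^ i * homogeneousComponent i (P l) := by
    intro i
    rw [map_sub, PowerSeries.coeff_rescale, coeff_hcSer, coeff_hcSer]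
  refine (hl.smul hc).eq_zero (n := A.totalMult) (fun i hi => ?_) (fun i hi => ?_) fun k => ?_
  · rw [hco, homogeneousComponent_eq_zero _ _ ((hdeg _).trans_lt hi),
      homogeneousComponent_eq_zero _ _ ((hdeg _).trans_lt hi), mul_zero, sub_zero]
  · rw [hco] at hi ⊢
    have hle : i ≤ A.totalMult := by
      by_contra hlt
      push Not at hlt
      apply hi
      rw [homogeneousComponent_eq_zero _ _ ((hdeg _).trans_lt hlt),
        homogeneousComponent_eq_zero _ _ ((hdeg _).trans_lt hlt), mul_zero, sub_zero]
    have hne : i ≠ A.totalMult := by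
      rintro rfl
      apply hi
      rw [htop, htop, IsHomogeneous.eval_smul A.poly_isHomogeneous, C_mul, C_pow]
      ring
    have hh : (homogeneousComponent i (P (c • l)) -
        C c ^ i * homogeneousComponent i (P l)).IsHomogeneous i := by
      rw [← C_pow]
      exact (homogeneousComponent_isHomogeneous _ _).sub
        ((homogeneousComponent_isHomogeneous _ _).C_mul _)
    exact hh.totalDegree_le.trans_lt (lt_of_le_of_ne hle hne)
  · rw [sub_mul, map_sub]
    refine sub_mem (hq _ _) ?_
    rw [expSer_clin_smul, ← map_mul, PowerSeries.coeff_rescale, ← C_pow, C_mul']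
    exact Subalgebra.smul_mem _ (hq l k) _

theorem IsBakerAkhiezer.exists_expansion {φ : (Fin N → ℂ) → (Fin N → ℂ) → ℂ}
    (hφ : IsBakerAkhiezer A φ) : ∃ F, IsExpansion A φ F := by
  obtain ⟨P, hdiff, hdeg, htop, hform⟩ := hφ.form
  have hq : ∀ l k, PowerSeries.coeff k (hcSer (P l) * expSer (clin l)) ∈ A.quasi := by
    intro l k
    refine coeff_hcSer_mul_expSer_mem_quasi ?_ k
    have := hφ.vanishing l
    simpa only [hform] using this
  -- The coefficient of x^ν is homogeneous of degree |ν| in λ; the uniqueness principle gives this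
  -- for generic λ, continuity for all λ. Entire and homogeneous, it is a polynomial.
  have hsc : ∀ (ν : Fin N →₀ ℕ) (c : ℂ), c ≠ 0 → ∀ l,
      (P (c • l)).coeff ν = c ^ ν.degree * (P l).coeff ν := by
    intro ν c hc l
    rw [← sub_eq_zero]
    refine eq_zero_of_generic_continuous (A := A)
      (g := fun l => (P (c • l)).coeff ν - c ^ ν.degree * (P l).coeff ν) ?_ (fun y hy => ?_) l
    · have h1 := (hdiff ν).continuous
      exact (h1.comp (continuous_const_smul c)).sub (continuous_const.mul h1)
    · have h1 := congrArg (fun s => (PowerSeries.coeff ν.degree s).coeff ν)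
        (hcSer_smul hdeg htop hq hy hc)
      simp only [PowerSeries.coeff_rescale, coeff_hcSer] at h1
      rw [← C_pow, coeff_C_mul, coeff_homogeneousComponent, coeff_homogeneousComponent, if_pos rfl,
        if_pos rfl] at h1
      rw [h1, sub_self]
  choose cf hcf hcfe using fun ν => exists_homogeneous_of_smul (hdiff ν) (hsc ν)
  let F : ℕ → BiPoly N := fun i =>
    ∑ ν ∈ Finset.finsuppAntidiag (Finset.univ : Finset (Fin N)) i, monomial ν (cf ν)
  have hmem : ∀ (ν : Fin N →₀ ℕ) (i : ℕ),
      ν ∈ Finset.finsuppAntidiag (Finset.univ : Finset (Fin N)) i ↔ ν.degree = i := by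
    intro ν i
    simp [Finset.mem_finsuppAntidiag, Finsupp.degree_eq_sum]
  have hFc : ∀ i ν, (F i).coeff ν = if ν.degree = i then cf ν else 0 := by
    intro i ν
    simp only [F, coeff_sum, coeff_monomial, Finset.sum_ite_eq', hmem]
  have hR : ∀ i l, atR l (F i) = homogeneousComponent i (P l) := by
    intro i l
    ext ν
    rw [atR, coeff_map, hFc, coeff_homogeneousComponent]
    split_ifs with h
    · exact (hcfe ν l).symm
    · simp
  refine ⟨F, fun i l => ?_, fun i x => ?_, fun l => ?_, fun i hi => ?_, fun x l => ?_,
    fun l k => ?_⟩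
  · rw [hR]; exact homogeneousComponent_isHomogeneous _ _
  · simp only [F, map_sum]
    refine IsHomogeneous.sum _ _ _ fun ν hν => ?_
    rw [atX, eval_monomial]
    have h1 : (ν.prod fun n e => (C (x n) : Poly N) ^ e) = C (ν.prod fun n e => x n ^ e) := by
      simp [Finsupp.prod]
    rw [h1, mul_comm]
    have := hcf ν
    rw [(hmem ν i).1 hν] at this
    exact this.C_mul _
  · rw [hR, htop]
  · ext1 ν
    rw [hFc, coeff_zero]
    split_ifs with h
    · apply MvPolynomial.funext
      intro l
      rw [← hcfe, map_zero]
      have h1 := congrArg (fun p => p.coeff ν)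
        (homogeneousComponent_eq_zero i (P l) ((hdeg l).trans_lt hi))
      simpa [coeff_homogeneousComponent, h] using h1
    · rfl
  · rw [hform, eval_sum_hcSer (hdeg l)]
    simp only [hR]
  · have : PowerSeries.mk (fun i => atR l (F i)) = hcSer (P l) := by
      ext i : 1
      rw [PowerSeries.coeff_mk, hR, coeff_hcSer]
    rw [this]
    exact hq l k

end

section

/-! ### The eigenvalue equation in the spectral variable -/

section CoeffMap

variable {R : Type*} [CommRing R] [Algebra ℂ R]

/-- Apply a linear functional to the coefficients of a polynomial. -/
def coeffMap (τ : R →ₗ[ℂ] ℂ) (F : MvPolynomial (Fin N) R) : Poly N :=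
  ∑ ν ∈ F.support, monomial ν (τ (F.coeff ν))

theorem coeff_coeffMap (τ : R →ₗ[ℂ] ℂ) (F : MvPolynomial (Fin N) R) (ν : Fin N →₀ ℕ) :
    (coeffMap τ F).coeff ν = τ (F.coeff ν) := by
  simp only [coeffMap, coeff_sum, coeff_monomial, Finset.sum_ite_eq']
  split_ifs with h
  · rfl
  · rw [notMem_support_iff.1 h, map_zero]

theorem eval_eq_sum_smul (x : Fin N → ℂ) (F : MvPolynomial (Fin N) R) :
    eval (fun i => algebraMap ℂ R (x i)) F =
      ∑ ν ∈ F.support, (ν.prod fun n e => x n ^ e) • F.coeff ν := by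
  conv_lhs => rw [F.as_sum, map_sum]
  refine Finset.sum_congr rfl fun ν _ => ?_
  rw [eval_monomial, mul_comm, Algebra.smul_def]
  congr 1
  simp [Finsupp.prod]

theorem eval_coeffMap_eq (τ : R →ₗ[ℂ] ℂ) (F : MvPolynomial (Fin N) R) (x : Fin N → ℂ) :
    eval x (coeffMap τ F) = τ (eval (fun i => algebraMap ℂ R (x i)) F) := by
  rw [eval_eq_sum_smul, coeffMap, map_sum, map_sum]
  refine Finset.sum_congr rfl fun ν _ => ?_
  rw [eval_monomial, map_smul, smul_eq_mul, mul_comm]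

/-- Linear functionals on the coefficient algebra reduce vanishing to scalar polynomials, where
evaluation at points is available. -/
theorem eq_zero_of_coeffMap {F : MvPolynomial (Fin N) R}
    (h : ∀ τ : R →ₗ[ℂ] ℂ, coeffMap τ F = 0) : F = 0 := by
  ext ν
  rw [coeff_zero]
  refine (Module.forall_dual_apply_eq_zero_iff ℂ _).1 fun τ => ?_
  have := congrArg (coeff ν) (h τ)
  rwa [coeff_coeffMap, coeff_zero] at this

/-- A polynomial with coefficients in a `ℂ`-algebra that vanishes at all complex points where a
given nonzero polynomial does not vanish. -/
theorem eq_zero_of_eval_of_ne_zero {F : MvPolynomial (Fin N) R} {w : Poly N} (hw : w ≠ 0)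
    (h : ∀ x, eval x w ≠ 0 → eval (fun i => algebraMap ℂ R (x i)) F = 0) : F = 0 := by
  refine eq_zero_of_coeffMap fun τ => (mul_eq_zero.1 ?_).resolve_left hw
  apply MvPolynomial.funext
  intro x
  rw [map_mul, map_zero, mul_eq_zero, or_iff_not_imp_left, eval_coeffMap_eq]
  intro hx
  rw [h x hx, map_zero]

theorem eq_zero_of_eval_generic {A : Configuration N} {F : MvPolynomial (Fin N) R}
    (h : ∀ x, A.Generic x → eval (fun i => algebraMap ℂ R (x i)) F = 0) : F = 0 := by
  refine eq_zero_of_coeffMap fun τ => eq_zero_of_generic (A := A) fun x hx => ?_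
  rw [eval_coeffMap_eq, h x hx, map_zero]

theorem isHomogeneous_coeffMap {F : MvPolynomial (Fin N) R} {i : ℕ} (hF : F.IsHomogeneous i)
    (τ : R →ₗ[ℂ] ℂ) : (coeffMap τ F).IsHomogeneous i := by
  intro ν hν
  rw [coeff_coeffMap] at hν
  refine hF (d := ν) fun h0 => hν ?_
  rw [h0, map_zero]

end CoeffMap

theorem eval_coeffMap (τ : Poly N →ₗ[ℂ] ℂ) (F : BiPoly N) (x : Fin N → ℂ) :
    eval x (coeffMap τ F) = τ (atX x F) :=
  eval_coeffMap_eq τ F x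

/-- View F as a tensor in x and λ. If θ kills Q then θ applied in x kills every specialisation in λ,
hence kills F as a polynomial in λ, and applying τ in λ afterwards gives zero. So any linear
operation in λ keeps quasi-invariance in x. -/
theorem coeffMap_mem {Q : Submodule ℂ (Poly N)} {F : BiPoly N} (h : ∀ l, atR l F ∈ Q)
    (τ : Poly N →ₗ[ℂ] ℂ) : coeffMap τ F ∈ Q := by
  by_contra hn
  obtain ⟨θ, hθ, hQ⟩ := Submodule.exists_le_ker_of_notMem hn
  apply hθ
  have hG : ∑ ν ∈ F.support, θ (monomial ν 1) • F.coeff ν = 0 := by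
    apply MvPolynomial.funext
    intro l
    have h1 : θ (atR l F) = 0 := hQ (h l)
    rw [map_zero, ← h1]
    conv_rhs => rw [F.as_sum, map_sum, map_sum]
    rw [map_sum]
    refine Finset.sum_congr rfl fun ν _ => ?_
    rw [atR, map_monomial, smul_eval, mul_comm, ← smul_eq_mul, ← map_smul, smul_monomial,
      smul_eq_mul, mul_one]
  have h2 := congrArg τ hG
  rw [map_sum, map_zero] at h2
  rw [coeffMap, map_sum, ← h2]
  refine Finset.sum_congr rfl fun ν _ => ?_
  rw [map_smul, smul_eq_mul, mul_comm, ← smul_eq_mul, ← map_smul, smul_monomial, smul_eq_mul,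
    mul_one]

theorem isHomogeneous_of_atR {F : BiPoly N} {i : ℕ} (h : ∀ l, (atR l F).IsHomogeneous i) :
    F.IsHomogeneous i := by
  intro ν hν
  by_contra hne
  apply hν
  apply MvPolynomial.funext
  intro l
  rw [map_zero]
  by_contra h0
  exact hne (h l (d := ν) (by rwa [atR, coeff_map]))

/-- The linear form pairing the two groups of variables. -/
def pairing : BiPoly N := ∑ i, C (X i) * X i

theorem atR_pairing (l : Fin N → ℂ) : atR l pairing = clin l := by
  simp [atR, pairing, clin]

theorem atX_pairing (x : Fin N → ℂ) : atX x pairing = clin x := by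
  simp [atX, pairing, clin, mul_comm]

/-- The homogeneous components of `(∑ F_i) e^{(x, λ)}`. -/
def bakerComp (F : ℕ → BiPoly N) (k : ℕ) : BiPoly N :=
  PowerSeries.coeff k (PowerSeries.mk F * expSer pairing)

theorem atR_bakerComp (F : ℕ → BiPoly N) (l : Fin N → ℂ) (k : ℕ) :
    atR l (bakerComp F k) =
      PowerSeries.coeff k (PowerSeries.mk (fun i => atR l (F i)) * expSer (clin l)) := by
  rw [bakerComp, ← PowerSeries.coeff_map, map_mul, map_expSer, atR_pairing]
  congr 2

theorem atX_bakerComp (F : ℕ → BiPoly N) (x : Fin N → ℂ) (k : ℕ) :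
    atX x (bakerComp F k) =
      PowerSeries.coeff k (PowerSeries.mk (fun i => atX x (F i)) * expSer (clin x)) := by
  rw [bakerComp, ← PowerSeries.coeff_map, map_mul, map_expSer, atX_pairing]
  congr 2

theorem eval_coeff_mul_expSer {s t : PowerSeries (Poly N)} {x l : Fin N → ℂ}
    (h : ∀ i, eval x (PowerSeries.coeff i s) = eval l (PowerSeries.coeff i t)) (k : ℕ) :
    eval x (PowerSeries.coeff k (s * expSer (clin l))) =
      eval l (PowerSeries.coeff k (t * expSer (clin x))) := by
  rw [← PowerSeries.coeff_map, ← PowerSeries.coeff_map, RingHom.map_mul, RingHom.map_mul,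
    map_expSer, map_expSer, eval_clin, eval_clin, bil_comm]
  congr 2
  ext i : 1
  rw [PowerSeries.coeff_map, PowerSeries.coeff_map, h]

/-- The quadratic form `(x, x)`. -/
def quadForm : Poly N := ∑ i, X i ^ 2

theorem eval_quadForm (x : Fin N → ℂ) : eval x quadForm = bil x x := by
  simp [quadForm, bil, pow_two]

theorem quadForm_mem_quasi (A : Configuration N) : quadForm ∈ A.quasi := by
  rw [Configuration.mem_quasi]
  intro α hα
  refine refl_eq_mem_quasiInv (MvPolynomial.funext fun x => ?_)
  have ha := A.bil_self_ne_zero hα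
  rw [eval_refl, eval_quadForm, eval_quadForm, bil_sub_right, bil_smul_right,
    bil_comm (x - _) x, bil_comm (x - _) (cvec α), bil_sub_right, bil_sub_right, bil_smul_right,
    bil_smul_right, bil_comm x (cvec α)]
  field_simp
  ring

theorem coeff_twist_zero (p : Poly N) (y : Fin N → ℂ) (s : PowerSeries (Poly N)) :
    PowerSeries.coeff 0 (twist p y s) = lhat p (PowerSeries.coeff 0 s) := by
  have : (2 : PowerSeries (Poly N)) = PowerSeries.C 2 := (map_ofNat PowerSeries.C 2).symm
  rw [twist, map_add, coeff_cw, this, PowerSeries.coeff_C_mul, PowerSeries.coeff_zero_X_mul]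
  simp

theorem coeff_twist_succ (p : Poly N) (y : Fin N → ℂ) (s : PowerSeries (Poly N)) (i : ℕ) :
    PowerSeries.coeff (i + 1) (twist p y s) = lhat p (PowerSeries.coeff (i + 1) s) +
      2 * (p * gam (clin y) (PowerSeries.coeff i s) -
        gam p (clin y) * PowerSeries.coeff i s) := by
  have : (2 : PowerSeries (Poly N)) = PowerSeries.C 2 := (map_ofNat PowerSeries.C 2).symm
  rw [twist, map_add, coeff_cw, this, PowerSeries.coeff_C_mul, PowerSeries.coeff_succ_X_mul,
    map_sub, PowerSeries.coeff_C_mul, PowerSeries.coeff_C_mul, coeff_cw]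
  rfl

theorem gam_C (p : Poly N) (c : ℂ) : gam p (C c) = 0 := by
  simp

theorem lhat_C (p : Poly N) (c : ℂ) : lhat p (C c) = 0 := by
  rw [lhat_apply, lap_C, gam_C]; simp

theorem eq_C_of_isHomogeneous_zero {p : Poly N} (hp : p.IsHomogeneous 0) : p = C (eval 0 p) := by
  have h := totalDegree_eq_zero_iff_eq_C.1 (Nat.le_zero.1 hp.totalDegree_le)
  rw [h]
  simp

namespace IsExpansion

variable {A : Configuration N} {φ : (Fin N → ℂ) → (Fin N → ℂ) → ℂ} {F : ℕ → BiPoly N}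

theorem eval_zero (hF : IsExpansion A φ F) (l : Fin N → ℂ) :
    φ 0 l = eval 0 (atR l (F 0)) := by
  rw [hF.form, Finset.sum_eq_single_of_mem 0 (by simp)]
  · simp [bil]
  · intro i _ hi
    have := IsHomogeneous.eval_smul (hF.homR i l) 0 0
    rwa [smul_zero, zero_pow hi, zero_mul] at this

theorem atX_zero (hF : IsExpansion A φ F) (x : Fin N → ℂ) : atX x (F 0) = C (φ 0 0) := by
  have h1 : ∀ x, atX x (F 0) = C (eval 0 (atX x (F 0))) := fun x =>
    eq_C_of_isHomogeneous_zero (hF.homX 0 x)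
  have h2 : ∀ l, atR l (F 0) = C (eval 0 (atR l (F 0))) := fun l =>
    eq_C_of_isHomogeneous_zero (hF.homR 0 l)
  rw [h1, ← eval_atR, h2, eval_C, ← hF.eval_zero]

theorem atR_zero (hF : IsExpansion A φ F) (l : Fin N → ℂ) : atR l (F 0) = C (φ 0 0) := by
  apply MvPolynomial.funext
  intro x
  rw [eval_atR, hF.atX_zero]
  simp

theorem atX_top (hF : IsExpansion A φ F) (x : Fin N → ℂ) :
    atX x (F A.totalMult) = C (eval x A.poly) * A.poly := by
  apply MvPolynomial.funext
  intro l
  rw [← eval_atR, hF.top, map_mul, map_mul, eval_C, eval_C, mul_comm]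

/-- Evaluation of an operator in the spectral variable. -/
def evalOp (l : Fin N → ℂ) (T : Poly N →ₗ[ℂ] Poly N) : Poly N →ₗ[ℂ] ℂ :=
  (aeval l).toLinearMap ∘ₗ T

theorem evalOp_apply (l : Fin N → ℂ) (T : Poly N →ₗ[ℂ] Poly N) (f : Poly N) :
    evalOp l T f = eval l (T f) := rfl

/-- The coefficients of the twisted operator in the spectral variable, as polynomials in `x`. -/
def spectralTwist (A : Configuration N) (F : ℕ → BiPoly N) (l : Fin N → ℂ) : ℕ → Poly N
  | 0 => coeffMap (evalOp l (lhat A.poly)) (F 0)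
  | i + 1 => coeffMap (evalOp l (lhat A.poly)) (F (i + 1)) +
      C 2 * ∑ j, X j * (C (eval l A.poly) * coeffMap (evalOp l (pderiv j).toLinearMap) (F i) -
        C (eval l (pderiv j A.poly)) * atR l (F i))

theorem eval_spectralTwist (x l : Fin N → ℂ) (i : ℕ) :
    eval x (spectralTwist A F l i) =
      eval l (PowerSeries.coeff i (twist A.poly x (PowerSeries.mk fun i => atX x (F i)))) := by
  cases i with
  | zero =>
    rw [spectralTwist, eval_coeffMap, evalOp_apply, coeff_twist_zero, PowerSeries.coeff_mk]
  | succ i =>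
    rw [spectralTwist, coeff_twist_succ, map_add, eval_coeffMap, evalOp_apply,
      PowerSeries.coeff_mk, PowerSeries.coeff_mk, map_add]
    congr 1
    rw [map_mul, map_mul, eval_C, map_ofNat, gam_comm A.poly, gam_clin, gam_clin]
    congr 1
    rw [Finset.mul_sum, Finset.sum_mul, ← Finset.sum_sub_distrib, map_sum, map_sum]
    refine Finset.sum_congr rfl fun j _ => ?_
    simp only [map_mul, map_sub, eval_X, eval_C, eval_coeffMap, evalOp_apply, eval_atR]
    simp only [Derivation.coeFn_coe]
    ring

theorem spectralTwist_isHomogeneous (hF : IsExpansion A φ F) (l : Fin N → ℂ) (i : ℕ) :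
    (spectralTwist A F l i).IsHomogeneous i := by
  have hh : ∀ i, (F i).IsHomogeneous i := fun i => isHomogeneous_of_atR (hF.homR i)
  cases i with
  | zero => exact isHomogeneous_coeffMap (hh 0) _
  | succ i =>
    refine (isHomogeneous_coeffMap (hh _) _).add (IsHomogeneous.C_mul ?_ _)
    refine IsHomogeneous.sum _ _ _ fun j _ => ?_
    rw [add_comm i 1]
    exact (isHomogeneous_X ℂ j).mul (((isHomogeneous_coeffMap (hh _) _).C_mul _).sub
      ((hF.homR i l).C_mul _))

/-- In degree |m|+1 only the top coefficient A_m(x)A_m(λ) contributes, and its two first-order terms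
A_m ∂A_m cancel. -/
theorem spectralTwist_eq_zero_of_lt (hF : IsExpansion A φ F) (l : Fin N → ℂ) (i : ℕ)
    (hi : A.totalMult < i) : spectralTwist A F l i = 0 := by
  obtain ⟨i, rfl⟩ : ∃ j, i = j + 1 := ⟨i - 1, by omega⟩
  apply MvPolynomial.funext
  intro x
  rw [eval_spectralTwist, coeff_twist_succ, PowerSeries.coeff_mk, PowerSeries.coeff_mk,
    hF.eq_zero _ hi, map_zero, map_zero, zero_add]
  rcases Nat.lt_or_ge A.totalMult i with h | h
  · rw [hF.eq_zero _ h]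
    simp
  · obtain rfl : i = A.totalMult := by omega
    rw [hF.atX_top, gam_mul_right, gam_C, gam_comm A.poly]
    simp only [map_zero]
    rw [← map_zero (eval l)]
    congr 1
    ring

/-- (L in λ minus (x,x)) φ is quasi-invariant in x: the operator acts on the other variable, and
(x,x) is itself quasi-invariant. -/
theorem spectralTwist_mem (hF : IsExpansion A φ F) (l : Fin N → ℂ) (k : ℕ) :
    PowerSeries.coeff k (PowerSeries.mk (spectralTwist A F l) * expSer (clin l)) ∈ A.quasi := by
  have hb : ∀ k, ∀ l, atR l (bakerComp F k) ∈ Subalgebra.toSubmodule A.quasi := by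
    intro k l
    rw [atR_bakerComp]
    exact hF.quasi l k
  have hm : ∀ k, coeffMap (evalOp l (lhat A.poly)) (bakerComp F k) ∈ A.quasi := fun k =>
    coeffMap_mem (hb k) _
  have he : ∀ x, eval x (PowerSeries.coeff k
      (PowerSeries.mk (spectralTwist A F l) * expSer (clin l))) =
      eval l (PowerSeries.coeff k (twist A.poly x (PowerSeries.mk fun i => atX x (F i)) *
        expSer (clin x))) := by
    intro x
    refine eval_coeff_mul_expSer (fun i => ?_) k
    rw [PowerSeries.coeff_mk, eval_spectralTwist]
  have htw : ∀ x, twist A.poly x (PowerSeries.mk fun i => atX x (F i)) * expSer (clin x) =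
      cw (lhat A.poly) (PowerSeries.mk (fun i => atX x (F i)) * expSer (clin x)) -
        PowerSeries.X ^ 2 * (PowerSeries.C (A.poly * C (bil x x)) *
          (PowerSeries.mk (fun i => atX x (F i)) * expSer (clin x))) := by
    intro x
    rw [cw_lhat_mul_expSer]
    ring
  rcases Nat.lt_or_ge k 2 with hk | hk
  · have : PowerSeries.coeff k (PowerSeries.mk (spectralTwist A F l) * expSer (clin l)) =
        coeffMap (evalOp l (lhat A.poly)) (bakerComp F k) := by
      apply MvPolynomial.funext
      intro x
      rw [he, htw, eval_coeffMap, evalOp_apply, map_sub, PowerSeries.coeff_X_pow_mul',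
        if_neg (by omega), sub_zero, coeff_cw, atX_bakerComp]
    rw [this]
    exact hm k
  · have : PowerSeries.coeff k (PowerSeries.mk (spectralTwist A F l) * expSer (clin l)) =
        coeffMap (evalOp l (lhat A.poly)) (bakerComp F k) -
          C (eval l A.poly) * (quadForm * atR l (bakerComp F (k - 2))) := by
      apply MvPolynomial.funext
      intro x
      rw [he, htw, map_sub (eval x), eval_coeffMap, evalOp_apply, map_sub,
        PowerSeries.coeff_X_pow_mul', if_pos hk, coeff_cw, atX_bakerComp, PowerSeries.coeff_C_mul,
        map_sub]
      congr 1
      generalize hg : PowerSeries.coeff (k - 2)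
        (PowerSeries.mk (fun i => atX x (F i)) * expSer (clin x)) = g
      rw [map_mul, map_mul, map_mul, map_mul, eval_C, eval_C, eval_quadForm, eval_atR,
        atX_bakerComp, hg, mul_assoc]
    rw [this]
    refine sub_mem (hm k) ?_
    rw [C_mul']
    exact Subalgebra.smul_mem _ (mul_mem (quadForm_mem_quasi A) (hb (k - 2) l)) _

theorem eval_poly_ne_zero {l : Fin N → ℂ} (hl : A.Generic l) : eval l A.poly ≠ 0 := by
  rw [Configuration.poly, map_prod]
  refine Finset.prod_ne_zero_iff.2 fun α hα => ?_
  rw [map_pow, linForm_eq, eval_clin]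
  exact pow_ne_zero _ (hl α hα)

/-- `A(l)⁻¹ c` times the Baker--Akhiezer series is the only quasi-invariant multiple of the
exponential of degree at most `|m|` with top coefficient `c A(x)`. -/
theorem eq_smul_of_quasi (hF : IsExpansion A φ F) {l : Fin N → ℂ} (hl : A.Generic l)
    {s : PowerSeries (Poly N)} (hs : ∀ i, A.totalMult < i → PowerSeries.coeff i s = 0)
    (hhom : ∀ i, (PowerSeries.coeff i s).IsHomogeneous i)
    (hq : ∀ k, PowerSeries.coeff k (s * expSer (clin l)) ∈ A.quasi) :
    ∃ c : ℂ, s = PowerSeries.C (C c) * PowerSeries.mk fun i => atR l (F i) := by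
  obtain ⟨g, hg⟩ := hl.poly_dvd_top hs hq
  have hgc : ∃ c, g = C c := by
    by_cases h0 : g = 0
    · exact ⟨0, by rw [h0, C_0]⟩
    · have h1 := (hhom A.totalMult).totalDegree (by
        rw [hg]; exact mul_ne_zero A.poly_ne_zero h0)
      rw [hg, totalDegree_mul_of_isDomain A.poly_ne_zero h0,
        A.poly_isHomogeneous.totalDegree A.poly_ne_zero] at h1
      exact ⟨_, totalDegree_eq_zero_iff_eq_C.1 (by omega)⟩
  obtain ⟨c, rfl⟩ := hgc
  refine ⟨c / eval l A.poly, ?_⟩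
  rw [← sub_eq_zero]
  have hco : ∀ i, PowerSeries.coeff i (s - PowerSeries.C (C (c / eval l A.poly)) *
      PowerSeries.mk fun i => atR l (F i)) =
      PowerSeries.coeff i s - C (c / eval l A.poly) * atR l (F i) := by
    intro i
    rw [map_sub, PowerSeries.coeff_C_mul, PowerSeries.coeff_mk]
  refine hl.eq_zero (n := A.totalMult) (fun i hi => ?_) (fun i hi => ?_) fun k => ?_
  · rw [hco, hs i hi, hF.eq_zero i hi]
    simp
  · rw [hco] at hi ⊢
    have hle : i ≤ A.totalMult := by
      by_contra hlt
      push Not at hlt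
      apply hi
      rw [hs i hlt, hF.eq_zero i hlt]
      simp
    have hne : i ≠ A.totalMult := by
      rintro rfl
      apply hi
      rw [hg, hF.top, ← mul_assoc, ← C_mul, div_mul_cancel₀ _ (eval_poly_ne_zero hl)]
      ring
    exact ((hhom i).sub ((hF.homR i l).C_mul _)).totalDegree_le.trans_lt
      (lt_of_le_of_ne hle hne)
  · rw [sub_mul, map_sub, mul_assoc, PowerSeries.coeff_C_mul, C_mul']
    exact sub_mem (hq k) (Subalgebra.smul_mem _ (hF.quasi l k) _)

/-- The Baker--Akhiezer function is an eigenfunction of `L` in the spectral variable. -/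
theorem twist_atX (hF : IsExpansion A φ F) (h0 : φ 0 0 ≠ 0) (x : Fin N → ℂ) :
    twist A.poly x (PowerSeries.mk fun i => atX x (F i)) = 0 := by
  have hz : ∀ l, A.Generic l → PowerSeries.mk (spectralTwist A F l) = 0 := by
    intro l hl
    obtain ⟨c, hc⟩ := hF.eq_smul_of_quasi hl
      (s := PowerSeries.mk (spectralTwist A F l))
      (fun i hi => by rw [PowerSeries.coeff_mk, hF.spectralTwist_eq_zero_of_lt l i hi])
      (fun i => by rw [PowerSeries.coeff_mk]; exact hF.spectralTwist_isHomogeneous l i)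
      (hF.spectralTwist_mem l)
    -- The twisted series is c times the Baker–Akhiezer series. In degree 0 in x the latter is
    -- φ(0,0) ≠ 0, while the operator kills constants, so c = 0.
    have h1 := congrArg (fun s => eval 0 (PowerSeries.coeff 0 s)) hc
    simp only [PowerSeries.coeff_mk, PowerSeries.coeff_C_mul, eval_spectralTwist,
      coeff_twist_zero, hF.atX_zero, lhat_C, map_mul, hF.atR_zero, eval_C, map_zero] at h1
    have hc0 : c = 0 := by simpa [h0] using h1.symm
    rw [hc, hc0, C_0, map_zero, zero_mul]
  ext i : 1
  rw [map_zero]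
  refine eq_zero_of_generic (A := A) fun l hl => ?_
  rw [← eval_spectralTwist]
  have := congrArg (PowerSeries.coeff i) (hz l hl)
  rw [PowerSeries.coeff_mk, map_zero] at this
  rw [this, map_zero]

end IsExpansion

end

section

/-! ### The locus conditions -/

theorem mul_lhat_reduce (a : Fin N → ℂ) (m n : ℕ) (B U : Poly N) :
    clin a ^ 2 * lhat (clin a ^ m * B) (clin a ^ n * U) = clin a ^ m * (clin a ^ n *
      (C (bil a a * (n * ((n : ℂ) - 1 - 2 * m))) * (B * U) + clin a *
        (B * (clin a * lap U + (2 * (n : Poly N) - 2 * (m : Poly N)) * gam (clin a) U) -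
          2 * ((n : Poly N) * gam B (clin a) * U + clin a * gam B U)))) := by
  have h1 := lap_sub_gam_clin_pow_mul a n m U
  have h2 := gam_pow_left (clin a ^ n * U) (clin a) m
  have h3 := gam_pow_right B (clin a) n
  have h4 := gam_mul_right B (clin a ^ n) U
  rw [lhat_apply, gam_mul_left]
  linear_combination (clin a ^ m * B) * h1 - 2 * clin a * B * h2 -
    2 * clin a ^ 2 * clin a ^ m * h4 - 2 * clin a * clin a ^ m * U * h3

theorem mul_gam_sub_gam_mul_reduce (a y : Fin N → ℂ) (m n : ℕ) (B V : Poly N) :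
    clin a ^ 2 * (clin a ^ m * B * gam (clin y) (clin a ^ n * V) -
      gam (clin a ^ m * B) (clin y) * (clin a ^ n * V)) = clin a ^ m * (clin a ^ (n + 1) *
      (C (bil a y * ((n : ℂ) - m)) * (B * V) + clin a *
        (B * gam (clin y) V - gam B (clin y) * V))) := by
  have h2 := gam_pow_left (clin y) (clin a) m
  have h3 := gam_pow_right (clin y) (clin a) n
  have h4 := gam_mul_right (clin y) (clin a ^ n) V
  rw [gam_comm (clin y) (clin a)] at h3
  rw [gam_clin_clin] at h2 h3
  rw [gam_mul_left]
  simp only [map_mul, map_sub, map_natCast] at *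
  linear_combination (clin a ^ 2 * clin a ^ m * B) * h4 + (clin a * clin a ^ m * B * V) * h3 -
    (clin a * B * clin a ^ n * V) * h2

theorem dvd_C_mul_iff {a : Poly N} {c : ℂ} (hc : c ≠ 0) {f : Poly N} : a ∣ C c * f ↔ a ∣ f :=
  IsUnit.dvd_mul_left ((isUnit_iff_ne_zero.2 hc).map C)

section Residue

variable {a y : Fin N → ℂ} (ha : bil a a ≠ 0) (hy : bil a y ≠ 0) {m : ℕ} {B : Poly N}
  (hB : ¬ clin a ∣ B)

include ha hy hB

/-- Compare leading powers of ℓ = (a,x) in one step of the twisted recursion. The second-order term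
applied to ℓ^{n+1}U starts at order n-1 and the first-order term applied to ℓ^b V at order b-1,
after division by A_m. While b < n the latter stands alone and its coefficient b-m is nonzero, so V
gains a factor ℓ; at b = n the two leading coefficients must cancel modulo ℓ. -/
theorem exists_step {f g : Poly N} (hfg : lhat (clin a ^ m * B) f +
      2 * (clin a ^ m * B * gam (clin y) g - gam (clin a ^ m * B) (clin y) * g) = 0)
    {n : ℕ} (hn : n < m) {U : Poly N} (hf : f = clin a ^ (n + 1) * U) :
    ∃ V, g = clin a ^ n * V ∧
      clin a ∣ C (bil a a * ((n + 1) * ((n : ℂ) - 2 * m))) * U +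
        C (2 * (bil a y * ((n : ℂ) - m))) * V := by
  have hp := clin_prime ha
  have hl := clin_ne_zero ha
  have key : ∀ (b : ℕ) (V : Poly N), g = clin a ^ b * V → b ≤ n →
      ∃ R S, clin a ^ (n - b) * (C (bil a a * ((n + 1) * ((n : ℂ) - 2 * m))) * (B * U) +
        clin a * R) + 2 * (C (bil a y * ((b : ℂ) - m)) * (B * V) + clin a * S) = 0 := by
    intro b V hg hb
    refine ⟨B * (clin a * lap U + (2 * ((n + 1 : ℕ) : Poly N) - 2 * (m : Poly N)) *
      gam (clin a) U) - 2 * (((n + 1 : ℕ) : Poly N) * gam B (clin a) * U + clin a * gam B U),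
      B * gam (clin y) V - gam B (clin y) * V, ?_⟩
    have h1 := mul_lhat_reduce a m (n + 1) B U
    have h2 := mul_gam_sub_gam_mul_reduce a y m b B V
    rw [← hf] at h1
    rw [← hg] at h2
    have h3 : clin a ^ (n + 1) = clin a ^ (b + 1) * clin a ^ (n - b) := by
      rw [← pow_add]; congr 1; omega
    rw [h3] at h1
    refine (mul_eq_zero.1 ?_).resolve_left (mul_ne_zero (pow_ne_zero m hl) (pow_ne_zero (b + 1) hl))
    have h4 : ((n + 1 : ℕ) : ℂ) - 1 - 2 * m = n - 2 * m := by push_cast; ring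
    have h5 : ((n + 1 : ℕ) : ℂ) = n + 1 := by push_cast; ring
    rw [h4, h5] at h1
    linear_combination clin a ^ 2 * hfg - h1 - 2 * h2
  have hdiv : ∀ b ≤ n, ∃ V, g = clin a ^ b * V := by
    intro b
    induction b with
    | zero => exact fun _ => ⟨g, by simp⟩
    | succ b ih =>
      intro hb
      obtain ⟨V, hV⟩ := ih (by omega)
      obtain ⟨R, S, h1⟩ := key b V hV (by omega)
      rw [show n - b = (n - b - 1) + 1 by omega, pow_succ] at h1
      have h2 : clin a ∣ C (2 * (bil a y * ((b : ℂ) - m))) * (B * V) := by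
        rw [C_mul, show (C 2 : Poly N) = 2 from map_ofNat C 2]
        exact ⟨-(clin a ^ (n - b - 1) * (C (bil a a * ((n + 1) * ((n : ℂ) - 2 * m))) * (B * U) +
          clin a * R) + 2 * S), by linear_combination h1⟩
      have h3 : (2 * (bil a y * ((b : ℂ) - m))) ≠ 0 := by
        have : ((b : ℂ) - m) ≠ 0 := sub_ne_zero.2 (by exact_mod_cast (by omega : b ≠ m))
        simp [hy, this]
      rw [dvd_C_mul_iff h3] at h2
      obtain ⟨W, rfl⟩ := (hp.dvd_or_dvd h2).resolve_left hB
      exact ⟨W, by rw [hV, pow_succ]; ring⟩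
  obtain ⟨V, hV⟩ := hdiv n le_rfl
  refine ⟨V, hV, ?_⟩
  obtain ⟨R, S, h1⟩ := key n V hV le_rfl
  rw [Nat.sub_self, pow_zero, one_mul] at h1
  refine (hp.dvd_or_dvd ?_).resolve_left hB
  rw [C_mul (a := 2), show (C 2 : Poly N) = 2 from map_ofNat C 2]
  exact ⟨-(R + 2 * S), by linear_combination h1⟩

/-- The leading coefficients along a hyperplane of a solution of the twisted equation. -/
theorem exists_residue {P : ℕ → Poly N} {c : ℂ} (h0 : P 0 = C c * (clin a ^ m * B))
    (hP : ∀ j < m, lhat (clin a ^ m * B) (P j) + 2 * (clin a ^ m * B * gam (clin y) (P (j + 1)) -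
      gam (clin a ^ m * B) (clin y) * P (j + 1)) = 0) (j : ℕ) (hj : j ≤ m) :
    ∃ U, P j = clin a ^ (m - j) * U ∧ clin a ∣ C (bil a y ^ j) * U -
      C (c * ∏ i ∈ Finset.range j, (-(bil a a * ((m - i) * (m + i + 1))) / (2 * (i + 1)))) * B := by
  induction j with
  | zero => exact ⟨C c * B, by rw [h0, Nat.sub_zero]; ring, by simp⟩
  | succ j ih =>
    obtain ⟨U, hU, hd⟩ := ih (by omega)
    -- With n = m-(j+1) the two constants are -(a,a)(m-j)(m+j+1) and -2(a,y)(j+1), whose quotient is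
    -- the factor i = j of the product.
    obtain ⟨V, hV, hd'⟩ := exists_step ha hy hB (hP j (by omega)) (n := m - (j + 1)) (by omega)
      (U := U) (by rw [hU]; congr 2; omega)
    refine ⟨V, hV, ?_⟩
    have hc : ((m - (j + 1) : ℕ) : ℂ) = m - (j + 1) := by
      rw [Nat.cast_sub hj]; push_cast; ring
    rw [hc] at hd'
    have hj0 : (2 * ((j : ℂ) + 1)) ≠ 0 := by
      have : ((j : ℂ) + 1) ≠ 0 := by exact_mod_cast Nat.succ_ne_zero j
      simp [this]
    rw [Finset.prod_range_succ, ← dvd_C_mul_iff (neg_ne_zero.2 hj0)]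
    have e := (hd'.mul_left (C (bil a y ^ j))).sub
      (hd.mul_left (C (bil a a * ((m - (j + 1) + 1) * ((m : ℂ) - (j + 1) - 2 * m)))))
    convert e using 1
    set p := ∏ i ∈ Finset.range j, (-(bil a a * ((m - i) * (m + i + 1))) / (2 * ((i : ℂ) + 1)))
    have e1 : -(2 * ((j : ℂ) + 1)) * bil a y ^ (j + 1) =
        bil a y ^ j * (2 * (bil a y * ((m : ℂ) - (j + 1) - m))) := by ring
    have e2 : -(2 * ((j : ℂ) + 1)) * (c * (p * (-(bil a a * ((m - j) * (m + j + 1))) /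
        (2 * ((j : ℂ) + 1))))) =
        -(bil a a * ((m - (j + 1) + 1) * ((m : ℂ) - (j + 1) - 2 * m))) * (c * p) := by
      field_simp
      ring
    have e1' := congrArg (C (σ := Fin N)) e1
    have e2' := congrArg (C (σ := Fin N)) e2
    simp only [C_mul, C_neg] at e1' e2' ⊢
    linear_combination V * e1' - B * e2'

end Residue

theorem refl_expSer_coeff {a l : Fin N → ℂ} {m : ℕ} (hl : bil a l = 0) (k : ℕ) :
    PowerSeries.coeff k (expSer (clin l)) ∈ quasiInv a m := by
  refine refl_eq_mem_quasiInv ?_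
  have : algebraMap ℚ (Poly N) (1 / k.factorial) = C (algebraMap ℚ ℂ (1 / k.factorial)) := rfl
  rw [coeff_expSer, this, map_mul, map_pow, refl_clin_of_orthogonal hl]
  congr 1
  exact (refl a).commutes _

theorem Configuration.mult_le_totalMult (A : Configuration N) {α : Fin N → ℝ}
    (hα : α ∈ A.vectors) : A.mult α ≤ A.totalMult :=
  Finset.single_le_sum (f := A.mult) (fun _ _ => Nat.zero_le _) hα

namespace IsExpansion

variable {A : Configuration N} {φ : (Fin N → ℂ) → (Fin N → ℂ) → ℂ} {F : ℕ → BiPoly N}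

/-- A configuration with a nondegenerate Baker--Akhiezer function satisfies the locus
conditions. -/
theorem locus (hF : IsExpansion A φ F) (h0 : φ 0 0 ≠ 0) : A.Locus := by
  intro α hα
  set a := cvec α
  set m := A.mult α
  set B := A.cofactor α
  have ha : bil a a ≠ 0 := A.bil_self_ne_zero hα
  have hB : ¬ clin a ∣ B := not_dvd_cofactor hα
  have hA : A.poly = clin a ^ m * B := A.poly_eq hα
  have hm : m ≤ A.totalMult := A.mult_le_totalMult hα
  -- A spectral parameter on the mirror of α but with nonzero cofactor; genericity is deliberately
  -- given up.
  obtain ⟨l, hl, hBl⟩ : ∃ l, bil a l = 0 ∧ eval l B ≠ 0 := by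
    by_contra hne
    push Not at hne
    exact hB ((clin_dvd_iff ha B).2 hne)
  set K : ℂ := ∏ i ∈ Finset.range m, (-(bil a a * ((m - i) * (m + i + 1))) / (2 * ((i : ℂ) + 1)))
  have hK : K ≠ 0 := by
    refine Finset.prod_ne_zero_iff.2 fun i hi => ?_
    have hi := Finset.mem_range.1 hi
    have h1 : (m : ℂ) - i ≠ 0 := sub_ne_zero.2 (by exact_mod_cast hi.ne')
    have h2 : (m : ℂ) + i + 1 ≠ 0 := by exact_mod_cast Nat.succ_ne_zero (m + i)
    have h3 : (i : ℂ) + 1 ≠ 0 := by exact_mod_cast Nat.succ_ne_zero i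
    exact div_ne_zero (neg_ne_zero.2 (mul_ne_zero ha (mul_ne_zero h1 h2)))
      (mul_ne_zero two_ne_zero h3)
  -- The recursion in the spectral variable, run m times from A_m(x)A_m(λ), determines the
  -- coefficient of degree |m|-m on the mirror: a nonzero constant times B(l)B(x). Dividing by
  -- (a,x)^m requires x off the mirror.
  have hval : ∀ x, bil a x ≠ 0 → eval x (atR l (F (A.totalMult - m))) =
      K * eval l B * eval x B := by
    intro x hx
    obtain ⟨U, hU, hd⟩ := exists_residue ha hx hB (c := eval x A.poly)
      (P := fun j => atX x (F (A.totalMult - j)))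
      (by simp only [Nat.sub_zero]; rw [hF.atX_top, hA]) (fun j hj => by
        have h1 := congrArg (PowerSeries.coeff (A.totalMult - (j + 1) + 1)) (hF.twist_atX h0 x)
        rw [coeff_twist_succ, PowerSeries.coeff_mk, PowerSeries.coeff_mk, map_zero,
          show A.totalMult - (j + 1) + 1 = A.totalMult - j by omega, hA] at h1
        exact h1) m le_rfl
    rw [Nat.sub_self, pow_zero, one_mul] at hU
    have h1 := (clin_dvd_iff ha _).1 hd l hl
    simp only [map_sub, map_mul, eval_C] at h1
    rw [eval_atR, hU]
    apply mul_left_cancel₀ (pow_ne_zero m hx)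
    have h2 : eval x A.poly = bil a x ^ m * eval x B := by
      rw [hA, map_mul, map_pow, eval_clin]
    rw [h2] at h1
    linear_combination h1
  have hpoly : atR l (F (A.totalMult - m)) = C (K * eval l B) * B := by
    rw [← sub_eq_zero]
    refine (mul_eq_zero.1 (?_ : clin a * _ = 0)).resolve_left (clin_ne_zero ha)
    apply MvPolynomial.funext
    intro x
    rw [map_mul, eval_clin, map_zero, mul_eq_zero, or_iff_not_imp_left]
    intro hx
    rw [map_sub, hval x hx, map_mul, eval_C, sub_self]
  -- Since (a,l) = 0, the factor e^{-(l,x)} is invariant under the reflection, so it can be removed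
  -- without losing quasi-invariance, leaving the bare coefficient.
  have hmem : atR l (F (A.totalMult - m)) ∈ quasiInv a m := by
    have h1 : PowerSeries.mk (fun i => atR l (F i)) =
        (PowerSeries.mk (fun i => atR l (F i)) * expSer (clin l)) * expSer (clin (-l)) := by
      have : clin (-l) = -clin l := by simp [clin]
      rw [this, mul_assoc, expSer_mul_expSer_neg, mul_one]
    have h2 := congrArg (PowerSeries.coeff (A.totalMult - m)) h1
    rw [PowerSeries.coeff_mk, PowerSeries.coeff_mul] at h2
    rw [h2]
    refine sum_mem fun p _ => mul_mem (Configuration.mem_quasi.1 (hF.quasi l p.1) α hα) ?_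
    refine refl_expSer_coeff ?_ _
    rw [← neg_one_smul ℂ l, bil_smul_right, hl, mul_zero]
  have h3 := Subalgebra.smul_mem _ hmem (K * eval l B)⁻¹
  rwa [hpoly, ← C_mul', ← mul_assoc, ← C_mul, inv_mul_cancel₀ (mul_ne_zero hK hBl), C_1,
    one_mul] at h3

end IsExpansion

end

section

/-! ### Symmetry of the Baker--Akhiezer function -/

theorem natDegree_line_le {f : Poly N} {k : ℕ} (hf : f.totalDegree ≤ k) (x y : Fin N → ℂ) :
    (line x y f).natDegree ≤ k := by
  have := MvPolynomial.aeval_natDegree_le f hf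
    (fun i => Polynomial.C (x i) + Polynomial.C (y i) * Polynomial.X) (n := 1) fun i => by
      compute_degree
  simpa [line] using this

theorem coeff_line_of_isHomogeneous {f : Poly N} {k : ℕ} (hf : f.IsHomogeneous k)
    (x y : Fin N → ℂ) : (line x y f).coeff k = eval y f := by
  -- By homogeneity f(x+ty) = t^k f(y+t⁻¹x): exchanging the two vectors reverses the coefficients.
  have h1 : line x y f = (line y x f).reflect k := by
    refine Polynomial.eq_of_infinite_eval_eq _ _ (Set.Infinite.mono ?_
      (Set.Finite.infinite_compl (Set.finite_singleton (0 : ℂ))))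
    intro t ht
    have ht : t ≠ 0 := ht
    let _ : Invertible t⁻¹ := invertibleOfNonzero (inv_ne_zero ht)
    have h2 := Polynomial.eval₂_reflect_mul_pow (RingHom.id ℂ) t⁻¹ k (line y x f)
      (natDegree_line_le hf.totalDegree_le y x)
    rw [invOf_eq_inv, inv_inv, Polynomial.eval₂_id, Polynomial.eval₂_id, eval_line] at h2
    rw [Set.mem_ofPred_eq, eval_line, ← mul_left_inj' (pow_ne_zero k (inv_ne_zero ht)), h2,
      mul_comm, ← IsHomogeneous.eval_smul hf]
    congr 2
    rw [smul_add, smul_smul, inv_mul_cancel₀ ht, one_smul, add_comm]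
  rw [h1, Polynomial.coeff_reflect, Polynomial.revAt_le le_rfl, Nat.sub_self,
    Polynomial.coeff_zero_eq_eval_zero, eval_line]
  simp

theorem derivative_line (x y : Fin N → ℂ) (f : Poly N) :
    Polynomial.derivative (line x y f) = line x y (gam (clin y) f) := by
  induction f using MvPolynomial.induction_on with
  | C r => rw [gam_C]; simp [line]
  | add p q hp hq => simp [hp, hq]
  | mul_X p i hp =>
    rw [gam_mul_right, map_add, map_mul (line x y), map_mul (line x y) (X i), ← hp,
      map_mul (line x y), Polynomial.derivative_mul, gam_clin]
    classical
    simp [line, pderiv_X, Pi.single_apply]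
    ring

/-- A solution of lower degree of the first order equation `w ∂_y u = u ∂_y w` vanishes. -/
theorem eq_zero_of_wronskian {y : Fin N → ℂ} {u w : Poly N} {k n : ℕ} (hu : u.totalDegree ≤ k)
    (hw : w.IsHomogeneous n) (hkn : k < n) (hwy : eval y w ≠ 0)
    (h : w * gam (clin y) u = u * gam (clin y) w) : u = 0 := by
  apply MvPolynomial.funext
  intro x
  have h1 := congrArg (line x y) h
  rw [map_mul, map_mul, ← derivative_line, ← derivative_line] at h1
  have hf := natDegree_line_le hu x y
  have hg := natDegree_line_le hw.totalDegree_le x y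
  have hgn : (line x y w).coeff n ≠ 0 := by rwa [coeff_line_of_isHomogeneous hw]
  have hx : eval x u = (line x y u).eval 0 := by rw [eval_line]; simp
  rw [hx, map_zero]
  generalize line x y u = f at *
  generalize line x y w = g at *
  suffices f = 0 by simp [this]
  by_contra hne
  have hd : ∀ q : Polynomial ℂ, (Polynomial.X * Polynomial.derivative q).natDegree ≤ q.natDegree := by
    intro q
    rcases Nat.eq_zero_or_pos q.natDegree with h0 | h0
    · rw [Polynomial.derivative_of_natDegree_zero h0]; simp
    · refine Polynomial.natDegree_mul_le.trans ?_
      have := Polynomial.natDegree_derivative_le q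
      rw [Polynomial.natDegree_X]
      omega
  have hc : ∀ (q : Polynomial ℂ) (r : ℕ), (Polynomial.X * Polynomial.derivative q).coeff r =
      r * q.coeff r := by
    intro q r
    cases r with
    | zero => simp
    | succ r => rw [Polynomial.coeff_X_mul, Polynomial.coeff_derivative]; push_cast; ring
  -- Using t d/dt instead of d/dt makes the top coefficients comparable: the equation forces deg f =
  -- n, which is too large.
  have h2 : g * (Polynomial.X * Polynomial.derivative f) =
      (Polynomial.X * Polynomial.derivative g) * f := by
    linear_combination Polynomial.X * h1
  have h3 := congrArg (fun q => q.coeff (n + f.natDegree)) h2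
  rw [Polynomial.coeff_mul_add_eq_of_natDegree_le hg (hd f),
    Polynomial.coeff_mul_add_eq_of_natDegree_le ((hd g).trans hg) le_rfl, hc, hc] at h3
  have hl : f.coeff f.natDegree ≠ 0 := by simpa using hne
  have h4 : (f.natDegree : ℂ) = n := by
    apply mul_left_cancel₀ (mul_ne_zero hgn hl)
    linear_combination h3
  have h5 : f.natDegree = n := by exact_mod_cast h4
  omega

theorem IsHomogeneous.eval_zero {f : Poly N} {k : ℕ} (hf : f.IsHomogeneous k) (hk : k ≠ 0) :
    eval 0 f = 0 := by
  have := IsHomogeneous.eval_smul hf 0 0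
  rwa [smul_zero, zero_pow hk, zero_mul] at this

theorem isHomogeneous_coeff_expSer (y : Fin N → ℂ) (k : ℕ) :
    (PowerSeries.coeff k (expSer (clin y))).IsHomogeneous k := by
  have : algebraMap ℚ (Poly N) (1 / k.factorial) = C (algebraMap ℚ ℂ (1 / k.factorial)) := rfl
  rw [coeff_expSer, this, mul_comm]
  have := ((clin_isHomogeneous y).pow k).C_mul (algebraMap ℚ ℂ (1 / k.factorial))
  simpa [mul_comm] using this

namespace IsExpansion

variable {A : Configuration N} {φ : (Fin N → ℂ) → (Fin N → ℂ) → ℂ} {F : ℕ → BiPoly N}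

theorem coeff_twist_top (hF : IsExpansion A φ F) (l : Fin N → ℂ) {i : ℕ} (hi : A.totalMult < i) :
    PowerSeries.coeff i (twist A.poly l (PowerSeries.mk fun i => atR l (F i))) = 0 := by
  obtain ⟨i, rfl⟩ : ∃ j, i = j + 1 := ⟨i - 1, by omega⟩
  rw [coeff_twist_succ, PowerSeries.coeff_mk, PowerSeries.coeff_mk, hF.eq_zero _ hi, map_zero,
    map_zero, zero_add]
  rcases Nat.lt_or_ge A.totalMult i with h | h
  · rw [hF.eq_zero _ h]
    simp
  · obtain rfl : i = A.totalMult := by omega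
    rw [hF.top, gam_mul_right, gam_C, gam_comm A.poly]
    ring

/-- Each term at index i has degree at most |m|+i-2, and the constant coefficient is killed; strict
inequality is what the uniqueness principle needs after division by A_m. -/
theorem totalDegree_coeff_twist (hF : IsExpansion A φ F) (l : Fin N → ℂ) {i : ℕ}
    (h : PowerSeries.coeff i (twist A.poly l (PowerSeries.mk fun i => atR l (F i))) ≠ 0) :
    (PowerSeries.coeff i (twist A.poly l (PowerSeries.mk fun i => atR l (F i)))).totalDegree <
      A.totalMult + A.totalMult := by
  have hi : i ≤ A.totalMult := by
    by_contra hlt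
    exact h (hF.coeff_twist_top l (by omega))
  have hA := A.poly_isHomogeneous
  cases i with
  | zero =>
    rw [coeff_twist_zero, PowerSeries.coeff_mk, hF.atR_zero, lhat_C] at h
    exact absurd rfl h
  | succ i =>
    suffices PowerSeries.coeff (i + 1) (twist A.poly l (PowerSeries.mk fun i => atR l (F i))) ∈
        restrictTotalDegree (Fin N) ℂ (A.totalMult + A.totalMult - 1) by
      rw [mem_restrictTotalDegree] at this
      omega
    have hm : ∀ {f : Poly N} {k : ℕ}, f.IsHomogeneous k → k ≤ A.totalMult + A.totalMult - 1 →
        f ∈ restrictTotalDegree (Fin N) ℂ (A.totalMult + A.totalMult - 1) := fun hf hk => by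
      rw [mem_restrictTotalDegree]
      exact hf.totalDegree_le.trans hk
    rw [coeff_twist_succ, PowerSeries.coeff_mk, PowerSeries.coeff_mk, lhat_apply, lap_apply,
      gam_clin, gam_comm A.poly (clin l), gam_clin, gam_apply, two_mul, two_mul, Finset.mul_sum,
      Finset.mul_sum, Finset.sum_mul]
    have h1 := hF.homR (i + 1) l
    have h0 := hF.homR i l
    have m1 : ∑ j, A.poly * pderiv j (pderiv j (atR l (F (i + 1)))) ∈
        restrictTotalDegree (Fin N) ℂ (A.totalMult + A.totalMult - 1) :=
      sum_mem fun j _ => hm (hA.mul h1.pderiv.pderiv) (by omega)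
    have m2 : ∑ j, pderiv j A.poly * pderiv j (atR l (F (i + 1))) ∈
        restrictTotalDegree (Fin N) ℂ (A.totalMult + A.totalMult - 1) :=
      sum_mem fun j _ => hm (hA.pderiv.mul h1.pderiv) (by omega)
    have m3 : ∑ j, A.poly * (C (l j) * pderiv j (atR l (F i))) ∈
        restrictTotalDegree (Fin N) ℂ (A.totalMult + A.totalMult - 1) :=
      sum_mem fun j _ => hm (hA.mul (h0.pderiv.C_mul _)) (by omega)
    have m4 : ∑ j, C (l j) * pderiv j A.poly * atR l (F i) ∈
        restrictTotalDegree (Fin N) ℂ (A.totalMult + A.totalMult - 1) :=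
      sum_mem fun j _ => hm ((hA.pderiv.C_mul _).mul h0) (by omega)
    exact add_mem (sub_mem m1 (add_mem m2 m2)) (add_mem (sub_mem m3 m4) (sub_mem m3 m4))

/-- By the locus conditions (L - (l,l))φ is A_m⁻¹ times the twisted series, so it is
quasi-invariant. Its polynomial factor has degree below |m|, hence it vanishes. -/
theorem twist_atR_of_generic (hF : IsExpansion A φ F) (hA : A.Locus) {l : Fin N → ℂ}
    (hl : A.Generic l) : twist A.poly l (PowerSeries.mk fun i => atR l (F i)) = 0 := by
  set s := PowerSeries.mk fun i => atR l (F i) with hs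
  choose g hg hgA using fun k => hA.exists_lhat (hF.quasi l k)
  set G : PowerSeries (Poly N) := PowerSeries.mk fun k =>
    g k - PowerSeries.coeff k (PowerSeries.X ^ 2 * (PowerSeries.C (C (bil l l)) *
      (s * expSer (clin l)))) with hG
  have hGq : ∀ k, PowerSeries.coeff k G ∈ A.quasi := by
    intro k
    rw [hG, PowerSeries.coeff_mk]
    refine sub_mem (hg k) ?_
    rw [PowerSeries.coeff_X_pow_mul']
    split_ifs
    · rw [PowerSeries.coeff_C_mul, C_mul']
      exact Subalgebra.smul_mem _ (hF.quasi l _) _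
    · exact zero_mem _
  have h1 : twist A.poly l s * expSer (clin l) = PowerSeries.C A.poly * G := by
    have h2 := cw_lhat_mul_expSer A.poly l s
    have h3 : cw (lhat A.poly) (s * expSer (clin l)) = PowerSeries.C A.poly * PowerSeries.mk g := by
      ext k : 1
      rw [coeff_cw, PowerSeries.coeff_C_mul, PowerSeries.coeff_mk, hgA]
    have h4 : G = PowerSeries.mk g - PowerSeries.X ^ 2 * (PowerSeries.C (C (bil l l)) *
        (s * expSer (clin l))) := by
      ext k : 1
      rw [hG, PowerSeries.coeff_mk, map_sub, PowerSeries.coeff_mk]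
    rw [h4, mul_sub, ← h3, h2, map_mul]
    ring
  have h5 : twist A.poly l s = PowerSeries.C A.poly * (G * expSer (-clin l)) := by
    rw [← mul_assoc, ← h1, mul_assoc, expSer_mul_expSer_neg, mul_one]
  have hco : ∀ i, PowerSeries.coeff i (twist A.poly l s) =
      A.poly * PowerSeries.coeff i (G * expSer (-clin l)) := by
    intro i
    rw [h5, PowerSeries.coeff_C_mul]
  have h6 : G * expSer (-clin l) = 0 := by
    refine hl.eq_zero (n := A.totalMult) (fun i hi => ?_) (fun i hi => ?_) fun k => ?_
    · have := hF.coeff_twist_top l hi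
      rw [← hs, hco] at this
      exact (mul_eq_zero.1 this).resolve_left A.poly_ne_zero
    · have hne := mul_ne_zero A.poly_ne_zero hi
      have := hF.totalDegree_coeff_twist l (i := i) (by rwa [← hs, hco])
      rw [← hs, hco, totalDegree_mul_of_isDomain A.poly_ne_zero hi,
        A.poly_isHomogeneous.totalDegree A.poly_ne_zero] at this
      omega
    · rw [mul_assoc, mul_comm (expSer _), expSer_mul_expSer_neg, mul_one]
      exact hGq k
  rw [h5, h6, mul_zero]

/-- Both sets of coefficients satisfy the same recursion with the same top term. If they agree at
i+1, their difference u at i solves A ∂_y u = u ∂_y A with deg u < |m|, so it vanishes; descend from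
the top. -/
theorem symm_of_generic (hF : IsExpansion A φ F) (h0 : φ 0 0 ≠ 0) {y : Fin N → ℂ}
    (hy : A.Generic y) (i : ℕ) : atX y (F i) = atR y (F i) := by
  have hR := hF.twist_atR_of_generic (hF.locus h0) hy
  have hX := hF.twist_atX h0 y
  have htop : ∀ i, A.totalMult ≤ i → atX y (F i) = atR y (F i) := by
    intro i hi
    rcases Nat.eq_or_lt_of_le hi with rfl | hi
    · rw [hF.atX_top, hF.top]
    · rw [hF.eq_zero i hi, map_zero, map_zero]
  have : ∀ k i, A.totalMult ≤ i + k → atX y (F i) = atR y (F i) := by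
    intro k
    induction k with
    | zero => exact htop
    | succ k ih =>
      intro i hi
      rcases Nat.lt_or_ge i A.totalMult with hlt | hge
      swap
      · exact htop i hge
      have e1 := congrArg (PowerSeries.coeff (i + 1)) hR
      have e2 := congrArg (PowerSeries.coeff (i + 1)) hX
      rw [coeff_twist_succ, PowerSeries.coeff_mk, PowerSeries.coeff_mk, map_zero] at e1 e2
      rw [ih (i + 1) (by omega)] at e2
      rw [← sub_eq_zero]
      refine eq_zero_of_wronskian (y := y) (k := i) ?_ A.poly_isHomogeneous hlt
        (eval_poly_ne_zero hy) ?_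
      · exact ((hF.homX i y).sub (hF.homR i y)).totalDegree_le
      · have h2 : (2 : Poly N) ≠ 0 := two_ne_zero
        apply mul_left_cancel₀ h2
        rw [gam_comm (clin y) A.poly, map_sub]
        linear_combination e2 - e1
  exact this A.totalMult i (by omega)

theorem atX_eq_atR (hF : IsExpansion A φ F) (h0 : φ 0 0 ≠ 0) (l : Fin N → ℂ) (i : ℕ) :
    atX l (F i) = atR l (F i) := by
  rw [← sub_eq_zero]
  refine eq_zero_of_generic (A := A) fun y hy => ?_
  rw [map_sub, ← eval_atR, ← hF.symm_of_generic h0 hy, ← eval_atR, sub_self]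

/-- The homogeneous components of the Baker--Akhiezer function in either variable. -/
theorem symm (hF : IsExpansion A φ F) (h0 : φ 0 0 ≠ 0) (k : ℕ) (x l : Fin N → ℂ) :
    eval x (atR l (bakerComp F k)) = eval l (atR x (bakerComp F k)) := by
  rw [eval_atR, atX_bakerComp, atR_bakerComp]
  simp only [hF.atX_eq_atR h0]

theorem twist_atR (hF : IsExpansion A φ F) (h0 : φ 0 0 ≠ 0) (l : Fin N → ℂ) :
    twist A.poly l (PowerSeries.mk fun i => atR l (F i)) = 0 := by
  rw [← hF.twist_atX h0 l]
  simp only [hF.atX_eq_atR h0]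

theorem comp_mem (hF : IsExpansion A φ F) (k : ℕ) (l : Fin N → ℂ) :
    atR l (bakerComp F k) ∈ A.quasi := by
  rw [atR_bakerComp]
  exact hF.quasi l k

theorem comp_isHomogeneous (hF : IsExpansion A φ F) (k : ℕ) (l : Fin N → ℂ) :
    (atR l (bakerComp F k)).IsHomogeneous k := by
  rw [atR_bakerComp, PowerSeries.coeff_mul]
  refine IsHomogeneous.sum _ _ _ fun p hp => ?_
  rw [← Finset.HasAntidiagonal.mem_antidiagonal.1 hp, PowerSeries.coeff_mk]
  exact (hF.homR _ l).mul (isHomogeneous_coeff_expSer l _)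

theorem comp_zero (hF : IsExpansion A φ F) (l : Fin N → ℂ) :
    atR l (bakerComp F 0) = C (φ 0 0) := by
  rw [atR_bakerComp, PowerSeries.coeff_mul]
  simp [coeff_expSer, hF.atR_zero]

theorem cw_lhat_comp (hF : IsExpansion A φ F) (h0 : φ 0 0 ≠ 0) (l : Fin N → ℂ) :
    cw (lhat A.poly) (PowerSeries.mk (fun i => atR l (F i)) * expSer (clin l)) =
      PowerSeries.X ^ 2 * (PowerSeries.C (A.poly * C (bil l l)) *
        (PowerSeries.mk (fun i => atR l (F i)) * expSer (clin l))) := by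
  rw [cw_lhat_mul_expSer, hF.twist_atR h0]
  ring

theorem lhat_comp (hF : IsExpansion A φ F) (h0 : φ 0 0 ≠ 0) (l : Fin N → ℂ) (k : ℕ) :
    lhat A.poly (atR l (bakerComp F (k + 2))) =
      A.poly * (C (bil l l) * atR l (bakerComp F k)) := by
  have h1 := congrArg (PowerSeries.coeff (k + 2)) (hF.cw_lhat_comp h0 l)
  rw [coeff_cw, ← atR_bakerComp, PowerSeries.coeff_X_pow_mul', if_pos (by omega),
    Nat.add_sub_cancel, PowerSeries.coeff_C_mul, ← atR_bakerComp] at h1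
  rw [h1, mul_assoc]

end IsExpansion

end

section

/-! ### Calculus of differential operators with rational coefficients -/

theorem derivation_ratFun_eq_zero {D : Derivation ℂ (RatFun N) (RatFun N)}
    (h : ∀ p, D (toRat p) = 0) : D = 0 := by
  ext f
  obtain ⟨p, r, hr, rfl⟩ := IsFractionRing.div_surjective (A := Poly N) f
  have hr0 : toRat r ≠ 0 := by
    simpa using nonZeroDivisors.ne_zero hr
  have h1 := D.leibniz (toRat p / toRat r) (toRat r)
  rw [div_mul_cancel₀ _ hr0, h, h, smul_zero, zero_add, smul_eq_mul, eq_comm, mul_eq_zero] at h1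
  simpa using h1.resolve_left hr0

theorem toRat_injective : Function.Injective (toRat : Poly N → RatFun N) :=
  IsFractionRing.injective (Poly N) (RatFun N)

theorem toRat_ne_zero {p : Poly N} (hp : p ≠ 0) : toRat p ≠ 0 :=
  fun h => hp (toRat_injective (h.trans (map_zero _).symm))

theorem toRat_C (c : ℂ) : toRat (C c : Poly N) = algebraMap ℂ (RatFun N) c := rfl

theorem smul_toRat (c : ℂ) (p : Poly N) : c • toRat p = toRat (c • p) := by
  rw [Algebra.smul_def, ← toRat_C, ← map_mul, C_mul']

theorem pd_apply (i : Fin N) (f : RatFun N) : pd i f = partialRat i f := rfl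

theorem pd_toRat (i : Fin N) (p : Poly N) : pd i (toRat p) = toRat (pderiv i p) :=
  partialRat_toRat i p

theorem mulOp_apply (f g : RatFun N) : mulOp f g = f * g := rfl

theorem pd_comm (i j : Fin N) : pd i * pd j = (pd j * pd i : Module.End ℂ (RatFun N)) := by
  have h : ⁅partialRat i, partialRat j⁆ = (0 : Derivation ℂ (RatFun N) (RatFun N)) := by
    refine derivation_ratFun_eq_zero fun p => ?_
    rw [Derivation.commutator_apply, partialRat_toRat, partialRat_toRat, partialRat_toRat,
      partialRat_toRat, pderiv_pderiv_comm, sub_self]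
  ext f
  have := congrArg (fun D : Derivation ℂ (RatFun N) (RatFun N) => D f) h
  rw [Derivation.commutator_apply, Derivation.zero_apply, sub_eq_zero] at this
  exact this

theorem pd_mul_mulOp (i : Fin N) (f : RatFun N) :
    pd i * mulOp f = mulOp f * pd i + mulOp (partialRat i f) := by
  ext g
  simp only [Module.End.mul_apply, LinearMap.add_apply, mulOp_apply, pd_apply, Derivation.leibniz,
    smul_eq_mul]
  ring

theorem mulOp_mul_mulOp (f g : RatFun N) : mulOp f * mulOp g = mulOp (f * g) := by
  ext h
  simp [mulOp_apply, mul_assoc]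

theorem mulOp_add (f g : RatFun N) : mulOp (f + g) = mulOp f + mulOp g := by
  ext h
  simp [mulOp_apply, add_mul]

theorem pdMulti_zero : pdMulti (0 : Fin N →₀ ℕ) = 1 := by
  simp [pdMulti]

-- The partial derivatives generate a commutative subalgebra, in which the ordered product becomes
-- an ordinary finite product.
open scoped IsMulCommutative in
theorem pdMulti_add_single (ν : Fin N →₀ ℕ) (i : Fin N) :
    pdMulti (ν + Finsupp.single i 1) = pd i * pdMulti ν ∧
      pdMulti (ν + Finsupp.single i 1) = pdMulti ν * pd i := by
  classical
  obtain ⟨S, hS, hmem⟩ : ∃ S : Subalgebra ℂ (Module.End ℂ (RatFun N)),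
      IsMulCommutative S ∧ ∀ i, pd i ∈ S := by
    refine ⟨Algebra.adjoin ℂ (Set.range pd), Algebra.isMulCommutative_adjoin ℂ ?_,
      fun i => Algebra.subset_adjoin ⟨i, rfl⟩⟩
    rintro _ ⟨i, rfl⟩ _ ⟨j, rfl⟩
    exact pd_comm i j
  let q : Fin N → S := fun i => ⟨pd i, hmem i⟩
  have hq : ∀ ν : Fin N →₀ ℕ, pdMulti ν = ((∏ i, q i ^ ν i : S) : Module.End ℂ (RatFun N)) := by
    intro ν
    rw [← List.prod_ofFn]
    have := map_list_prod S.val (List.ofFn fun i => q i ^ ν i)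
    rw [List.map_ofFn] at this
    exact this.symm
  have h1 : (∏ j, q j ^ ((ν + Finsupp.single i 1 : Fin N →₀ ℕ) j)) = q i * ∏ j, q j ^ ν j := by
    have : q i = ∏ j, q j ^ ((Finsupp.single i 1 : Fin N →₀ ℕ) j) := by
      rw [Finset.prod_eq_single_of_mem i (Finset.mem_univ _)]
      · simp
      · intro j _ hj
        rw [Finsupp.single_eq_of_ne hj, pow_zero]
    conv_rhs => rw [this]
    rw [← Finset.prod_mul_distrib]
    exact Finset.prod_congr rfl fun j _ => by rw [Finsupp.add_apply, pow_add, mul_comm]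
  constructor
  · rw [hq, hq, h1]
    rfl
  · rw [hq, hq, h1, mul_comm]
    rfl

/-- Symbols of differential operators. -/
abbrev Symb (N : ℕ) : Type := MvPolynomial (Fin N) (RatFun N)

theorem opOfSymbol_eq_sum {a : Symb N} {s : Finset (Fin N →₀ ℕ)} (hs : a.support ⊆ s) :
    opOfSymbol a = ∑ ν ∈ s, mulOp (a.coeff ν) * pdMulti ν := by
  refine Finset.sum_subset hs fun ν _ hν => ?_
  rw [notMem_support_iff.1 hν]
  ext
  simp [mulOp_apply]

theorem opOfSymbol_add (a b : Symb N) :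
    opOfSymbol (a + b) = opOfSymbol a + opOfSymbol b := by
  classical
  rw [opOfSymbol_eq_sum (MvPolynomial.support_add (p := a) (q := b)),
    opOfSymbol_eq_sum (Finset.subset_union_left (s₁ := a.support) (s₂ := b.support)),
    opOfSymbol_eq_sum (Finset.subset_union_right (s₁ := a.support) (s₂ := b.support)),
    ← Finset.sum_add_distrib]
  refine Finset.sum_congr rfl fun ν _ => ?_
  rw [coeff_add, mulOp_add, add_mul]

theorem mulOp_mul_opOfSymbol (f : RatFun N) (a : Symb N) :
    mulOp f * opOfSymbol a = opOfSymbol (C f * a) := by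
  have hs : (C f * a).support ⊆ a.support := by
    intro ν hν
    rw [mem_support_iff, coeff_C_mul] at hν
    rw [mem_support_iff]
    exact right_ne_zero_of_mul hν
  rw [opOfSymbol_eq_sum hs, opOfSymbol, Finset.mul_sum]
  refine Finset.sum_congr rfl fun ν _ => ?_
  rw [coeff_C_mul, ← mul_assoc, mulOp_mul_mulOp]

theorem opOfSymbol_monomial (ν : Fin N →₀ ℕ) (f : RatFun N) :
    opOfSymbol (monomial ν f) = mulOp f * pdMulti ν := by
  classical
  rw [opOfSymbol_eq_sum (support_monomial_subset (s := ν)), Finset.sum_singleton, coeff_monomial,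
    if_pos rfl]

theorem opOfSymbol_C (f : RatFun N) : opOfSymbol (C f) = mulOp f := by
  rw [← monomial_zero', opOfSymbol_monomial, pdMulti_zero, mul_one]

theorem opOfSymbol_zero : opOfSymbol (0 : Symb N) = 0 := by simp [opOfSymbol]

theorem opOfSymbol_neg (a : Symb N) : opOfSymbol (-a) = -opOfSymbol a := by
  rw [eq_neg_iff_add_eq_zero, ← opOfSymbol_add, neg_add_cancel, opOfSymbol_zero]

theorem opOfSymbol_sub (a b : Symb N) :
    opOfSymbol (a - b) = opOfSymbol a - opOfSymbol b := by
  rw [sub_eq_add_neg, opOfSymbol_add, opOfSymbol_neg, sub_eq_add_neg]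

theorem opOfSymbol_sum {ι : Type*} (s : Finset ι) (a : ι → Symb N) :
    opOfSymbol (∑ i ∈ s, a i) = ∑ i ∈ s, opOfSymbol (a i) := by
  classical
  induction s using Finset.induction_on with
  | empty => simp [opOfSymbol_zero]
  | insert i s hi ih => rw [Finset.sum_insert hi, Finset.sum_insert hi, opOfSymbol_add, ih]

theorem opOfSymbol_smul (c : ℂ) (a : Symb N) : opOfSymbol (c • a) = c • opOfSymbol a := by
  rw [algebra_compatible_smul (RatFun N) c a, ← C_mul', ← mulOp_mul_opOfSymbol]
  ext f
  simp [mulOp_apply, Algebra.smul_def]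

/-- Coefficientwise partial derivative of a symbol. -/
def symD (i : Fin N) (a : Symb N) : Symb N :=
  ∑ ν ∈ a.support, monomial ν (partialRat i (a.coeff ν))

theorem coeff_symD (i : Fin N) (a : Symb N) (ν : Fin N →₀ ℕ) :
    (symD i a).coeff ν = partialRat i (a.coeff ν) := by
  classical
  simp only [symD, coeff_sum, coeff_monomial, Finset.sum_ite_eq']
  split_ifs with h
  · rfl
  · rw [notMem_support_iff.1 h, map_zero]

theorem symD_add (i : Fin N) (a b : Symb N) : symD i (a + b) = symD i a + symD i b := by
  ext ν
  simp only [coeff_symD, coeff_add, map_add]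

theorem symD_monomial (i : Fin N) (ν : Fin N →₀ ℕ) (f : RatFun N) :
    symD i (monomial ν f) = monomial ν (partialRat i f) := by
  classical
  ext μ
  rw [coeff_symD, coeff_monomial, coeff_monomial]
  split_ifs <;> simp

theorem symD_X_mul (i j : Fin N) (a : Symb N) : symD i (X j * a) = X j * symD i a := by
  classical
  ext μ
  rw [coeff_symD, coeff_X_mul', coeff_X_mul', coeff_symD]
  split_ifs <;> simp

theorem symD_C (i : Fin N) (f : RatFun N) : symD i (C f) = C (partialRat i f) := by
  rw [← monomial_zero', symD_monomial]

theorem X_mul_monomial (i : Fin N) (ν : Fin N →₀ ℕ) (f : RatFun N) :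
    (X i * monomial ν f : Symb N) = monomial (ν + Finsupp.single i 1) f := by
  rw [monomial_add_single, pow_one, mul_comm]

theorem pd_mul_opOfSymbol (i : Fin N) (a : Symb N) :
    pd i * opOfSymbol a = opOfSymbol (X i * a + symD i a) := by
  induction a using MvPolynomial.induction_on' with
  | monomial ν f =>
    rw [symD_monomial, opOfSymbol_add, X_mul_monomial, opOfSymbol_monomial,
      opOfSymbol_monomial, opOfSymbol_monomial, ← mul_assoc, pd_mul_mulOp, add_mul, mul_assoc,
      (pdMulti_add_single ν i).1]
  | add a b ha hb =>
    rw [opOfSymbol_add, mul_add, ha, hb, ← opOfSymbol_add, symD_add]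
    congr 1
    ring

theorem opOfSymbol_mul_pd (i : Fin N) (a : Symb N) :
    opOfSymbol a * pd i = opOfSymbol (X i * a) := by
  induction a using MvPolynomial.induction_on' with
  | monomial ν f =>
    rw [X_mul_monomial, opOfSymbol_monomial, opOfSymbol_monomial, mul_assoc,
      (pdMulti_add_single ν i).2]
  | add a b ha hb =>
    rw [opOfSymbol_add, add_mul, ha, hb, ← opOfSymbol_add, mul_add]

end

section

/-! ### Conjugation by exponentials -/

/-- The operator `T` multiplies the top coefficient of a polynomial multiple of `e^{(l, x)}` by `c`
and raises its degree by `k`. -/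
def Raises (l : Fin N → ℂ) (T : Module.End ℂ (RatFun N)) (k : ℕ) (c : RatFun N) : Prop :=
  ∀ (S : PowerSeries (RatFun N)) (n : ℕ), (∀ i, n < i → PowerSeries.coeff i S = 0) →
    ∃ U : PowerSeries (RatFun N), cw T (S * expSer (toRat (clin l))) = U * expSer (toRat (clin l)) ∧
      (∀ i, n + k < i → PowerSeries.coeff i U = 0) ∧
      PowerSeries.coeff (n + k) U = c * PowerSeries.coeff n S

namespace Raises

variable {l : Fin N → ℂ}

theorem one : Raises l 1 0 1 := fun S n hS =>
  ⟨S, by ext i : 1; rw [coeff_cw]; rfl, hS, by rw [one_mul, add_zero]⟩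

theorem mul {T T' : Module.End ℂ (RatFun N)} {k k' : ℕ} {c c' : RatFun N} (h : Raises l T k c)
    (h' : Raises l T' k' c') : Raises l (T * T') (k + k') (c * c') := by
  intro S n hS
  obtain ⟨U, hU, hU0, hUt⟩ := h' S n hS
  obtain ⟨V, hV, hV0, hVt⟩ := h U (n + k') hU0
  refine ⟨V, ?_, fun i hi => hV0 i (by omega), ?_⟩
  · rw [← hV, ← hU]
    ext i : 1
    simp only [coeff_cw]
    rfl
  · rw [add_comm k, ← add_assoc, hVt, hUt, mul_assoc]

theorem pow {T : Module.End ℂ (RatFun N)} {k : ℕ} {c : RatFun N} (h : Raises l T k c) (j : ℕ) :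
    Raises l (T ^ j) (k * j) (c ^ j) := by
  induction j with
  | zero => exact one
  | succ j ih => rw [pow_succ, pow_succ]; exact ih.mul h

theorem mulOp (f : RatFun N) : Raises l (mulOp f) 0 f := by
  intro S n hS
  refine ⟨PowerSeries.C f * S, ?_, fun i hi => ?_, ?_⟩
  · rw [AHermite.mulOp, cw_mulLeft, mul_assoc]
  · rw [PowerSeries.coeff_C_mul, hS i hi, mul_zero]
  · rw [PowerSeries.coeff_C_mul, add_zero]

theorem pd (i : Fin N) : Raises l (pd i) 1 (toRat (C (l i))) := by
  intro S n hS
  refine ⟨cw (AHermite.pd i) S + PowerSeries.X * PowerSeries.C (toRat (C (l i))) * S, ?_,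
    fun j hj => ?_, ?_⟩
  · have h1 := cw_derivation_mul (partialRat i) S (expSer (toRat (clin l)))
    have h2 := cw_derivation_expSer (partialRat i) (toRat (clin l))
    rw [partialRat_toRat, pderiv_clin] at h2
    rw [h2] at h1
    rw [AHermite.pd, h1]
    ring
  · obtain ⟨j, rfl⟩ : ∃ t, j = t + 1 := ⟨j - 1, by omega⟩
    rw [map_add, coeff_cw, mul_assoc, PowerSeries.coeff_succ_X_mul, PowerSeries.coeff_C_mul,
      hS _ (by omega), hS _ (by omega)]
    simp
  · rw [map_add, coeff_cw, mul_assoc, PowerSeries.coeff_succ_X_mul, PowerSeries.coeff_C_mul,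
      hS _ (by omega)]
    simp

theorem listProd {n : ℕ} {T : Fin n → Module.End ℂ (RatFun N)} {k : Fin n → ℕ}
    {c : Fin n → RatFun N} (h : ∀ i, Raises l (T i) (k i) (c i)) :
    Raises l (List.ofFn T).prod (∑ i, k i) (∏ i, c i) := by
  induction n with
  | zero => exact one
  | succ n ih =>
    rw [List.ofFn_succ, List.prod_cons, Fin.sum_univ_succ, Fin.prod_univ_succ]
    exact (h 0).mul (ih fun i => h i.succ)

theorem of_lt {T : Module.End ℂ (RatFun N)} {k r : ℕ} {c : RatFun N} (h : Raises l T k c)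
    (hk : k < r) : Raises l T r 0 := by
  intro S n hS
  obtain ⟨U, hU, hU0, -⟩ := h S n hS
  exact ⟨U, hU, fun i hi => hU0 i (by omega), by rw [hU0 _ (by omega), zero_mul]⟩

theorem zero (k : ℕ) : Raises l 0 k 0 := fun S n _ =>
  ⟨0, by ext i : 1; rw [coeff_cw, zero_mul]; rfl, fun i _ => map_zero _, by rw [map_zero, zero_mul]⟩

theorem add {T T' : Module.End ℂ (RatFun N)} {k : ℕ} {c c' : RatFun N} (h : Raises l T k c)
    (h' : Raises l T' k c') : Raises l (T + T') k (c + c') := by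
  intro S n hS
  obtain ⟨U, hU, hU0, hUt⟩ := h S n hS
  obtain ⟨V, hV, hV0, hVt⟩ := h' S n hS
  refine ⟨U + V, ?_, fun i hi => by rw [map_add, hU0 i hi, hV0 i hi, add_zero], ?_⟩
  · rw [add_mul, ← hU, ← hV]
    ext i : 1
    simp only [coeff_cw, map_add]
    rfl
  · rw [map_add, hUt, hVt, add_mul]

theorem sum {ι : Type*} (s : Finset ι) {T : ι → Module.End ℂ (RatFun N)} {k : ℕ}
    {c : ι → RatFun N} (h : ∀ i ∈ s, Raises l (T i) k (c i)) :
    Raises l (∑ i ∈ s, T i) k (∑ i ∈ s, c i) := by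
  classical
  induction s using Finset.induction_on with
  | empty => exact zero k
  | insert i s hi ih =>
    rw [Finset.sum_insert hi, Finset.sum_insert hi]
    exact (h i (Finset.mem_insert_self _ _)).add
      (ih fun j hj => h j (Finset.mem_insert_of_mem hj))

/-- Only terms of order exactly r reach the top, where ∂^ν contributes l^ν: the factor is the
principal symbol at l. -/
theorem opOfSymbol {a : Symb N} {r : ℕ} (ha : ∀ ν : Fin N →₀ ℕ, r < ν.degree → a.coeff ν = 0) :
    Raises l (opOfSymbol a) r (eval (fun i => algebraMap ℂ (RatFun N) (l i))
      (homogeneousComponent r a)) := by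
  have hν : ∀ ν : Fin N →₀ ℕ, Raises l (pdMulti ν) ν.degree
      (∏ i, algebraMap ℂ (RatFun N) (l i) ^ ν i) := by
    intro ν
    have := listProd (l := l) (T := fun i => AHermite.pd i ^ ν i) (k := fun i => 1 * ν i)
      (c := fun i => toRat (C (l i)) ^ ν i) fun i => (pd i).pow _
    simp only [one_mul] at this
    rwa [← Finsupp.degree_eq_sum] at this
  have he : eval (fun i => algebraMap ℂ (RatFun N) (l i)) (homogeneousComponent r a) =
      ∑ ν ∈ a.support, if ν.degree = r then
        a.coeff ν * ∏ i, algebraMap ℂ (RatFun N) (l i) ^ ν i else 0 := by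
    rw [homogeneousComponent_apply, map_sum, Finset.sum_filter]
    refine Finset.sum_congr rfl fun ν _ => ?_
    split_ifs
    · rw [eval_monomial, Finsupp.prod_fintype _ _ fun i => pow_zero _]
    · rfl
  rw [he]
  refine sum _ fun ν hνs => ?_
  have h1 : Raises l (AHermite.mulOp (a.coeff ν) * pdMulti ν) ν.degree
      (a.coeff ν * ∏ i, algebraMap ℂ (RatFun N) (l i) ^ ν i) := by
    simpa using (mulOp (a.coeff ν)).mul (hν ν)
  split_ifs with h
  · rwa [h] at h1
  · refine h1.of_lt (lt_of_le_of_ne ?_ h)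
    by_contra hlt
    push Not at hlt
    exact mem_support_iff.1 hνs (ha ν hlt)

end Raises

/-- A symbol vanishes as soon as its top component vanishes for every bound on its order. -/
theorem symbol_eq_zero {a : Symb N} {r₀ : ℕ}
    (ha : ∀ ν : Fin N →₀ ℕ, r₀ < ν.degree → a.coeff ν = 0)
    (h : ∀ r ≤ r₀, (∀ ν : Fin N →₀ ℕ, r < ν.degree → a.coeff ν = 0) →
      homogeneousComponent r a = 0) : a = 0 := by
  have hc : ∀ r, homogeneousComponent r a = 0 → ∀ ν : Fin N →₀ ℕ, ν.degree = r →
      a.coeff ν = 0 := by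
    intro r hr ν hν
    have := congrArg (coeff ν) hr
    rwa [coeff_homogeneousComponent, if_pos hν, coeff_zero] at this
  have key : ∀ k ≤ r₀, ∀ ν : Fin N →₀ ℕ, r₀ - k < ν.degree → a.coeff ν = 0 := by
    intro k
    induction k with
    | zero => exact fun _ => ha
    | succ k ih =>
      intro hk ν hν
      rcases Nat.lt_or_ge (r₀ - k) ν.degree with h1 | h1
      · exact ih (by omega) ν h1
      · exact hc (r₀ - k) (h _ (Nat.sub_le _ _) (ih (by omega))) ν (by omega)
  have h0 := key r₀ le_rfl
  rw [Nat.sub_self] at h0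
  ext ν
  rw [coeff_zero]
  rcases Nat.eq_zero_or_pos ν.degree with h1 | h1
  · exact hc 0 (h 0 (Nat.zero_le _) h0) ν h1
  · exact h0 ν h1

/-- Applied to e^{(x,l)} for every l, an operator reveals its principal symbol, and then the lower
ones in turn. -/
theorem opOfSymbol_injective {a b : Symb N} (h : opOfSymbol a = opOfSymbol b) : a = b := by
  rw [← sub_eq_zero]
  refine symbol_eq_zero (r₀ := (a - b).totalDegree) (fun ν hν => ?_) fun r _ hr => ?_
  · exact coeff_eq_zero_of_totalDegree_lt hν
  · refine eq_zero_of_eval_of_ne_zero (w := 1) one_ne_zero fun x _ => ?_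
    obtain ⟨U, hU, -, hUt⟩ := Raises.opOfSymbol (l := x) hr 1 0 fun i hi => by
      rw [PowerSeries.coeff_one, if_neg hi.ne']
    have h0 : U = 0 := by
      refine mul_expSer_right_cancel (u := toRat (clin x)) ?_
      rw [← hU, opOfSymbol_sub, h, sub_self, zero_mul]
      ext i : 1
      rw [coeff_cw]
      rfl
    rw [h0] at hUt
    simpa using hUt.symm

/-! ### Operators on quasi-invariants -/

/-- All nonzero coefficients of `g` have degree `n`. -/
def HomZ (g : Poly N) (n : ℤ) : Prop := ∀ ν, g.coeff ν ≠ 0 → (ν.degree : ℤ) = n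

theorem homZ_natCast {g : Poly N} {n : ℕ} : HomZ g n ↔ g.IsHomogeneous n := by
  have hw : ∀ ν : Fin N →₀ ℕ, Finsupp.weight 1 ν = ν.degree := fun ν => by
    rw [Finsupp.degree_eq_weight_one]; rfl
  constructor
  · intro h ν hν
    rw [hw]
    exact_mod_cast h ν hν
  · intro h ν hν
    have := h hν
    rw [hw] at this
    exact_mod_cast this

theorem HomZ.eq_zero {g : Poly N} {n : ℤ} (h : HomZ g n) (hn : n < 0) : g = 0 := by
  ext ν
  rw [coeff_zero]
  by_contra h0
  have := h ν h0
  omega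

theorem HomZ.zero (n : ℤ) : HomZ (0 : Poly N) n := fun ν h => absurd (coeff_zero ν) h

theorem HomZ.add {f g : Poly N} {n : ℤ} (hf : HomZ f n) (hg : HomZ g n) : HomZ (f + g) n := by
  intro ν hν
  by_contra hne
  apply hν
  rw [coeff_add, not_imp_comm.1 (hf ν) hne, not_imp_comm.1 (hg ν) hne, add_zero]

theorem HomZ.neg {f : Poly N} {n : ℤ} (hf : HomZ f n) : HomZ (-f) n := by
  intro ν hν
  rw [coeff_neg, neg_ne_zero] at hν
  exact hf ν hν

theorem HomZ.sum {ι : Type*} {s : Finset ι} {f : ι → Poly N} {n : ℤ}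
    (h : ∀ i ∈ s, HomZ (f i) n) : HomZ (∑ i ∈ s, f i) n := by
  intro ν hν
  rw [coeff_sum] at hν
  obtain ⟨i, hi, h0⟩ := Finset.exists_ne_zero_of_sum_ne_zero hν
  exact h i hi ν h0

theorem HomZ.mul {f g : Poly N} {n m : ℤ} (hf : HomZ f n) (hg : HomZ g m) :
    HomZ (f * g) (n + m) := by
  rcases lt_or_ge n 0 with hn | hn
  · rw [hf.eq_zero hn, zero_mul]; exact HomZ.zero _
  rcases lt_or_ge m 0 with hm | hm
  · rw [hg.eq_zero hm, mul_zero]; exact HomZ.zero _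
  lift n to ℕ using hn
  lift m to ℕ using hm
  have := (homZ_natCast.1 hf).mul (homZ_natCast.1 hg)
  exact_mod_cast homZ_natCast.2 this

/-- `T` maps homogeneous quasi-invariants to homogeneous quasi-invariants and lowers degrees by
`e`. -/
def Lowers (A : Configuration N) (T : Module.End ℂ (RatFun N)) (e : ℤ) : Prop :=
  ∀ (n : ℤ), ∀ f ∈ A.quasi, HomZ f n → ∃ g ∈ A.quasi, T (toRat f) = toRat g ∧ HomZ g (n - e)

variable {A : Configuration N}

theorem Lowers.mul {T T' : Module.End ℂ (RatFun N)} {e e' : ℤ} (h : Lowers A T e)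
    (h' : Lowers A T' e') : Lowers A (T * T') (e' + e) := by
  intro n f hf hn
  obtain ⟨g, hg, hTg, hgn⟩ := h' n f hf hn
  obtain ⟨w, hw, hTw, hwn⟩ := h _ g hg hgn
  refine ⟨w, hw, ?_, by rwa [← sub_sub]⟩
  rw [Module.End.mul_apply, hTg, hTw]

theorem Lowers.sub {T T' : Module.End ℂ (RatFun N)} {e : ℤ} (h : Lowers A T e)
    (h' : Lowers A T' e) : Lowers A (T - T') e := by
  intro n f hf hn
  obtain ⟨g, hg, hTg, hgn⟩ := h n f hf hn
  obtain ⟨w, hw, hTw, hwn⟩ := h' n f hf hn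
  refine ⟨g - w, sub_mem hg hw, ?_, by rw [sub_eq_add_neg]; exact hgn.add hwn.neg⟩
  rw [LinearMap.sub_apply, hTg, hTw, map_sub]

theorem Lowers.mulOp {p : Poly N} (hp : p ∈ A.quasi) {d : ℕ} (hd : p.IsHomogeneous d) :
    Lowers A (mulOp (toRat p)) (-d) := by
  intro n f hf hn
  refine ⟨p * f, mul_mem hp hf, by rw [mulOp_apply, map_mul], ?_⟩
  have := (homZ_natCast.2 hd).mul hn
  rwa [sub_neg_eq_add, add_comm]

namespace IsExpansion

variable {φ : (Fin N → ℂ) → (Fin N → ℂ) → ℂ} {F : ℕ → BiPoly N}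

/-- Applying the operator to φ and removing the exponential gives a polynomial-coefficient series q,
because the operator preserves Q_A. Two gradings are kept apart: the index i, bounded by |m|+r
through the order, and the degree i-e in x, fixed by the degree shift. -/
theorem exists_conj (hF : IsExpansion A φ F) (l : Fin N → ℂ) {a : Symb N} {r : ℕ}
    (ha : ∀ ν : Fin N →₀ ℕ, r < ν.degree → a.coeff ν = 0) {e : ℤ}
    (hT : Lowers A (opOfSymbol a) e) :
    ∃ q : PowerSeries (Poly N), (∀ i, A.totalMult + r < i → PowerSeries.coeff i q = 0) ∧
      (∀ i : ℕ, HomZ (PowerSeries.coeff i q) (i - e)) ∧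
      (∀ k, PowerSeries.coeff k (q * expSer (clin l)) ∈ A.quasi) ∧
      (∀ k, opOfSymbol a (toRat (atR l (bakerComp F k))) =
        toRat (PowerSeries.coeff k (q * expSer (clin l)))) ∧
      toRat (PowerSeries.coeff (A.totalMult + r) q) =
        eval (fun i => algebraMap ℂ (RatFun N) (l i)) (homogeneousComponent r a) *
          toRat (C (eval l A.poly) * A.poly) := by
  choose G hG hTG hGn using fun k : ℕ => hT k _ (hF.comp_mem k l)
    (homZ_natCast.2 (hF.comp_isHomogeneous k l))
  set S : PowerSeries (RatFun N) := PowerSeries.map toRat (PowerSeries.mk fun i => atR l (F i))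
    with hS
  obtain ⟨U, hU, hU0, hUt⟩ := Raises.opOfSymbol (l := l) ha S A.totalMult fun i hi => by
    rw [hS, PowerSeries.coeff_map, PowerSeries.coeff_mk, hF.eq_zero i hi, map_zero, map_zero]
  have hexp : expSer (toRat (clin l)) = PowerSeries.map toRat (expSer (clin l)) :=
    (map_expSer _ _).symm
  have hGU : PowerSeries.map toRat (PowerSeries.mk G) = U * expSer (toRat (clin l)) := by
    rw [← hU, hexp, hS, ← map_mul]
    ext k : 1
    rw [coeff_cw, PowerSeries.coeff_map, PowerSeries.coeff_map, ← atR_bakerComp, hTG,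
      PowerSeries.coeff_mk]
  set q := PowerSeries.mk G * expSer (-clin l) with hq
  have hqU : PowerSeries.map toRat q = U := by
    rw [hq, map_mul, hGU, map_expSer, map_neg, mul_assoc, expSer_mul_expSer_neg, mul_one]
  have hqE : q * expSer (clin l) = PowerSeries.mk G := by
    rw [hq, mul_assoc, mul_comm (expSer _), expSer_mul_expSer_neg, mul_one]
  refine ⟨q, fun i hi => ?_, fun i => ?_, fun k => ?_, fun k => ?_, ?_⟩
  · apply toRat_injective
    rw [← PowerSeries.coeff_map, hqU, hU0 i hi, map_zero]
  · have hn : expSer (-clin l) = expSer (clin (-l)) := by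
      rw [← neg_one_smul ℂ l, clin_smul]
      simp
    rw [hq, hn, PowerSeries.coeff_mul]
    refine HomZ.sum fun p hp => ?_
    have h1 := (hGn p.1).mul (homZ_natCast.2 (isHomogeneous_coeff_expSer (-l) p.2))
    rw [← Finset.HasAntidiagonal.mem_antidiagonal.1 hp, PowerSeries.coeff_mk]
    convert h1 using 1
    push_cast
    ring
  · rw [hqE, PowerSeries.coeff_mk]
    exact hG k
  · rw [hqE, PowerSeries.coeff_mk, hTG]
  · rw [← PowerSeries.coeff_map, hqU, hUt, hS, PowerSeries.coeff_map, PowerSeries.coeff_mk, hF.top]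

/-- An operator on quasi-invariants which lowers degrees by more than its order vanishes. -/
theorem symbol_eq_zero_of_lowers (hF : IsExpansion A φ F) {a : Symb N} {r₀ : ℕ}
    (ha : ∀ ν : Fin N →₀ ℕ, r₀ < ν.degree → a.coeff ν = 0) {e : ℤ}
    (hT : Lowers A (opOfSymbol a) e) (he : r₀ < e) : a = 0 := by
  refine symbol_eq_zero ha fun r hr hra => eq_zero_of_eval_generic (A := A) fun l hl => ?_
  obtain ⟨q, hq0, hqn, hqq, -, hqt⟩ := hF.exists_conj l hra hT
  -- Here i ≤ |m|+r and r < e, so every coefficient has degree i-e below |m|.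
  have hz : q = 0 := by
    refine hl.eq_zero hq0 (fun i hi => ?_) hqq
    have hle : i ≤ A.totalMult + r := by
      by_contra hlt
      exact hi (hq0 i (by omega))
    rcases lt_or_ge ((i : ℤ) - e) 0 with h | h
    · exact absurd ((hqn i).eq_zero h) hi
    · obtain ⟨j, hj⟩ := Int.eq_ofNat_of_zero_le h
      have h1 := hqn i
      rw [hj] at h1
      rw [(homZ_natCast.1 h1).totalDegree hi]
      omega
  rw [hz, map_zero, map_zero, eq_comm, mul_eq_zero] at hqt
  refine hqt.resolve_right (toRat_ne_zero (mul_ne_zero ?_ A.poly_ne_zero))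
  exact fun h => eval_poly_ne_zero hl (C_injective _ _ (h.trans C_0.symm))

/-- An operator on quasi-invariants of order `d` that lowers degrees by `d` acts on the
Baker--Akhiezer function by its symbol. -/
theorem opOfSymbol_comp (hF : IsExpansion A φ F) {a : Symb N} {d : ℕ}
    (ha : ∀ ν : Fin N →₀ ℕ, d < ν.degree → a.coeff ν = 0)
    (hT : Lowers A (opOfSymbol a) d) {p : Poly N}
    (hp : homogeneousComponent d a = map (algebraMap ℂ (RatFun N)) p) {l : Fin N → ℂ}
    (hl : A.Generic l) (k : ℕ) :
    opOfSymbol a (toRat (atR l (bakerComp F (k + d)))) =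
      toRat (C (eval l p) * atR l (bakerComp F k)) := by
  obtain ⟨q, hq0, hqn, hqq, hTq, hqt⟩ := hF.exists_conj l ha hT
  -- Coefficients of q of index below d have negative degree, so q starts at index d; after the
  -- shift the index agrees with the degree in x.
  set s : PowerSeries (Poly N) := PowerSeries.mk fun i => PowerSeries.coeff (i + d) q with hs
  have hqs : q = PowerSeries.X ^ d * s := by
    ext i : 1
    rw [PowerSeries.coeff_X_pow_mul']
    split_ifs with h
    · rw [hs, PowerSeries.coeff_mk, Nat.sub_add_cancel h]
    · exact (hqn i).eq_zero (by omega)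
  have hsE : ∀ k, PowerSeries.coeff k (s * expSer (clin l)) =
      PowerSeries.coeff (k + d) (q * expSer (clin l)) := by
    intro k
    rw [hqs, mul_assoc, PowerSeries.coeff_X_pow_mul]
  obtain ⟨c, hc⟩ := hF.eq_smul_of_quasi hl (s := s)
    (fun i hi => by rw [hs, PowerSeries.coeff_mk, hq0 _ (by omega)])
    (fun i => by
      rw [hs, PowerSeries.coeff_mk, ← homZ_natCast]
      have := hqn (i + d)
      rwa [Nat.cast_add, add_sub_cancel_right] at this)
    (fun k => by rw [hsE]; exact hqq _)
  have hcp : c = eval l p := by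
    have h1 := congrArg (PowerSeries.coeff A.totalMult) hc
    rw [hs, PowerSeries.coeff_mk, PowerSeries.coeff_C_mul, PowerSeries.coeff_mk, hF.top] at h1
    have h2 : eval (fun i => algebraMap ℂ (RatFun N) (l i)) (map (algebraMap ℂ (RatFun N)) p) =
        toRat (C (eval l p)) := by
      rw [toRat_C, eval_map]
      exact (eval₂_comp_left (algebraMap ℂ (RatFun N)) (RingHom.id ℂ) l p).symm
    rw [hp, h2, h1, ← map_mul] at hqt
    have h3 := mul_right_cancel₀ (mul_ne_zero (fun h => eval_poly_ne_zero hl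
      (C_injective _ _ (h.trans C_0.symm))) A.poly_ne_zero) (toRat_injective hqt)
    exact C_injective _ _ h3
  rw [hTq, ← hsE, hc, hcp, mul_assoc, PowerSeries.coeff_C_mul, atR_bakerComp]

end IsExpansion

end

section

/-! ### Homogeneous symbols -/

theorem homRat_zero [Nonempty (Fin N)] (n : ℤ) : HomRat (0 : RatFun N) n := by
  obtain ⟨i⟩ := ‹Nonempty (Fin N)›
  refine ⟨n.toNat, (-n).toNat, 0, X i ^ (-n).toNat, isHomogeneous_zero _ _ _, ?_,
    pow_ne_zero _ (X_ne_zero i), by omega, by simp⟩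
  simpa using (isHomogeneous_X ℂ i).pow (-n).toNat

theorem homRat_toRat {p : Poly N} {d : ℕ} (hp : p.IsHomogeneous d) : HomRat (toRat p) d :=
  ⟨d, 0, p, 1, hp, isHomogeneous_one _ _, one_ne_zero, by simp, by simp⟩

theorem HomRat.add {f g : RatFun N} {n : ℤ} (hf : HomRat f n) (hg : HomRat g n) :
    HomRat (f + g) n := by
  obtain ⟨i, j, p, r, hp, hr, hr0, hn, rfl⟩ := hf
  obtain ⟨i', j', p', r', hp', hr', hr0', hn', rfl⟩ := hg
  refine ⟨i + j', j + j', p * r' + r * p', r * r', (hp.mul hr').add ?_, hr.mul hr',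
    mul_ne_zero hr0 hr0', by push_cast; omega, ?_⟩
  · have : i + j' = j + i' := by omega
    rw [this]
    exact hr.mul hp'
  · rw [div_add_div _ _ (toRat_ne_zero hr0) (toRat_ne_zero hr0')]
    simp only [map_add, map_mul]

theorem HomRat.mul {f g : RatFun N} {n m : ℤ} (hf : HomRat f n) (hg : HomRat g m) :
    HomRat (f * g) (n + m) := by
  obtain ⟨i, j, p, r, hp, hr, hr0, hn, rfl⟩ := hf
  obtain ⟨i', j', p', r', hp', hr', hr0', hn', rfl⟩ := hg
  refine ⟨i + i', j + j', p * p', r * r', hp.mul hp', hr.mul hr', mul_ne_zero hr0 hr0',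
    by push_cast; omega, ?_⟩
  rw [div_mul_div_comm, map_mul, map_mul]

theorem HomRat.neg {f : RatFun N} {n : ℤ} (hf : HomRat f n) : HomRat (-f) n := by
  obtain ⟨i, j, p, r, hp, hr, hr0, hn, rfl⟩ := hf
  exact ⟨i, j, -p, r, hp.neg, hr, hr0, hn, by rw [map_neg]; ring⟩

theorem HomRat.sum [Nonempty (Fin N)] {ι : Type*} {s : Finset ι} {f : ι → RatFun N} {n : ℤ}
    (h : ∀ i ∈ s, HomRat (f i) n) : HomRat (∑ i ∈ s, f i) n := by
  classical
  induction s using Finset.induction_on with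
  | empty => exact homRat_zero n
  | insert i s hi ih =>
    rw [Finset.sum_insert hi]
    exact (h i (Finset.mem_insert_self _ _)).add
      (ih fun j hj => h j (Finset.mem_insert_of_mem hj))

theorem isHomogeneous_X_mul_pderiv {p : Poly N} {d : ℕ} (hp : p.IsHomogeneous d) (i : Fin N) :
    (X i * pderiv i p).IsHomogeneous d := by
  cases d with
  | zero =>
    rw [eq_C_of_isHomogeneous_zero hp, pderiv_C, mul_zero]
    exact isHomogeneous_zero _ _ _
  | succ d =>
    have := (isHomogeneous_X ℂ i).mul (hp.pderiv (i := i))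
    rwa [Nat.add_sub_cancel, add_comm] at this

theorem HomRat.partialRat {f : RatFun N} {n : ℤ} (hf : HomRat f n) (i : Fin N) :
    HomRat (partialRat i f) (n - 1) := by
  obtain ⟨k, j, p, r, hp, hr, hr0, hn, rfl⟩ := hf
  have hr' := toRat_ne_zero hr0
  have hX : toRat (X i : Poly N) ≠ 0 := toRat_ne_zero (X_ne_zero i)
  -- Numerator and denominator carry an extra factor x_i, so that x_i ∂_i preserves degrees and no
  -- natural-number subtraction occurs.
  refine ⟨k + j, 1 + (j + j), X i * pderiv i p * r - p * (X i * pderiv i r), X i * (r * r),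
    ((isHomogeneous_X_mul_pderiv hp i).mul hr).sub (hp.mul (isHomogeneous_X_mul_pderiv hr i)),
    (isHomogeneous_X ℂ i).mul (hr.mul hr), mul_ne_zero (X_ne_zero i) (mul_ne_zero hr0 hr0),
    by push_cast; omega, ?_⟩
  have h1 := (AHermite.partialRat i).leibniz (toRat p / toRat r) (toRat r)
  rw [div_mul_cancel₀ _ hr', partialRat_toRat, partialRat_toRat, smul_eq_mul, smul_eq_mul] at h1
  rw [eq_div_iff (toRat_ne_zero (mul_ne_zero (X_ne_zero i) (mul_ne_zero hr0 hr0)))]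
  simp only [map_sub, map_mul]
  rw [h1]
  field_simp
  ring

/-- A symbol of order less than `r` whose operator is homogeneous of degree `-e`. -/
structure IsSym (a : Symb N) (r : ℕ) (e : ℤ) : Prop where
  order : ∀ ν : Fin N →₀ ℕ, r ≤ ν.degree → a.coeff ν = 0
  hom : ∀ ν : Fin N →₀ ℕ, HomRat (a.coeff ν) (ν.degree - e)

namespace IsSym

variable {a b : Symb N} {r : ℕ} {e : ℤ}

theorem add (ha : IsSym a r e) (hb : IsSym b r e) : IsSym (a + b) r e :=
  ⟨fun ν hν => by rw [coeff_add, ha.order ν hν, hb.order ν hν, add_zero],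
    fun ν => by rw [coeff_add]; exact (ha.hom ν).add (hb.hom ν)⟩

theorem neg (ha : IsSym a r e) : IsSym (-a) r e :=
  ⟨fun ν hν => by rw [coeff_neg, ha.order ν hν, neg_zero],
    fun ν => by rw [coeff_neg]; exact (ha.hom ν).neg⟩

theorem sub (ha : IsSym a r e) (hb : IsSym b r e) : IsSym (a - b) r e := by
  rw [sub_eq_add_neg]
  exact ha.add hb.neg

theorem mono (ha : IsSym a r e) {r' : ℕ} (h : r ≤ r') : IsSym a r' e :=
  ⟨fun ν hν => ha.order ν (h.trans hν), ha.hom⟩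

theorem zero [Nonempty (Fin N)] (r : ℕ) (e : ℤ) : IsSym (0 : Symb N) r e :=
  ⟨fun ν _ => coeff_zero ν, fun ν => by rw [coeff_zero]; exact homRat_zero _⟩

theorem sum [Nonempty (Fin N)] {ι : Type*} {s : Finset ι} {a : ι → Symb N}
    (h : ∀ i ∈ s, IsSym (a i) r e) : IsSym (∑ i ∈ s, a i) r e := by
  classical
  induction s using Finset.induction_on with
  | empty => exact zero _ _
  | insert i s hi ih =>
    rw [Finset.sum_insert hi]
    exact (h i (Finset.mem_insert_self _ _)).add
      (ih fun j hj => h j (Finset.mem_insert_of_mem hj))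

theorem C_mul (ha : IsSym a r e) {f : RatFun N} {n : ℤ} (hf : HomRat f n) :
    IsSym (C f * a) r (e - n) :=
  ⟨fun ν hν => by rw [coeff_C_mul, ha.order ν hν, mul_zero], fun ν => by
    rw [coeff_C_mul]
    convert hf.mul (ha.hom ν) using 1
    ring⟩

theorem X_mul (ha : IsSym a r e) (i : Fin N) : IsSym (X i * a) (r + 1) (e + 1) := by
  classical
  have : Nonempty (Fin N) := ⟨i⟩
  have hd : ∀ ν : Fin N →₀ ℕ, i ∈ ν.support → (ν - Finsupp.single i 1).degree + 1 = ν.degree := by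
    intro ν hi
    have h1 : ν - Finsupp.single i 1 + Finsupp.single i 1 = ν := by
      refine tsub_add_cancel_of_le ?_
      rw [Finsupp.single_le_iff]
      exact Nat.one_le_iff_ne_zero.2 (Finsupp.mem_support_iff.1 hi)
    conv_rhs => rw [← h1, map_add, Finsupp.degree_single]
  constructor
  · intro ν hν
    rw [coeff_X_mul']
    split_ifs with hi
    · exact ha.order _ (by have := hd ν hi; omega)
    · rfl
  · intro ν
    rw [coeff_X_mul']
    split_ifs with hi
    · convert ha.hom (ν - Finsupp.single i 1) using 1
      have := hd ν hi
      omega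
    · exact homRat_zero _

theorem symD (ha : IsSym a r e) (i : Fin N) : IsSym (symD i a) r (e + 1) :=
  ⟨fun ν hν => by rw [coeff_symD, ha.order ν hν, map_zero], fun ν => by
    rw [coeff_symD]
    convert (ha.hom ν).partialRat i using 1
    ring⟩

theorem monomial [Nonempty (Fin N)] {f : RatFun N} {n : ℤ} (hf : HomRat f n) (ν : Fin N →₀ ℕ)
    (hν : ν.degree < r) : IsSym (MvPolynomial.monomial ν f) r (ν.degree - n) := by
  classical
  constructor
  · intro μ hμ
    rw [coeff_monomial, if_neg]
    rintro rfl
    omega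
  · intro μ
    rw [coeff_monomial]
    split_ifs with h
    · subst h
      convert hf using 1
      ring
    · exact homRat_zero _

end IsSym

theorem exists_pdMulti_mul_mulOp [Nonempty (Fin N)] {f : RatFun N} {n : ℤ} (hf : HomRat f n)
    (ν : Fin N →₀ ℕ) : ∃ b : Symb N, pdMulti ν * mulOp f = opOfSymbol (monomial ν f + b) ∧
      IsSym b ν.degree (ν.degree - n) := by
  induction hk : ν.degree generalizing ν with
  | zero =>
    rw [Finsupp.degree_eq_zero_iff] at hk
    subst hk
    refine ⟨0, ?_, IsSym.zero _ _⟩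
    rw [pdMulti_zero, one_mul, add_zero, opOfSymbol_monomial, pdMulti_zero, mul_one]
  | succ k ih =>
    obtain ⟨i, hi⟩ : ∃ i, ν i ≠ 0 := by
      by_contra hne
      push Not at hne
      have : ν = 0 := Finsupp.ext hne
      rw [this, map_zero] at hk
      omega
    obtain ⟨μ, rfl⟩ : ∃ μ : Fin N →₀ ℕ, ν = μ + Finsupp.single i 1 := by
      refine ⟨ν - Finsupp.single i 1, (tsub_add_cancel_of_le ?_).symm⟩
      rw [Finsupp.single_le_iff]
      exact Nat.one_le_iff_ne_zero.2 hi
    rw [map_add, Finsupp.degree_single] at hk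
    have hk : μ.degree = k := by omega
    obtain ⟨b, hb, hbs⟩ := ih μ hk
    refine ⟨X i * b + (monomial μ (partialRat i f) + symD i b), ?_, ?_⟩
    · rw [(pdMulti_add_single μ i).1, mul_assoc, hb, pd_mul_opOfSymbol, symD_add, symD_monomial,
        mul_add, X_mul_monomial]
      congr 1
      ring
    · have h1 := hbs.X_mul i
      have h2 := (hbs.symD i).mono (Nat.le_succ k)
      have h3 := IsSym.monomial (r := k + 1) (hf.partialRat i) μ (by omega)
      have e1 : ((k + 1 : ℕ) : ℤ) - n = k - n + 1 := by push_cast; ring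
      have e2 : (μ.degree : ℤ) - (n - 1) = k - n + 1 := by rw [hk]; ring
      rw [e2] at h3
      rw [e1]
      exact h1.add (h3.add h2)

theorem exists_opOfSymbol_mul_mulOp [Nonempty (Fin N)] {f : RatFun N} {n : ℤ} (hf : HomRat f n)
    {a : Symb N} {r : ℕ} {e : ℤ} (ha : IsSym a (r + 1) e) :
    ∃ b : Symb N, opOfSymbol a * mulOp f = opOfSymbol (C f * a + b) ∧ IsSym b r (e - n) := by
  choose b hb hbs using exists_pdMulti_mul_mulOp hf
  refine ⟨∑ ν ∈ a.support, C (a.coeff ν) * b ν, ?_, IsSym.sum fun ν hν => ?_⟩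
  · have h1 : C f * a = ∑ ν ∈ a.support, C (a.coeff ν) * monomial ν f := by
      conv_lhs => rw [a.as_sum, Finset.mul_sum]
      refine Finset.sum_congr rfl fun ν _ => ?_
      rw [C_mul_monomial, C_mul_monomial, mul_comm]
    rw [h1, ← Finset.sum_add_distrib, opOfSymbol_sum, opOfSymbol, Finset.sum_mul]
    refine Finset.sum_congr rfl fun ν _ => ?_
    rw [mul_assoc, hb, mulOp_mul_opOfSymbol, mul_add]
  · have h1 := (hbs ν).C_mul (ha.hom ν)
    have e1 : (ν.degree : ℤ) - n - (ν.degree - e) = e - n := by ring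
    rw [e1] at h1
    refine h1.mono ?_
    by_contra hlt
    push Not at hlt
    exact mem_support_iff.1 hν (ha.order ν hlt)

/-! ### Commutators with `L` -/

/-- The coefficients of the first order part of `L`. -/
def potential (A : Configuration N) (i : Fin N) : RatFun N :=
  ∑ α ∈ A.vectors, toRat (C (2 * A.mult α * (α i : ℂ))) / toRat (linForm α)

theorem opL_eq (A : Configuration N) :
    opL A = ∑ i, pd i ^ 2 - ∑ i, mulOp (potential A i) * pd i := by
  rw [opL]
  congr 1
  ext f
  simp only [LinearMap.sum_apply, Module.End.mul_apply, mulOp_apply, potential, pdDir,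
    LinearMap.smul_apply, Finset.sum_mul, Finset.mul_sum]
  rw [Finset.sum_comm]
  refine Finset.sum_congr rfl fun i _ => Finset.sum_congr rfl fun α _ => ?_
  rw [Algebra.smul_def, toRat_C]
  simp only [map_mul, map_natCast, map_ofNat]
  ring

theorem homRat_potential (A : Configuration N) (i : Fin N) : HomRat (potential A i) (-1) := by
  have : Nonempty (Fin N) := ⟨i⟩
  refine HomRat.sum fun α hα => ⟨0, 1, _, _, isHomogeneous_C _ _, clin_isHomogeneous (cvec α),
    clin_ne_zero (A.bil_self_ne_zero hα), by norm_num, rfl⟩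

/-- The symbol derivative `∑ ξ_i ∂_i`. -/
def symV (a : Symb N) : Symb N := ∑ i, X i * symD i a

theorem homogeneousComponent_X_mul (i : Fin N) (a : Symb N) (r : ℕ) :
    homogeneousComponent (r + 1) (X i * a) = X i * homogeneousComponent r a := by
  classical
  ext ν
  rw [coeff_homogeneousComponent, coeff_X_mul', coeff_X_mul', coeff_homogeneousComponent]
  by_cases hi : i ∈ ν.support
  · have h1 : ν - Finsupp.single i 1 + Finsupp.single i 1 = ν := by
      refine tsub_add_cancel_of_le ?_
      rw [Finsupp.single_le_iff]
      exact Nat.one_le_iff_ne_zero.2 (Finsupp.mem_support_iff.1 hi)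
    have h2 : (ν - Finsupp.single i 1).degree + 1 = ν.degree := by
      conv_rhs => rw [← h1, map_add, Finsupp.degree_single]
    rw [if_pos hi, if_pos hi]
    exact if_congr (by omega) rfl rfl
  · rw [if_neg hi, if_neg hi, ite_self]

theorem homogeneousComponent_symD (i : Fin N) (a : Symb N) (r : ℕ) :
    homogeneousComponent r (symD i a) = symD i (homogeneousComponent r a) := by
  ext ν
  rw [coeff_homogeneousComponent, coeff_symD, coeff_symD, coeff_homogeneousComponent]
  split_ifs
  · rfl
  · rw [map_zero]

theorem homogeneousComponent_symV (a : Symb N) (r : ℕ) :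
    homogeneousComponent (r + 1) (symV a) = symV (homogeneousComponent r a) := by
  rw [symV, map_sum, symV]
  exact Finset.sum_congr rfl fun i _ => by
    rw [homogeneousComponent_X_mul, homogeneousComponent_symD]

/-- In [L, a(x,∂)] the terms ξ_i² a cancel; the next order comes only from Δ and is 2 ∑ ξ_i ∂_i a.
The first-order part of L contributes to lower orders only. -/
theorem exists_commutator [Nonempty (Fin N)] (A : Configuration N) {a : Symb N} {r : ℕ} {e : ℤ}
    (ha : IsSym a (r + 1) e) : ∃ b : Symb N,
      opL A * opOfSymbol a - opOfSymbol a * opL A = opOfSymbol b ∧ IsSym b (r + 2) (e + 2) ∧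
      homogeneousComponent (r + 1) b = 2 * symV (homogeneousComponent r a) := by
  choose b hb hbs using fun i => exists_opOfSymbol_mul_mulOp (homRat_potential A i) ha
  -- All contributions of order at most r: the second derivatives of the symbol and the commutator
  -- with the first-order part of L.
  set R : Symb N := ∑ i, (symD i (symD i a) - C (potential A i) * symD i a + X i * b i) with hR
  have hRs : IsSym R (r + 1) (e + 2) := by
    refine IsSym.sum fun i _ => ?_
    have h1 := (ha.symD i).symD i
    have h2 := (ha.symD i).C_mul (homRat_potential A i)
    have h3 := (hbs i).X_mul i
    rw [show e + 1 + 1 = e + 2 by ring] at h1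
    rw [show e + 1 - -1 = e + 2 by ring] at h2
    rw [show e - -1 + 1 = e + 2 by ring] at h3
    exact (h1.sub h2).add h3
  have hV : IsSym (symV a) (r + 2) (e + 2) := by
    refine IsSym.sum fun i _ => ?_
    have h1 := (ha.symD i).X_mul i
    rwa [show e + 1 + 1 = e + 2 by ring] at h1
  refine ⟨symV a + symV a + R, ?_, (hV.add hV).add (hRs.mono (Nat.le_succ _)), ?_⟩
  · have hL : ∀ i, pd i ^ 2 * opOfSymbol a = opOfSymbol a * pd i ^ 2 +
        opOfSymbol (X i * symD i a + X i * symD i a + symD i (symD i a)) := by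
      intro i
      rw [pow_two, mul_assoc, pd_mul_opOfSymbol, pd_mul_opOfSymbol, ← mul_assoc,
        opOfSymbol_mul_pd, opOfSymbol_mul_pd, ← opOfSymbol_add, symD_add, symD_X_mul]
      congr 1
      ring
    have hP : ∀ i, mulOp (potential A i) * pd i * opOfSymbol a =
        opOfSymbol a * (mulOp (potential A i) * pd i) +
        opOfSymbol (C (potential A i) * symD i a - X i * b i) := by
      intro i
      rw [mul_assoc, pd_mul_opOfSymbol, mulOp_mul_opOfSymbol, ← mul_assoc, hb,
        opOfSymbol_mul_pd, ← opOfSymbol_add]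
      congr 1
      ring
    rw [opL_eq, sub_mul, mul_sub, Finset.sum_mul, Finset.sum_mul, Finset.mul_sum, Finset.mul_sum,
      Finset.sum_congr rfl fun i _ => hL i, Finset.sum_congr rfl fun i _ => hP i,
      Finset.sum_add_distrib, Finset.sum_add_distrib, ← opOfSymbol_sum, ← opOfSymbol_sum,
      symV, hR, ← Finset.sum_add_distrib, ← Finset.sum_add_distrib]
    have e1 : ∑ i, (X i * symD i a + X i * symD i a + (symD i (symD i a) -
        C (potential A i) * symD i a + X i * b i)) =
        ∑ i, (X i * symD i a + X i * symD i a + symD i (symD i a)) -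
          ∑ i, (C (potential A i) * symD i a - X i * b i) := by
      rw [← Finset.sum_sub_distrib]
      exact Finset.sum_congr rfl fun i _ => by ring
    rw [e1, opOfSymbol_sub]
    abel
  · have h0 : homogeneousComponent (r + 1) R = 0 := by
      ext ν
      rw [coeff_homogeneousComponent, coeff_zero]
      split_ifs with h
      · exact hRs.order ν h.ge
      · rfl
    rw [map_add, map_add, homogeneousComponent_symV, h0, add_zero, two_mul]

theorem symD_sum {ι : Type*} (i : Fin N) (s : Finset ι) (a : ι → Symb N) :
    symD i (∑ j ∈ s, a j) = ∑ j ∈ s, symD i (a j) :=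
  map_sum (AddMonoidHom.mk' (symD i) (symD_add i)) a s

theorem symV_sum_X_mul (a : Fin N → Symb N) :
    symV (∑ j, X j * a j) = ∑ j, X j * symV (a j) := by
  simp only [symV, symD_sum, symD_X_mul, Finset.mul_sum]
  rw [Finset.sum_comm]
  exact Finset.sum_congr rfl fun i _ => Finset.sum_congr rfl fun j _ => by ring

theorem symV_iterate_sum_X_mul (n : ℕ) (a : Fin N → Symb N) :
    symV^[n] (∑ j, X j * a j) = ∑ j, X j * symV^[n] (a j) := by
  induction n generalizing a with
  | zero => simp only [Function.iterate_zero_apply]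
  | succ n ih =>
    rw [Function.iterate_succ_apply, symV_sum_X_mul, ih]
    simp only [Function.iterate_succ_apply]

/-- Iterating ξ·∂ on p(x) gives d! p(ξ): it commutes with multiplication by ξ_i, and the induction
step is Euler's identity. -/
theorem symV_iterate_C {p : Poly N} {d : ℕ} (hp : p.IsHomogeneous d) :
    symV^[d] (C (toRat p) : Symb N) =
      (d.factorial : Symb N) * map (algebraMap ℂ (RatFun N)) p := by
  induction d generalizing p with
  | zero =>
    rw [eq_C_of_isHomogeneous_zero hp, Function.iterate_zero_apply, toRat_C, Nat.factorial_zero,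
      Nat.cast_one, one_mul, map_C]
  | succ d ih =>
    have h1 : symV (C (toRat p) : Symb N) = ∑ i, X i * C (toRat (pderiv i p)) := by
      simp only [symV, symD_C, partialRat_toRat]
    rw [Function.iterate_succ_apply, h1, symV_iterate_sum_X_mul]
    have h2 := congrArg (map (algebraMap ℂ (RatFun N))) hp.sum_X_mul_pderiv
    rw [map_sum, nsmul_eq_mul, map_mul, map_natCast] at h2
    rw [Nat.factorial_succ, Nat.cast_mul, mul_comm ((d + 1 : ℕ) : Symb N), mul_assoc, ← h2,
      Finset.mul_sum]
    refine Finset.sum_congr rfl fun i _ => ?_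
    have h3 := hp.pderiv (i := i)
    rw [Nat.add_sub_cancel] at h3
    rw [ih h3, map_mul, map_X]
    ring

end

section

/-! ### The operator `L` on quasi-invariants -/

variable {A : Configuration N}

/-- Logarithmic differentiation of the product. -/
theorem toRat_gam_prod (f : Poly N) {s : Finset (Fin N → ℝ)} (hs : s ⊆ A.vectors) :
    toRat (gam (∏ α ∈ s, linForm α ^ A.mult α) f) = toRat (∏ α ∈ s, linForm α ^ A.mult α) *
      ∑ α ∈ s, (A.mult α : RatFun N) / toRat (linForm α) * toRat (gam (linForm α) f) := by
  classical
  induction s using Finset.induction_on with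
  | empty => simp [gam_apply]
  | insert β s hβ ih =>
    have hl : toRat (linForm β) ≠ 0 :=
      toRat_ne_zero (clin_ne_zero (A.bil_self_ne_zero (hs (Finset.mem_insert_self _ _))))
    have h1 := congrArg toRat (gam_pow_left f (linForm β) (A.mult β))
    simp only [map_mul, map_natCast] at h1
    have h2 : toRat (gam (linForm β ^ A.mult β) f) = toRat (linForm β ^ A.mult β) *
        ((A.mult β : RatFun N) / toRat (linForm β) * toRat (gam (linForm β) f)) := by
      apply mul_left_cancel₀ hl
      rw [h1]
      field_simp
    rw [Finset.prod_insert hβ, Finset.sum_insert hβ, gam_mul_left, map_add, map_mul, map_mul, h2,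
      ih ((Finset.subset_insert _ _).trans hs), map_mul]
    ring

theorem toRat_poly_mul_opL (f : Poly N) :
    toRat A.poly * opL A (toRat f) = toRat (lhat A.poly f) := by
  have h1 : opL A (toRat f) = toRat (lap f) -
      2 * ∑ α ∈ A.vectors, (A.mult α : RatFun N) / toRat (linForm α) *
        toRat (gam (linForm α) f) := by
    simp only [opL, LinearMap.sub_apply, LinearMap.sum_apply, pow_two, Module.End.mul_apply,
      pd_toRat, pdDir, mulOp_apply, LinearMap.smul_apply]
    rw [lap_apply, map_sum, Finset.mul_sum]
    congr 1
    refine Finset.sum_congr rfl fun α _ => ?_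
    rw [linForm_eq, gam_clin, map_sum]
    have h2 : ∀ i, (α i : ℂ) • toRat (pderiv i f) = toRat (C (cvec α i) * pderiv i f) := by
      intro i
      rw [map_mul, toRat_C, Algebra.smul_def]
      rfl
    simp only [h2]
    ring
  rw [h1, lhat_apply, map_sub, map_mul, map_mul, map_ofNat, Configuration.poly,
    toRat_gam_prod f (Finset.Subset.refl _)]
  ring

theorem opL_toRat_of_lhat {f g : Poly N} (h : A.poly * g = lhat A.poly f) :
    opL A (toRat f) = toRat g := by
  apply mul_left_cancel₀ (toRat_ne_zero A.poly_ne_zero)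
  rw [toRat_poly_mul_opL, ← h, map_mul]

theorem HomZ.pderiv {f : Poly N} {n : ℤ} (hf : HomZ f n) (i : Fin N) :
    HomZ (pderiv i f) (n - 1) := by
  rcases lt_or_ge n 0 with hn | hn
  · rw [hf.eq_zero hn, map_zero]
    exact HomZ.zero _
  lift n to ℕ using hn
  have hf := homZ_natCast.1 hf
  cases n with
  | zero =>
    rw [eq_C_of_isHomogeneous_zero hf, pderiv_C]
    exact HomZ.zero _
  | succ n =>
    have := homZ_natCast.2 (hf.pderiv (i := i))
    rw [Nat.add_sub_cancel] at this
    convert this using 1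
    push_cast
    ring

theorem HomZ.lhat {p f : Poly N} {m n : ℤ} (hp : HomZ p m) (hf : HomZ f n) :
    HomZ (lhat p f) (m + (n - 2)) := by
  have h1 : HomZ (p * lap f) (m + (n - 2)) := by
    rw [lap_apply]
    refine hp.mul (HomZ.sum fun i _ => ?_)
    convert (hf.pderiv i).pderiv i using 1
    ring
  have h2 : HomZ (gam p f) (m + (n - 2)) := by
    rw [gam_apply]
    refine HomZ.sum fun i _ => ?_
    convert (hp.pderiv i).mul (hf.pderiv i) using 1
    ring
  rw [lhat_apply, two_mul, sub_eq_add_neg]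
  exact h1.add (h2.add h2).neg

theorem homogeneousComponent_mul_of_isHomogeneous {p : Poly N} {m : ℕ} (hp : p.IsHomogeneous m)
    (g : Poly N) (j : ℕ) :
    homogeneousComponent (m + j) (p * g) = p * homogeneousComponent j g := by
  conv_lhs => rw [← sum_homogeneousComponent g, Finset.mul_sum, map_sum]
  have h1 : ∀ i, homogeneousComponent (m + j) (p * homogeneousComponent i g) =
      if i = j then p * homogeneousComponent i g else 0 := by
    intro i
    rw [homogeneousComponent_of_mem ((mem_homogeneousSubmodule _ _).2
      (hp.mul (homogeneousComponent_isHomogeneous i g)))]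
    exact if_congr (by omega) rfl rfl
  rw [Finset.sum_congr rfl fun i _ => h1 i, Finset.sum_ite_eq']
  split_ifs with h
  · rfl
  · rw [homogeneousComponent_eq_zero _ _ (by simpa [Nat.lt_succ_iff] using h), mul_zero]

theorem HomZ.of_mul {p g : Poly N} {m : ℕ} {n : ℤ} (hp : p.IsHomogeneous m) (hp0 : p ≠ 0)
    (h : HomZ (p * g) (m + n)) : HomZ g n := by
  intro ν hν
  have h1 : homogeneousComponent ν.degree g ≠ 0 := by
    intro h0
    have := congrArg (coeff ν) h0
    rw [coeff_homogeneousComponent, if_pos rfl, coeff_zero] at this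
    exact hν this
  have h2 := mul_ne_zero hp0 h1
  rw [← homogeneousComponent_mul_of_isHomogeneous hp] at h2
  obtain ⟨μ, hμ⟩ := ne_zero_iff.1 h2
  rw [coeff_homogeneousComponent] at hμ
  split_ifs at hμ with hd
  · have := h μ hμ
    rw [hd] at this
    push_cast at this
    omega
  · exact absurd rfl hμ

theorem lowers_opL (hA : A.Locus) : Lowers A (opL A) 2 := by
  intro n f hf hn
  obtain ⟨g, hg, hgf⟩ := hA.exists_lhat hf
  refine ⟨g, hg, opL_toRat_of_lhat hgf, HomZ.of_mul A.poly_isHomogeneous A.poly_ne_zero ?_⟩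
  rw [hgf]
  exact (homZ_natCast.2 A.poly_isHomogeneous).lhat hn

/-! ### Quantum integrals -/

/-- Iterated commutators of `L` with an operator. -/
def adL (A : Configuration N) (T : Module.End ℂ (RatFun N)) : Module.End ℂ (RatFun N) :=
  opL A * T - T * opL A

theorem adL_iterate_symbol [Nonempty (Fin N)] {p : Poly N} {d : ℕ} (hd : p.IsHomogeneous d)
    (n : ℕ) : ∃ a : Symb N, (adL A)^[n] (mulOp (toRat p)) = opOfSymbol a ∧
      IsSym a (n + 1) (2 * n - d) ∧
      homogeneousComponent n a = 2 ^ n * symV^[n] (C (toRat p)) := by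
  induction n with
  | zero =>
    refine ⟨C (toRat p), (opOfSymbol_C _).symm, ?_, ?_⟩
    · have := IsSym.monomial (r := 1) (homRat_toRat hd) 0 (by simp)
      simpa [← monomial_zero'] using this
    · simp
  | succ n ih =>
    obtain ⟨a, ha, has, hat⟩ := ih
    obtain ⟨b, hb, hbs, hbt⟩ := exists_commutator A has
    refine ⟨b, ?_, ?_, ?_⟩
    · rw [Function.iterate_succ_apply', ha, adL, hb]
    · convert hbs using 1
      push_cast
      ring
    · have hV : symV (2 ^ n * symV^[n] (C (toRat p)) : Symb N) =
          2 ^ n * symV (symV^[n] (C (toRat p))) := by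
        have h2 : ∀ (k : ℕ) (b : Symb N), symV ((k : Symb N) * b) = (k : Symb N) * symV b := by
          intro k b
          have hD : ∀ i, symD i ((k : Symb N) * b) = (k : Symb N) * symD i b := fun i => by
            have := map_nsmul (AddMonoidHom.mk' (symD i) (symD_add i)) k b
            simpa using this
          simp only [symV, hD, Finset.mul_sum]
          exact Finset.sum_congr rfl fun i _ => by ring
        have := h2 (2 ^ n) (symV^[n] (C (toRat p)))
        simpa using this
      rw [hbt, hat, hV, Function.iterate_succ_apply', pow_succ]
      ring

theorem lowers_adL_iterate (hA : A.Locus) {p : Poly N} (hp : p ∈ A.quasi) {d : ℕ}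
    (hd : p.IsHomogeneous d) (n : ℕ) :
    Lowers A ((adL A)^[n] (mulOp (toRat p))) (2 * n - d) := by
  induction n with
  | zero => simpa using Lowers.mulOp hp hd
  | succ n ih =>
    rw [Function.iterate_succ_apply', adL]
    have h1 := (lowers_opL hA).mul ih
    have h2 := ih.mul (lowers_opL hA)
    rw [add_comm] at h2
    have := h1.sub h2
    convert this using 1
    push_cast
    ring

theorem Lowers.smul {T : Module.End ℂ (RatFun N)} {e : ℤ} (h : Lowers A T e) (c : ℂ) :
    Lowers A (c • T) e := by
  intro n f hf hn
  obtain ⟨g, hg, hTg, hgn⟩ := h n f hf hn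
  refine ⟨c • g, Subalgebra.smul_mem _ hg c, ?_, fun ν hν => hgn ν ?_⟩
  · rw [LinearMap.smul_apply, hTg, smul_toRat]
  · rw [coeff_smul] at hν
    exact right_ne_zero_of_mul hν

/-- Take ad_L^d of multiplication by p. It has order at most d, lowers degrees by d, and has
principal symbol 2^d d! p(ξ). The next commutator has order at most d+1 but lowers degrees by d+2,
so it vanishes: the operator commutes with L. -/
theorem IsExpansion.exists_integral [Nonempty (Fin N)] {φ : (Fin N → ℂ) → (Fin N → ℂ) → ℂ}
    {F : ℕ → BiPoly N} (hF : IsExpansion A φ F) (hA : A.Locus) {p : Poly N} (hp : p ∈ A.quasi)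
    {d : ℕ} (hd : p.IsHomogeneous d) :
    ∃ a : Symb N, IsSym a (d + 1) d ∧
      homogeneousComponent d a = map (algebraMap ℂ (RatFun N)) p ∧
      Lowers A (opOfSymbol a) d ∧ opOfSymbol a * opL A = opL A * opOfSymbol a := by
  obtain ⟨a, ha, has, hat⟩ := adL_iterate_symbol (A := A) hd d
  have hlow := lowers_adL_iterate hA hp hd d
  have hcomm : opL A * opOfSymbol a - opOfSymbol a * opL A = 0 := by
    obtain ⟨b, hb, hbs, -⟩ := adL_iterate_symbol (A := A) hd (d + 1)
    have h1 := lowers_adL_iterate hA hp hd (d + 1)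
    rw [hb] at h1
    have h2 : b = 0 := hF.symbol_eq_zero_of_lowers (r₀ := d + 1)
      (fun ν hν => hbs.order ν hν) h1 (by push_cast; omega)
    rw [Function.iterate_succ_apply', ha, adL, h2, opOfSymbol_zero] at hb
    exact hb
  rw [ha] at hlow
  rw [show (2 * (d : ℤ) - d) = d by ring] at has hlow
  -- 2^d comes from the factor 2 in each commutator, d! from iterating ξ·∂ on p.
  set c : ℂ := ((2 : ℂ) ^ d * d.factorial)⁻¹ with hc
  have hc0 : ((2 : ℂ) ^ d * d.factorial) ≠ 0 :=
    mul_ne_zero (pow_ne_zero _ two_ne_zero) (Nat.cast_ne_zero.2 d.factorial_ne_zero)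
  have hca : (C (algebraMap ℂ (RatFun N) c) * a : Symb N) = c • a := by
    rw [C_mul', algebraMap_smul]
  refine ⟨c • a, ?_, ?_, ?_, ?_⟩
  · rw [← hca]
    have := has.C_mul (homRat_toRat (isHomogeneous_C (Fin N) c))
    rw [← toRat_C]
    simpa using this
  · rw [← hca, ← smul_eq_C_mul, map_smul, hat, symV_iterate_C hd, smul_eq_C_mul, ← mul_assoc,
      ← mul_assoc]
    have h3 : (C (algebraMap ℂ (RatFun N) c) * 2 ^ d * (d.factorial : Symb N)) = 1 := by
      have h4 : (C (algebraMap ℂ (RatFun N) (c * (2 ^ d * d.factorial))) : Symb N) = 1 := by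
        rw [hc, inv_mul_cancel₀ hc0, map_one, C_1]
      rw [← h4]
      simp only [map_mul, map_pow, map_natCast, map_ofNat]
      ring
    rw [h3, one_mul]
  · rw [opOfSymbol_smul]
    exact hlow.smul c
  · rw [opOfSymbol_smul, smul_mul_assoc, mul_smul_comm, sub_eq_zero.1 hcomm]

end

section

/-! ### Uniqueness of quantum integrals -/

theorem exists_common_denominator {ι : Type*} (s : Finset ι) {f : ι → RatFun N} {n : ℤ}
    (h : ∀ i ∈ s, HomRat (f i) n) :
    ∃ (j : ℕ) (R : Poly N) (P : ι → Poly N), R.IsHomogeneous j ∧ R ≠ 0 ∧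
      ∀ i ∈ s, f i * toRat R = toRat (P i) ∧ HomZ (P i) (j + n) := by
  classical
  induction s using Finset.induction_on with
  | empty => exact ⟨0, 1, 0, isHomogeneous_one _ _, one_ne_zero, by simp⟩
  | insert b s hb ih =>
    obtain ⟨j, R, P, hR, hR0, hP⟩ := ih fun i hi => h i (Finset.mem_insert_of_mem hi)
    obtain ⟨k, j', p, r, hp, hr, hr0, hn, hf⟩ := h b (Finset.mem_insert_self _ _)
    refine ⟨j + j', R * r, fun i => if i = b then p * R else P i * r, hR.mul hr,
      mul_ne_zero hR0 hr0, fun i hi => ?_⟩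
    rcases Finset.mem_insert.1 hi with rfl | hi
    · simp only [if_true]
      constructor
      · rw [hf, map_mul, map_mul, mul_comm (toRat R), ← mul_assoc,
          div_mul_cancel₀ _ (toRat_ne_zero hr0)]
      · convert homZ_natCast.2 (hp.mul hR) using 1
        push_cast
        omega
    · have hne : i ≠ b := fun e => hb (e ▸ hi)
      simp only [if_neg hne]
      constructor
      · rw [map_mul, ← mul_assoc, (hP i hi).1, map_mul]
      · convert (hP i hi).2.mul (homZ_natCast.2 hr) using 1
        push_cast
        ring

theorem HomZ.totalDegree_lt {f : Poly N} {n : ℤ} {j : ℕ} (hf : HomZ f n) (hn : n < j)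
    (hj : 0 < j) : f.totalDegree ≤ j - 1 := by
  refine Finset.sup_le fun ν hν => ?_
  have h1 : (ν.degree : ℤ) = n := hf ν (mem_support_iff.1 hν)
  have h2 : (ν.sum fun _ e => e) = ν.degree := rfl
  omega

theorem eval_symD (c : Fin N → ℂ) (i : Fin N) (a : Symb N) :
    eval (fun i => algebraMap ℂ (RatFun N) (c i)) (symD i a) =
      partialRat i (eval (fun i => algebraMap ℂ (RatFun N) (c i)) a) := by
  have hm : ∀ (ν : Fin N →₀ ℕ) (f : RatFun N),
      eval (fun i => algebraMap ℂ (RatFun N) (c i)) (monomial ν f) =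
        (ν.prod fun n e => c n ^ e) • f := by
    intro ν f
    rw [eval_monomial, mul_comm, Algebra.smul_def]
    congr 1
    simp [Finsupp.prod]
  induction a using MvPolynomial.induction_on' with
  | monomial ν f => rw [symD_monomial, hm, hm, Derivation.map_smul]
  | add a b ha hb => rw [symD_add, map_add, map_add, map_add, ha, hb]

/-- A homogeneous symbol of negative degree with `∑ ξ_i ∂_i a = 0` vanishes. -/
theorem eq_zero_of_symV_eq_zero {a : Symb N} {n : ℤ} (hn : n < 0)
    (ha : ∀ ν : Fin N →₀ ℕ, a.coeff ν ≠ 0 → HomRat (a.coeff ν) n) (hV : symV a = 0) : a = 0 := by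
  classical
  obtain ⟨j, R, P, hR, hR0, hP⟩ := exists_common_denominator a.support (f := fun ν => a.coeff ν)
    fun ν hν => ha ν (mem_support_iff.1 hν)
  set G : BiPoly N := ∑ ν ∈ a.support, monomial ν (P ν) with hG
  have hGa : map toRat G = C (toRat R) * a := by
    conv_rhs => rw [a.as_sum, Finset.mul_sum]
    rw [hG, map_sum]
    refine Finset.sum_congr rfl fun ν hν => ?_
    rw [map_monomial, C_mul_monomial, mul_comm, (hP ν hν).1]
  -- Freeze ξ = c. The hypothesis says that the rational function u/R is constant along c, while deg
  -- u < deg R because n < 0; the first-order equation then forces u = 0.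
  have hG0 : G = 0 := by
    refine eq_zero_of_eval_of_ne_zero hR0 fun c hc => ?_
    set u := eval (fun i => algebraMap ℂ (Poly N) (c i)) G with hu
    set g := eval (fun i => algebraMap ℂ (RatFun N) (c i)) a with hg
    have hgu : toRat R * g = toRat u := by
      have h1 := congrArg (eval fun i => algebraMap ℂ (RatFun N) (c i)) hGa
      rw [map_mul, eval_C, ← hg] at h1
      rw [← h1, hu, eval_map]
      exact (eval₂_comp_left toRat (RingHom.id (Poly N)) _ G).symm
    rcases a.support.eq_empty_or_nonempty with hs | ⟨μ, hμ⟩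
    · rw [hu, hG, hs, Finset.sum_empty, map_zero]
    by_cases hz : ∀ ν ∈ a.support, P ν = 0
    · rw [hu, hG, Finset.sum_eq_zero fun ν hν => by rw [hz ν hν, map_zero], map_zero]
    push Not at hz
    obtain ⟨ν₀, hν₀, hP0⟩ := hz
    have hj : 0 < j := by
      by_contra h0
      exact hP0 ((hP ν₀ hν₀).2.eq_zero (by omega))
    refine eq_zero_of_wronskian (y := c) (k := j - 1) ?_ hR (by omega) hc ?_
    · have h2 : HomZ u (j + n) := by
        rw [hu, hG, map_sum]
        refine HomZ.sum fun ν hν => ?_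
        rw [eval_monomial]
        have h3 : (ν.prod fun i e => algebraMap ℂ (Poly N) (c i) ^ e) =
            C (ν.prod fun i e => c i ^ e) := by
          simp [Finsupp.prod]
        rw [h3]
        have := (hP ν hν).2.mul (homZ_natCast.2 (isHomogeneous_C (Fin N) (ν.prod fun i e => c i ^ e)))
        simpa using this
      exact h2.totalDegree_lt (by omega) hj
    · apply toRat_injective
      have hD : ∑ i, algebraMap ℂ (RatFun N) (c i) * partialRat i g = 0 := by
        have h1 := congrArg (eval fun i => algebraMap ℂ (RatFun N) (c i)) hV
        rw [symV, map_sum, map_zero] at h1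
        rw [← h1]
        refine Finset.sum_congr rfl fun i _ => ?_
        rw [map_mul, eval_X, eval_symD]
      have hE : ∀ i, toRat (pderiv i u) = toRat R * partialRat i g + g * toRat (pderiv i R) := by
        intro i
        rw [← partialRat_toRat, ← hgu, Derivation.leibniz, partialRat_toRat, smul_eq_mul,
          smul_eq_mul]
      have hgam : toRat (gam (clin c) u) = g * toRat (gam (clin c) R) := by
        rw [gam_clin, gam_clin, map_sum, map_sum, Finset.mul_sum]
        have h1 : ∀ i, toRat (C (c i) * pderiv i u) =
            toRat R * (algebraMap ℂ (RatFun N) (c i) * partialRat i g) +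
              g * toRat (C (c i) * pderiv i R) := by
          intro i
          rw [map_mul, hE, map_mul, toRat_C]
          ring
        rw [Finset.sum_congr rfl fun i _ => h1 i, Finset.sum_add_distrib, ← Finset.mul_sum, hD,
          mul_zero, zero_add]
      rw [map_mul, map_mul, hgam, ← hgu]
      ring
  rw [hG0, map_zero, eq_comm, mul_eq_zero] at hGa
  exact hGa.resolve_left fun h => toRat_ne_zero hR0 (C_injective _ _ (h.trans C_0.symm))

variable {A : Configuration N}

/-- The principal symbol satisfies ∑ ξ_i ∂_i a = 0, and since the order is below d its coefficients
are homogeneous of negative degree, so it vanishes, order after order. -/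
theorem symbol_eq_zero_of_commute [Nonempty (Fin N)] {a : Symb N} {d : ℕ} (ha : IsSym a d d)
    (hcomm : opOfSymbol a * opL A = opL A * opOfSymbol a) : a = 0 := by
  cases d with
  | zero =>
    ext ν
    rw [coeff_zero]
    exact ha.order ν (Nat.zero_le _)
  | succ d =>
    refine symbol_eq_zero (r₀ := d) (fun ν hν => ha.order ν hν) fun r hr hra => ?_
    obtain ⟨b, hb, -, hbt⟩ := exists_commutator A (a := a) (r := r) (e := (d + 1 : ℕ))
      ⟨fun ν hν => hra ν hν, ha.hom⟩
    rw [hcomm, sub_self, ← opOfSymbol_zero] at hb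
    rw [← opOfSymbol_injective hb, map_zero, eq_comm, mul_eq_zero] at hbt
    refine eq_zero_of_symV_eq_zero (n := r - (d + 1 : ℕ)) (by push_cast; omega) (fun ν hν => ?_)
      (hbt.resolve_left two_ne_zero)
    rw [coeff_homogeneousComponent] at hν ⊢
    split_ifs at hν ⊢ with h
    · rw [← h]
      exact ha.hom ν
    · exact absurd rfl hν

/-- The difference of two integrals has order below d. The hypothesis sets aside N = 0 with d > 0,
where zero is not `HomRat` of negative degree. -/
theorem IsQuantumIntegral.unique {d : ℕ} (hN : Nonempty (Fin N) ∨ d = 0) {p : Poly N}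
    {D D' : Module.End ℂ (RatFun N)} (h : IsQuantumIntegral A d p D)
    (h' : IsQuantumIntegral A d p D') : D = D' := by
  obtain ⟨⟨a, rfl, had, hat, hah⟩, hac⟩ := h
  obtain ⟨⟨b, rfl, hbd, hbt, hbh⟩, hbc⟩ := h'
  have ho : ∀ ν : Fin N →₀ ℕ, d ≤ ν.degree → (a - b).coeff ν = 0 := by
    intro ν hν
    rw [coeff_sub]
    rcases Nat.eq_or_lt_of_le hν with h | h
    · rw [hat ν h.symm, hbt ν h.symm, sub_self]
    · rw [coeff_eq_zero_of_totalDegree_lt (had.trans_lt h),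
        coeff_eq_zero_of_totalDegree_lt (hbd.trans_lt h), sub_zero]
  have hz : a - b = 0 := by
    rcases hN with hN | rfl
    · refine symbol_eq_zero_of_commute (A := A) (d := d) ⟨ho, fun ν => ?_⟩ ?_
      · rw [coeff_sub, sub_eq_add_neg]
        exact (hah ν).add (hbh ν).neg
      · rw [opOfSymbol_sub, sub_mul, mul_sub, hac, hbc]
    · ext ν
      rw [ho ν (Nat.zero_le _), coeff_zero]
  rw [sub_eq_zero.1 hz]

theorem isQuantumIntegral_opOfSymbol {a : Symb N} {d : ℕ} {p : Poly N} (ha : IsSym a (d + 1) d)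
    (hp : homogeneousComponent d a = map (algebraMap ℂ (RatFun N)) p)
    (hc : opOfSymbol a * opL A = opL A * opOfSymbol a) : IsQuantumIntegral A d p (opOfSymbol a) := by
  refine ⟨⟨a, rfl, Finset.sup_le fun ν hν => ?_, fun ν hν => ?_, ha.hom⟩, hc⟩
  · by_contra hlt
    exact mem_support_iff.1 hν (ha.order ν (Nat.succ_le_of_lt (not_le.1 hlt)))
  · have := congrArg (coeff ν) hp
    rwa [coeff_homogeneousComponent, if_pos hν, coeff_map] at this

theorem isQuantumIntegral_C (A : Configuration N) (c : ℂ) :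
    IsQuantumIntegral A 0 (C c) (c • (1 : Module.End ℂ (RatFun N))) := by
  classical
  refine ⟨⟨C (algebraMap ℂ (RatFun N) c), ?_, ?_, fun ν hν => ?_, fun ν => ?_⟩, ?_⟩
  · rw [opOfSymbol_C]
    ext f
    simp [mulOp_apply, Algebra.smul_def]
  · rw [totalDegree_C]
  · rw [Finsupp.degree_eq_zero_iff] at hν
    rw [hν, coeff_C, coeff_C, if_pos rfl, if_pos rfl]
    rfl
  · rw [coeff_C]
    split_ifs with h
    · rw [← h, map_zero, ← toRat_C]
      simpa using homRat_toRat (isHomogeneous_C (Fin N) c)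
    · exact ⟨ν.degree, 0, 0, 1, isHomogeneous_zero _ _ _, isHomogeneous_one _ _, one_ne_zero,
        by simp, by simp⟩
  · rw [smul_mul_assoc, mul_smul_comm, one_mul, mul_one]

theorem quantumIntegral_C (A : Configuration N) (c : ℂ) :
    quantumIntegral A (C c) = c • (1 : Module.End ℂ (RatFun N)) := by
  have h := isQuantumIntegral_C A c
  rw [quantumIntegral, totalDegree_C, Finset.sum_range_one,
    homogeneousComponent_eq_self (isHomogeneous_C _ _)]
  exact IsQuantumIntegral.unique (Or.inr rfl) (Classical.epsilon_spec ⟨_, h⟩) h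

/-- The quantum integral of a homogeneous quasi-invariant acts on quasi-invariants, and on the
Baker--Akhiezer function by its symbol. -/
theorem IsExpansion.quantumIntegral_spec {φ : (Fin N → ℂ) → (Fin N → ℂ) → ℂ}
    {F : ℕ → BiPoly N} (hF : IsExpansion A φ F) (h0 : φ 0 0 ≠ 0) {p : Poly N} (hp : p ∈ A.quasi)
    {d : ℕ} (hd : p.IsHomogeneous d) :
    Lowers A (quantumIntegral A p) d ∧ ∀ l, A.Generic l → ∀ k,
      quantumIntegral A p (toRat (atR l (bakerComp F (k + d)))) =
        toRat (C (eval l p) * atR l (bakerComp F k)) := by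
  have hA := hF.locus h0
  by_cases hp0 : p = 0
  · have hz : quantumIntegral A p = 0 := by
      rw [hp0, ← C_0, quantumIntegral_C, zero_smul]
    rw [hz, hp0]
    refine ⟨fun n f _ _ => ⟨0, zero_mem _, by rw [map_zero]; rfl, HomZ.zero _⟩, fun l _ k => ?_⟩
    simp
  rcases isEmpty_or_nonempty (Fin N) with hN | hN
  · obtain ⟨c, rfl⟩ := C_surjective (Fin N) p
    have hd0 : d = 0 := by
      have := hd.totalDegree hp0
      rwa [totalDegree_C, eq_comm] at this
    subst hd0
    rw [quantumIntegral_C]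
    constructor
    · intro n f hf hn
      refine ⟨c • f, Subalgebra.smul_mem _ hf c, by rw [← smul_toRat]; rfl, fun ν hν => ?_⟩
      rw [coeff_smul] at hν
      simpa using hn ν (right_ne_zero_of_mul hν)
    · intro l _ k
      rw [eval_C, C_mul', ← smul_toRat]
      rfl
  · obtain ⟨a, ha, hat, hal, hac⟩ := hF.exists_integral hA hp hd
    have hq : quantumIntegral A p = opOfSymbol a := by
      rw [quantumIntegral, Finset.sum_eq_single_of_mem d
        (by rw [hd.totalDegree hp0]; exact Finset.self_mem_range_succ d)]
      · rw [homogeneousComponent_eq_self hd]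
        have h := isQuantumIntegral_opOfSymbol ha hat hac
        exact IsQuantumIntegral.unique (Or.inl hN) (Classical.epsilon_spec ⟨_, h⟩) h
      -- In the other degrees the chosen operator belongs to the zero polynomial, and uniqueness
      -- makes it zero.
      · intro k _ hk
        rw [homogeneousComponent_of_mem ((mem_homogeneousSubmodule _ _).2 hd), if_neg hk]
        have h : IsQuantumIntegral A k 0 (0 : Module.End ℂ (RatFun N)) := by
          have := isQuantumIntegral_opOfSymbol (A := A) (a := 0) (p := 0) (d := k)
            (IsSym.zero _ _) (by rw [map_zero, map_zero]) (by rw [opOfSymbol_zero]; simp)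
          rwa [opOfSymbol_zero] at this
        exact IsQuantumIntegral.unique (Or.inl hN) (Classical.epsilon_spec ⟨_, h⟩) h
    rw [hq]
    exact ⟨hal, fun l hl k => hF.opOfSymbol_comp (fun ν hν => ha.order ν hν) hal hat hl k⟩

end

section

/-! ### Spanning by the components of the Baker--Akhiezer function -/

variable {A : Configuration N}

namespace IsExpansion

variable {φ : (Fin N → ℂ) → (Fin N → ℂ) → ℂ} {F : ℕ → BiPoly N}

theorem opL_comp (hF : IsExpansion A φ F) (h0 : φ 0 0 ≠ 0) (l : Fin N → ℂ) (k : ℕ) :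
    opL A (toRat (atR l (bakerComp F (k + 2)))) = bil l l • toRat (atR l (bakerComp F k)) := by
  rw [smul_toRat, ← C_mul']
  exact opL_toRat_of_lhat (hF.lhat_comp h0 l k).symm

theorem opL_pow_comp (hF : IsExpansion A φ F) (h0 : φ 0 0 ≠ 0) (l : Fin N → ℂ) (n k : ℕ) :
    (opL A ^ n) (toRat (atR l (bakerComp F (k + 2 * n)))) =
      bil l l ^ n • toRat (atR l (bakerComp F k)) := by
  induction n with
  | zero => simp
  | succ n ih =>
    rw [pow_succ, Module.End.mul_apply, mul_add, mul_one, ← add_assoc, hF.opL_comp h0, map_smul,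
      ih, smul_smul, pow_succ, mul_comm]

theorem atX_bakerComp_eq (hF : IsExpansion A φ F) (h0 : φ 0 0 ≠ 0) (k : ℕ) (x : Fin N → ℂ) :
    atX x (bakerComp F k) = atR x (bakerComp F k) := by
  apply MvPolynomial.funext
  intro l
  rw [← eval_atR, hF.symm h0]

/-- Homogeneous quasi-invariants are spanned by the components of the Baker--Akhiezer function. -/
theorem mem_span (hF : IsExpansion A φ F) (h0 : φ 0 0 ≠ 0) {q : Poly N} (hq : q ∈ A.quasi) {d : ℕ}
    (hd : q.IsHomogeneous d) :
    q ∈ Submodule.span ℂ ((fun l => atR l (bakerComp F d)) '' {l | A.Generic l}) := by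
  by_contra hn
  obtain ⟨θ, hθ, hle⟩ := Submodule.exists_le_ker_of_notMem hn
  apply hθ
  set B := bakerComp F d with hB
  -- θ kills every B(·,l) with l generic; by the symmetry of B it may be applied in the spectral
  -- variable instead, so it kills each coefficient of B.
  have hθB : coeffMap θ B = 0 := by
    refine eq_zero_of_generic (A := A) fun l hl => ?_
    rw [eval_coeffMap, hB, hF.atX_bakerComp_eq h0]
    exact hle (Submodule.subset_span ⟨l, hl, rfl⟩)
  set D := quantumIntegral A q
  have hD := (hF.quantumIntegral_spec h0 hq hd).2
  obtain ⟨η, hη⟩ : ∃ η : RatFun N →ₗ[ℂ] ℂ, η 1 ≠ 0 := by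
    by_contra hne
    push Not at hne
    exact one_ne_zero ((Module.forall_dual_apply_eq_zero_iff ℂ (1 : RatFun N)).1 hne)
  -- L_q B(·,l) = q(l)φ(0,0) writes q, as a polynomial in l, as a linear combination of the
  -- coefficients of B. The functional η serves to extract scalars from an identity between rational
  -- functions.
  have hsum : ∑ ν ∈ B.support, η (D (toRat (monomial ν 1))) • B.coeff ν - (φ 0 0 * η 1) • q = 0 := by
    refine eq_zero_of_generic (A := A) fun l hl => ?_
    have h1 := congrArg η (hD l hl 0)
    have h1' : η (toRat (C (eval l q * φ 0 0))) = eval l q * φ 0 0 * η 1 := by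
      rw [toRat_C, Algebra.algebraMap_eq_smul_one, map_smul, smul_eq_mul]
    rw [zero_add, hF.comp_zero, ← C_mul, h1', ← hB] at h1
    have h2 : toRat (atR l B) = ∑ ν ∈ B.support, eval l (B.coeff ν) • toRat (monomial ν 1) := by
      conv_lhs => rw [B.as_sum, map_sum, map_sum]
      refine Finset.sum_congr rfl fun ν _ => ?_
      rw [atR, map_monomial, smul_toRat, smul_monomial, smul_eq_mul, mul_one]
    rw [h2, map_sum, map_sum] at h1
    rw [map_sub, map_sum, smul_eval, sub_eq_zero]
    have h3 : ∀ ν, eval l (η (D (toRat (monomial ν 1))) • B.coeff ν) =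
        η (D (eval l (B.coeff ν) • toRat (monomial ν 1))) := by
      intro ν
      rw [smul_eval, map_smul, map_smul, smul_eq_mul, mul_comm]
    rw [Finset.sum_congr rfl fun ν _ => h3 ν, h1]
    ring
  have h1 := congrArg θ hsum
  rw [map_sub, map_sum, map_zero, map_smul, Finset.sum_eq_zero, zero_sub, neg_eq_zero, smul_eq_mul,
    mul_eq_zero] at h1
  · exact h1.resolve_left (mul_ne_zero h0 hη)
  · intro ν _
    have h2 := congrArg (coeff ν) hθB
    rw [coeff_coeffMap, coeff_zero] at h2
    rw [map_smul, h2, smul_zero]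

end IsExpansion

/-! ### The Gaussian series -/

section Gauss

variable {R S : Type*} [CommRing R] [Algebra ℚ R] [CommRing S] [Algebra ℚ S]

/-- The series of `e^{u X^2}`. -/
def gaussSer (u : R) : PowerSeries R :=
  PowerSeries.mk fun i => if Even i then u ^ (i / 2) * algebraMap ℚ R (1 / (i / 2).factorial) else 0

theorem map_gaussSer (f : R →+* S) (u : R) :
    PowerSeries.map f (gaussSer u) = gaussSer (f u) := by
  ext i
  rw [PowerSeries.coeff_map, gaussSer, gaussSer, PowerSeries.coeff_mk, PowerSeries.coeff_mk]
  split_ifs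
  · rw [map_mul, map_pow]
    congr 1
    simp
  · rw [map_zero]

theorem coeff_mul_gaussSer (s : PowerSeries R) (u : R) (k : ℕ) :
    PowerSeries.coeff k (s * gaussSer u) = ∑ n ∈ Finset.range (k / 2 + 1),
      PowerSeries.coeff (k - 2 * n) s * (u ^ n * algebraMap ℚ R (1 / n.factorial)) := by
  rw [mul_comm, PowerSeries.coeff_mul, Finset.Nat.sum_antidiagonal_eq_sum_range_succ_mk]
  symm
  refine Finset.sum_of_injOn (fun n => 2 * n) (fun a _ b _ h => by simpa using h) (fun n hn => ?_)
    (fun i hi hne => ?_) fun n _ => ?_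
  · simp only [Finset.coe_range, Set.mem_Iio] at hn ⊢
    omega
  · simp only
    rw [gaussSer, PowerSeries.coeff_mk, if_neg, zero_mul]
    rintro ⟨j, rfl⟩
    apply hne
    simp only [Finset.mem_range] at hi
    exact ⟨j, by simp only [Finset.coe_range, Set.mem_Iio]; omega, by simp only; omega⟩
  · simp only
    rw [gaussSer, PowerSeries.coeff_mk, if_pos (even_two_mul n), Nat.mul_div_cancel_left n two_pos,
      mul_comm]

end Gauss

/-- The equation g' = 2ct g gives a two-step recursion for the Taylor coefficients. -/
theorem hasTaylor_gauss (c : ℂ) : HasTaylor (fun t => Complex.exp (c * t ^ 2)) (gaussSer c) := by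
  set g : ℂ → ℂ := fun t => Complex.exp (c * t ^ 2) with hg
  set s : PowerSeries ℂ := PowerSeries.mk fun k => (k.factorial : ℂ)⁻¹ * iteratedDeriv k g 0 with hs
  have hgs : HasTaylor g s := by
    refine ⟨by fun_prop, fun k => ?_⟩
    have := Nat.cast_ne_zero (R := ℂ).2 k.factorial_ne_zero
    rw [hs, PowerSeries.coeff_mk, mul_inv_cancel_left₀ this]
  have hd : deriv g = fun t => (Polynomial.C (2 * c) * Polynomial.X).eval t * g t := by
    funext t
    have h1 : HasDerivAt (fun t : ℂ => c * t ^ 2) (c * (2 * t)) t := by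
      simpa using (hasDerivAt_pow 2 t).const_mul c
    rw [h1.cexp.deriv]
    simp only [Polynomial.eval_mul, Polynomial.eval_C, Polynomial.eval_X, hg]
    ring
  have hrec := (hasTaylor_polynomial (Polynomial.C (2 * c) * Polynomial.X)).mul hgs
  rw [← hd] at hrec
  have hstep : ∀ k : ℕ, ((k : ℂ) + 1) * PowerSeries.coeff (k + 1) s =
      PowerSeries.coeff k (((Polynomial.C (2 * c) * Polynomial.X : Polynomial ℂ) :
        PowerSeries ℂ) * s) := by
    intro k
    have h1 := hrec.2 k
    rw [← iteratedDeriv_succ', hgs.2, Nat.factorial_succ] at h1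
    apply mul_left_cancel₀ (Nat.cast_ne_zero (R := ℂ).2 k.factorial_ne_zero)
    rw [← h1]
    push_cast
    ring
  simp only [Polynomial.coe_mul, Polynomial.coe_C, Polynomial.coe_X, mul_assoc,
    PowerSeries.coeff_C_mul] at hstep
  have hc0 : PowerSeries.coeff 0 s = 1 := by
    rw [hs, PowerSeries.coeff_mk, iteratedDeriv_zero]
    simp [hg]
  have hc1 : PowerSeries.coeff 1 s = 0 := by
    have := hstep 0
    simpa using this
  have key : ∀ n, PowerSeries.coeff (2 * n) s = c ^ n * algebraMap ℚ ℂ (1 / n.factorial) ∧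
      PowerSeries.coeff (2 * n + 1) s = 0 := by
    intro n
    induction n with
    | zero => exact ⟨by simp [hc0], hc1⟩
    | succ n ih =>
      have h1 := hstep (2 * n + 1)
      have h2 := hstep (2 * n + 2)
      rw [PowerSeries.coeff_succ_X_mul] at h1 h2
      rw [ih.1] at h1
      rw [ih.2, mul_zero, mul_zero] at h2
      have h5 : ∀ m : ℕ, algebraMap ℚ ℂ (1 / m.factorial) = 1 / (m.factorial : ℂ) := fun m => by
        simp
      have e1 : ((2 * n + 1 : ℕ) : ℂ) + 1 ≠ 0 := Nat.cast_add_one_ne_zero _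
      have e2 : ((2 * n + 2 : ℕ) : ℂ) + 1 ≠ 0 := Nat.cast_add_one_ne_zero _
      refine ⟨?_, (mul_eq_zero.1 h2).resolve_left e2⟩
      apply mul_left_cancel₀ e1
      rw [show 2 * (n + 1) = 2 * n + 1 + 1 by ring, h1, h5, h5, Nat.factorial_succ]
      have h3 := Nat.cast_ne_zero (R := ℂ).2 n.factorial_ne_zero
      have h4 : (n : ℂ) + 1 ≠ 0 := by exact_mod_cast Nat.succ_ne_zero n
      push_cast
      field_simp
      ring
  have : s = gaussSer c := by
    ext i
    refine Eq.trans ?_ (PowerSeries.coeff_mk i _).symm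
    rcases Nat.even_or_odd' i with ⟨n, rfl | rfl⟩
    · rw [if_pos (even_two_mul n), Nat.mul_div_cancel_left n two_pos, (key n).1]
    · rw [if_neg (by simp), (key n).2]
  rwa [← this]

/-! ### Taylor components -/

/-- Expanding D^k f(0)(v,…,v) multilinearly in the coordinates of v recovers the k-th derivative
along the line tv. -/
theorem eval_taylorComponent {f : (Fin N → ℂ) → ℂ} (hf : ContDiff ℂ ⊤ f) (k : ℕ)
    (v : Fin N → ℂ) : eval v (taylorComponent f k) =
      (k.factorial : ℂ)⁻¹ * iteratedDeriv k (fun t : ℂ => f (t • v)) 0 := by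
  have h1 : iteratedDeriv k (fun t : ℂ => f (t • v)) 0 = iteratedFDeriv ℂ k f 0 fun _ => v := by
    have h2 := ContinuousLinearMap.iteratedFDeriv_comp_right
      (ContinuousLinearMap.toSpanSingleton ℂ v) hf 0 (i := k) le_top
    have h3 : (f ∘ ContinuousLinearMap.toSpanSingleton ℂ v) = fun t : ℂ => f (t • v) := by
      funext t
      simp
    rw [h3] at h2
    rw [iteratedDeriv_eq_iteratedFDeriv, h2, ContinuousMultilinearMap.compContinuousLinearMap_apply,
      map_zero]
    simp only [ContinuousLinearMap.toSpanSingleton_apply, one_smul]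
  have h4 : v = ∑ i, v i • (Pi.single i (1 : ℂ) : Fin N → ℂ) := by
    funext j
    simp [Finset.sum_apply, Pi.single_apply]
  rw [h1]
  conv_rhs => rw [h4, ContinuousMultilinearMap.map_sum]
  rw [taylorComponent, map_sum, Finset.mul_sum]
  refine Finset.sum_congr rfl fun s _ => ?_
  rw [ContinuousMultilinearMap.map_smul_univ, map_mul, eval_C, map_prod, smul_eq_mul]
  simp only [eval_X]
  ring

theorem contDiff_eval (p : Poly N) : ContDiff ℂ ⊤ fun l : Fin N → ℂ => eval l p := by
  induction p using MvPolynomial.induction_on with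
  | C c => simp only [eval_C]; exact contDiff_const
  | add p q hp hq => simp only [map_add]; exact hp.add hq
  | mul_X p i hp => simp only [map_mul, eval_X]; exact hp.mul (contDiff_apply ℂ ℂ i)

/-- The homogeneous components of the generating function. -/
def genComp (F : ℕ → BiPoly N) (x : Fin N → ℂ) : PowerSeries (Poly N) :=
  PowerSeries.mk (fun k => atR x (bakerComp F k)) * gaussSer (C (-1 / 2) * quadForm)

namespace IsExpansion

variable {φ : (Fin N → ℂ) → (Fin N → ℂ) → ℂ} {F : ℕ → BiPoly N}

theorem taylorComponent_genFun (hF : IsExpansion A φ F) (h0 : φ 0 0 ≠ 0) (x : Fin N → ℂ) (k : ℕ) :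
    taylorComponent (genFun φ x) k = PowerSeries.coeff k (genComp F x) := by
  have hform : genFun φ x = fun l => (∑ i ∈ Finset.range (A.totalMult + 1),
      eval l (atR x (F i))) * Complex.exp (bil x l) * Complex.exp (-(bil l l) / 2) := by
    funext l
    rw [genFun, hF.form]
    have e : ∀ i, eval x (atR l (F i)) = eval l (atR x (F i)) := fun i => by
      rw [eval_atR, hF.atX_eq_atR h0]
    simp only [e]
  have hbil : ContDiff ℂ ⊤ fun l : Fin N → ℂ => bil x l := by
    unfold bil
    fun_prop
  have hquad : ContDiff ℂ ⊤ fun l : Fin N → ℂ => bil l l := by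
    unfold bil
    fun_prop
  have hsm : ContDiff ℂ ⊤ (genFun φ x) := by
    rw [hform]
    refine ((ContDiff.sum fun i _ => contDiff_eval _).mul hbil.cexp).mul ?_
    exact (hquad.neg.div_const 2).cexp
  apply MvPolynomial.funext
  intro v
  rw [eval_taylorComponent hsm]
  -- On the line λ = tv the generating function is a polynomial times an exponential times a
  -- Gaussian in t, each with known Taylor series; symmetry lets the polynomial factor be read in λ.
  set p : Polynomial ℂ := ∑ i ∈ Finset.range (A.totalMult + 1),
    Polynomial.monomial i (eval v (atR x (F i))) with hp
  have hT := ((hasTaylor_polynomial p).mul (hasTaylor_exp (bil x v))).mul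
    (hasTaylor_gauss (-1 / 2 * bil v v))
  have hfun : (fun t : ℂ => genFun φ x (t • v)) = fun t => p.eval t * Complex.exp (bil x v * t) *
      Complex.exp (-1 / 2 * bil v v * t ^ 2) := by
    funext t
    rw [hform]
    have e1 : ∑ i ∈ Finset.range (A.totalMult + 1), eval (t • v) (atR x (F i)) = p.eval t := by
      rw [hp, Polynomial.eval_finsetSum]
      refine Finset.sum_congr rfl fun i _ => ?_
      rw [IsHomogeneous.eval_smul (hF.homR i x), Polynomial.eval_monomial, mul_comm]
    have e2 : -(t * (t * bil v v)) / 2 = -1 / 2 * bil v v * t ^ 2 := by ring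
    simp only [bil_smul_right, bil_smul_left]
    rw [e1, e2, mul_comm t]
  rw [hfun, hT.2, inv_mul_cancel_left₀ (Nat.cast_ne_zero.2 k.factorial_ne_zero),
    ← PowerSeries.coeff_map, genComp, RingHom.map_mul, map_gaussSer]
  congr 2
  · have h1 : PowerSeries.mk (fun k => atR x (bakerComp F k)) =
        PowerSeries.mk (fun i => atR x (F i)) * expSer (clin x) := by
      ext i : 1
      rw [PowerSeries.coeff_mk, atR_bakerComp]
    rw [h1, RingHom.map_mul, map_expSer, eval_clin]
    congr 1
    ext i
    rw [Polynomial.coeff_coe, PowerSeries.coeff_map, PowerSeries.coeff_mk, hp,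
      Polynomial.finsetSum_coeff]
    simp only [Polynomial.coeff_monomial, Finset.sum_ite_eq', Finset.mem_range]
    split_ifs with hi
    · rfl
    · rw [hF.eq_zero i (by omega), map_zero, map_zero]
  · rw [map_mul, eval_C, eval_quadForm]

theorem coeff_genComp (F : ℕ → BiPoly N) (x : Fin N → ℂ) (k : ℕ) :
    PowerSeries.coeff k (genComp F x) = ∑ n ∈ Finset.range (k / 2 + 1),
      ((-1 / 2 : ℂ) ^ n / n.factorial) • (quadForm ^ n * atR x (bakerComp F (k - 2 * n))) := by
  rw [genComp, coeff_mul_gaussSer]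
  refine Finset.sum_congr rfl fun n _ => ?_
  have : algebraMap ℚ (Poly N) (1 / n.factorial) = C (1 / (n.factorial : ℂ)) := by
    have h : algebraMap ℚ (Poly N) (1 / n.factorial) = C (algebraMap ℚ ℂ (1 / n.factorial)) := rfl
    rw [h]
    simp
  rw [PowerSeries.coeff_mk, this, ← C_mul', mul_pow, ← C_pow,
    div_eq_mul_one_div ((-1 / 2 : ℂ) ^ n), C_mul]
  ring

theorem genComp_mem (hF : IsExpansion A φ F) (x : Fin N → ℂ) (k : ℕ) :
    PowerSeries.coeff k (genComp F x) ∈ A.quasi := by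
  rw [coeff_genComp]
  exact sum_mem fun n _ => Subalgebra.smul_mem _
    (mul_mem (pow_mem (quadForm_mem_quasi A) n) (hF.comp_mem _ x)) _

theorem genComp_isHomogeneous (hF : IsExpansion A φ F) (x : Fin N → ℂ) (k : ℕ) :
    (PowerSeries.coeff k (genComp F x)).IsHomogeneous k := by
  rw [coeff_genComp]
  refine IsHomogeneous.sum _ _ _ fun n hn => ?_
  have hn := Finset.mem_range.1 hn
  have h1 : (quadForm : Poly N).IsHomogeneous 2 :=
    IsHomogeneous.sum _ _ _ fun i _ => by simpa using (isHomogeneous_X ℂ i).pow 2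
  have h2 := (h1.pow n).mul (hF.comp_isHomogeneous (k - 2 * n) x)
  rw [Nat.add_sub_cancel' (by omega)] at h2
  rw [← C_mul']
  exact h2.C_mul _

theorem eval_genComp (hF : IsExpansion A φ F) (h0 : φ 0 0 ≠ 0) (x l : Fin N → ℂ) (k : ℕ) :
    eval l (PowerSeries.coeff k (genComp F x)) = ∑ n ∈ Finset.range (k / 2 + 1),
      ((-1 / 2 : ℂ) ^ n / n.factorial) * (bil l l ^ n *
        eval x (atR l (bakerComp F (k - 2 * n)))) := by
  rw [coeff_genComp, map_sum]
  refine Finset.sum_congr rfl fun n _ => ?_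
  rw [smul_eval, map_mul, map_pow, eval_quadForm, hF.symm h0]

end IsExpansion

end

section

/-! ### The Hermite polynomials -/

variable {A : Configuration N}

theorem HomZ.smul {f : Poly N} {n : ℤ} (hf : HomZ f n) (c : ℂ) : HomZ (c • f) n := fun ν hν => by
  rw [coeff_smul] at hν
  exact hf ν (right_ne_zero_of_mul hν)

theorem HomZ.homogeneousComponent_eq_zero {f : Poly N} {n : ℤ} (hf : HomZ f n) {k : ℕ}
    (hk : (k : ℤ) ≠ n) : homogeneousComponent k f = 0 := by
  ext ν
  rw [coeff_homogeneousComponent, coeff_zero]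
  split_ifs with h
  · by_contra hne
    exact hk (by rw [← h, hf ν hne])
  · rfl

theorem opL_pow_toRat (hA : A.Locus) (j : ℕ) {f : Poly N} (hf : f ∈ A.quasi) {n : ℤ}
    (hn : HomZ f n) :
    ∃ g ∈ A.quasi, (opL A ^ j) (toRat f) = toRat g ∧ HomZ g (n - 2 * j) := by
  induction j with
  | zero => exact ⟨f, hf, rfl, by simpa using hn⟩
  | succ j ih =>
    obtain ⟨g, hg, hfg, hgn⟩ := ih
    obtain ⟨g', hg', hgg', hgn'⟩ := lowers_opL hA _ g hg hgn
    refine ⟨g', hg', by rw [pow_succ', Module.End.mul_apply, hfg, hgg'], ?_⟩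
    rwa [Nat.cast_succ, mul_add, mul_one, ← sub_sub]

theorem opL_toRat_mem (hA : A.Locus) {f : Poly N} (hf : f ∈ A.quasi) :
    ∃ g ∈ A.quasi, opL A (toRat f) = toRat g := by
  obtain ⟨g, hg, h⟩ := hA.exists_lhat hf
  exact ⟨g, hg, opL_toRat_of_lhat h⟩

theorem opL_pow_toRat_eq_zero (hA : A.Locus) {f : Poly N} (hf : f ∈ A.quasi) {d j : ℕ}
    (hd : f.IsHomogeneous d) (hj : d < 2 * j) : (opL A ^ j) (toRat f) = 0 := by
  obtain ⟨g, -, h, hg⟩ := opL_pow_toRat hA j hf (homZ_natCast.2 hd)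
  rw [h, hg.eq_zero (by omega), map_zero]

theorem opL_locally_nilpotent (hA : A.Locus) {f : Poly N} (hf : f ∈ A.quasi) :
    ∃ n : ℕ, (opL A ^ n) (toRat f) = 0 := by
  refine ⟨f.totalDegree + 1, ?_⟩
  have h1 : toRat f = ∑ i ∈ Finset.range (f.totalDegree + 1), toRat (homogeneousComponent i f) := by
    rw [← map_sum, sum_homogeneousComponent]
  rw [h1, map_sum]
  refine Finset.sum_eq_zero fun i hi => ?_
  refine opL_pow_toRat_eq_zero hA (homogeneousComponent_mem_quasi hf i)
    (homogeneousComponent_isHomogeneous i f) ?_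
  have := Finset.mem_range.1 hi
  omega

theorem opE_toRat {f : Poly N} {n : ℕ} (hf : f.IsHomogeneous n) :
    opE (toRat f) = (n : ℂ) • toRat f := by
  have h1 : opE (toRat f) = toRat (∑ i, X i * pderiv i f) := by
    rw [opE, LinearMap.sum_apply, map_sum]
    refine Finset.sum_congr rfl fun i _ => ?_
    rw [Module.End.mul_apply, pd_toRat, mulOp_apply, map_mul]
  rw [h1, hf.sum_X_mul_pderiv, smul_toRat, Nat.cast_smul_eq_nsmul]

theorem evalZero_toRat (g : Poly N) : evalZero (toRat g) = eval 0 g :=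
  toRat_injective.extend_apply _ _ g

/-- The terms `(-1/2)^n / n! L^n q` of `e^{-L/2} q`. -/
theorem exists_expNegHalfL_terms (hA : A.Locus) {q : Poly N} (hq : q ∈ A.quasi) {d : ℕ}
    (hd : q.IsHomogeneous d) : ∃ h : ℕ → Poly N, ∀ n, h n ∈ A.quasi ∧ HomZ (h n) (d - 2 * n) ∧
      toRat (h n) = ((-1 / 2 : ℂ) ^ n / (n.factorial : ℂ)) • (opL A ^ n) (toRat q) := by
  choose g hg hgq hgn using fun n => opL_pow_toRat hA n hq (homZ_natCast.2 hd)
  exact ⟨fun n => ((-1 / 2 : ℂ) ^ n / (n.factorial : ℂ)) • g n, fun n =>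
    ⟨Subalgebra.smul_mem _ (hg n) _, (hgn n).smul _, by rw [hgq n, smul_toRat]⟩⟩

theorem expNegHalfL_eq_sum (hA : A.Locus) {q : Poly N} (hq : q ∈ A.quasi) {d : ℕ}
    (hd : q.IsHomogeneous d) : expNegHalfL A (toRat q) = ∑ n ∈ Finset.range (d / 2 + 1),
      ((-1 / 2 : ℂ) ^ n / (n.factorial : ℂ)) • (opL A ^ n) (toRat q) := by
  refine finsum_eq_sum_of_support_subset _ fun n hn => ?_
  rw [Finset.mem_coe, Finset.mem_range]
  by_contra hlt
  refine hn ?_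
  simp only
  rw [opL_pow_toRat_eq_zero hA hq hd (by omega), smul_zero]

namespace IsExpansion

variable {φ : (Fin N → ℂ) → (Fin N → ℂ) → ℂ} {F : ℕ → BiPoly N}

/-- The component of degree `d` of the generating function reproduces `e^{-L/2}` on homogeneous
quasi-invariants of degree `d`. -/
theorem quantumIntegral_genComp (hF : IsExpansion A φ F) (h0 : φ 0 0 ≠ 0) (x : Fin N → ℂ)
    {q : Poly N} (hq : q ∈ A.quasi) {d : ℕ} (hd : q.IsHomogeneous d) :
    ∃ g, ∑ n ∈ Finset.range (d / 2 + 1),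
        ((-1 / 2 : ℂ) ^ n / (n.factorial : ℂ)) • (opL A ^ n) (toRat q) = toRat g ∧
      quantumIntegral A (PowerSeries.coeff d (genComp F x)) (toRat q) =
        toRat (C (φ 0 0 * eval x g)) := by
  have hspan := hF.mem_span h0 hq hd
  clear hq hd
  induction hspan using Submodule.span_induction with
  | mem p hp =>
    obtain ⟨l, hl, rfl⟩ := hp
    refine ⟨∑ n ∈ Finset.range (d / 2 + 1), ((-1 / 2 : ℂ) ^ n / (n.factorial : ℂ)) •
      bil l l ^ n • atR l (bakerComp F (d - 2 * n)), ?_, ?_⟩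
    · rw [map_sum]
      refine Finset.sum_congr rfl fun n hn => ?_
      have hn := Finset.mem_range.1 hn
      have h1 := hF.opL_pow_comp h0 l n (d - 2 * n)
      rw [Nat.sub_add_cancel (by omega)] at h1
      rw [← smul_toRat, ← smul_toRat]
      exact congrArg _ h1
    · have h1 := (hF.quantumIntegral_spec h0 (hF.genComp_mem x d)
        (hF.genComp_isHomogeneous x d)).2 l hl 0
      rw [zero_add, hF.comp_zero, ← C_mul, hF.eval_genComp h0] at h1
      rw [map_sum]
      simp only [smul_eval]
      rw [mul_comm]
      exact h1
  | zero => exact ⟨0, by simp, by simp⟩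
  | add p p' _ _ ih ih' =>
    obtain ⟨g, hg, h⟩ := ih
    obtain ⟨g', hg', h'⟩ := ih'
    refine ⟨g + g', ?_, ?_⟩
    · simp only [map_add, smul_add, Finset.sum_add_distrib, hg, hg']
    · rw [map_add toRat, map_add, h, h', map_add (eval x), mul_add, C_add, map_add]
  | smul c p _ ih =>
    obtain ⟨g, hg, h⟩ := ih
    refine ⟨c • g, ?_, ?_⟩
    · rw [← smul_toRat, ← smul_toRat, ← hg, Finset.smul_sum]
      exact Finset.sum_congr rfl fun n _ => by rw [map_smul, smul_comm]
    · rw [← smul_toRat, map_smul, h, smul_toRat, smul_eval, mul_left_comm, C_mul (a := c), C_mul']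

/-- Only k = d contributes: for k ≠ d the integral sends q to a polynomial that is homogeneous of
degree d-k, so it is zero or vanishes at the origin. -/
theorem hermite_eq_eval (hF : IsExpansion A φ F) (h0 : φ 0 0 ≠ 0) {q : Poly N}
    (hq : q ∈ A.quasi) {d : ℕ} (hd : q.IsHomogeneous d) {H : Poly N}
    (hH : toRat H = expNegHalfL A (toRat q)) (x : Fin N → ℂ) :
    hermite A φ q x = eval x H := by
  rw [hermite, finsum_eq_single _ d]
  · obtain ⟨g, hg, h⟩ := hF.quantumIntegral_genComp h0 x hq hd
    rw [← expNegHalfL_eq_sum (hF.locus h0) hq hd, ← hH] at hg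
    rw [nform, AHermite.form, hF.taylorComponent_genFun h0, h, evalZero_toRat, eval_C,
      inv_mul_cancel_left₀ h0, toRat_injective hg]
  · intro k hk
    obtain ⟨g, -, h, hg⟩ := (hF.quantumIntegral_spec h0 (hF.genComp_mem x k)
      (hF.genComp_isHomogeneous x k)).1 d q hq (homZ_natCast.2 hd)
    rw [nform, AHermite.form, hF.taylorComponent_genFun h0, h, evalZero_toRat]
    have hz : eval 0 g = 0 := by
      rcases lt_or_ge d k with hlt | hle
      · rw [hg.eq_zero (by omega), map_zero]
      · rw [← Nat.cast_sub hle, homZ_natCast] at hg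
        exact IsHomogeneous.eval_zero hg (by omega)
    rw [hz, mul_zero]

end IsExpansion

/-- `e^{-L/2} q` is an eigenvector of `L - E`. -/
theorem opLH_expNegHalfL (hA : A.Locus) {q : Poly N} (hq : q ∈ A.quasi) {d : ℕ}
    (hd : q.IsHomogeneous d) :
    opLH A (expNegHalfL A (toRat q)) = -(d : ℂ) • expNegHalfL A (toRat q) := by
  obtain ⟨h, hh⟩ := exists_expNegHalfL_terms hA hq hd
  set t : ℕ → RatFun N := fun n => ((-1 / 2 : ℂ) ^ n / (n.factorial : ℂ)) • (opL A ^ n) (toRat q)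
    with ht
  -- The factor -2(n+1) is the ratio of consecutive coefficients (-1/2)^n/n!.
  have hL : ∀ n, opL A (t n) = -(2 * (n + 1) : ℂ) • t (n + 1) := by
    intro n
    simp only [ht]
    rw [map_smul, smul_smul, pow_succ' (opL A), Module.End.mul_apply]
    congr 1
    have h1 : ((n + 1 : ℕ) : ℂ) ≠ 0 := Nat.cast_ne_zero.2 n.succ_ne_zero
    have h2 : (n.factorial : ℂ) ≠ 0 := Nat.cast_ne_zero.2 n.factorial_ne_zero
    rw [Nat.factorial_succ, Nat.cast_mul]
    push_cast at h1 ⊢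
    field_simp
    ring
  have hE : ∀ n, opE (t n) = ((d : ℂ) - 2 * n) • t n := by
    intro n
    rw [show t n = toRat (h n) from (hh n).2.2.symm]
    rcases lt_or_ge d (2 * n) with hlt | hle
    · rw [(hh n).2.1.eq_zero (by omega), map_zero, map_zero, smul_zero]
    · have h1 := (hh n).2.1
      rw [show ((d : ℤ) - 2 * n) = ((d - 2 * n : ℕ) : ℤ) by omega, homZ_natCast] at h1
      rw [opE_toRat h1, Nat.cast_sub hle]
      push_cast
      rfl
  have hlast : t (d / 2 + 1) = 0 := by
    simp only [ht]
    rw [opL_pow_toRat_eq_zero hA hq hd (by omega), smul_zero]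
  -- The terms 2n t_n from E cancel those produced by L, leaving only the boundary term 2M t_M.
  have key : ∀ M, opLH A (∑ n ∈ Finset.range M, t n) =
      -(d : ℂ) • ∑ n ∈ Finset.range M, t n - (2 * M : ℂ) • t M := by
    intro M
    induction M with
    | zero => simp
    | succ M ih =>
      rw [Finset.sum_range_succ, map_add, ih, opLH, LinearMap.sub_apply, hL, hE]
      push_cast
      module
  rw [expNegHalfL_eq_sum hA hq hd, key, hlast, smul_zero, sub_zero]

/-- An eigenvector of `L - E` for the eigenvalue `-d` without components of degree at least `d`
vanishes. -/
theorem eq_zero_of_opLH (hA : A.Locus) {W : Poly N} (hW : W ∈ A.quasi) {d : ℕ}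
    (hd : ∀ k, d ≤ k → homogeneousComponent k W = 0)
    (hLH : opLH A (toRat W) = -(d : ℂ) • toRat W) : W = 0 := by
  choose V _ hV hVn using fun i : ℕ => lowers_opL hA i _ (homogeneousComponent_mem_quasi hW i)
    (homZ_natCast.2 (homogeneousComponent_isHomogeneous i W))
  have hsum : ∑ i ∈ Finset.range (W.totalDegree + 1), V i =
      ∑ i ∈ Finset.range (W.totalDegree + 1), ((i : ℂ) - d) • homogeneousComponent i W := by
    apply toRat_injective
    have h1 : toRat W = ∑ i ∈ Finset.range (W.totalDegree + 1),
        toRat (homogeneousComponent i W) := by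
      rw [← map_sum, sum_homogeneousComponent]
    rw [h1, map_sum, Finset.smul_sum, ← sub_eq_zero, ← Finset.sum_sub_distrib] at hLH
    rw [← sub_eq_zero, map_sum, map_sum, ← Finset.sum_sub_distrib, ← hLH]
    refine Finset.sum_congr rfl fun i _ => ?_
    rw [opLH, LinearMap.sub_apply, hV, opE_toRat (homogeneousComponent_isHomogeneous i W),
      ← smul_toRat]
    module
  -- In degree k the equation reads L W_{k+2} = (k-d) W_k, so vanishing propagates downwards from
  -- degree d.
  have hz : ∀ j k, d ≤ k + j → homogeneousComponent k W = 0 := by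
    intro j
    induction j with
    | zero => exact hd
    | succ j ih =>
      intro k hk
      by_cases hdk : d ≤ k
      · exact hd k hdk
      rcases lt_or_ge W.totalDegree k with hlt | hle
      · exact homogeneousComponent_eq_zero _ _ hlt
      have h1 := congrArg (homogeneousComponent k) hsum
      rw [map_sum, map_sum, Finset.sum_eq_zero, Finset.sum_eq_single_of_mem k
        (Finset.mem_range.2 (by omega))] at h1
      · rw [map_smul, homogeneousComponent_eq_self (homogeneousComponent_isHomogeneous k W)] at h1
        refine (smul_eq_zero.1 h1.symm).resolve_left (sub_ne_zero.2 ?_)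
        exact_mod_cast fun h : k = d => hdk h.ge
      · intro i _ hi
        rw [map_smul, homogeneousComponent_of_mem ((mem_homogeneousSubmodule _ _).2
          (homogeneousComponent_isHomogeneous i W)), if_neg hi.symm, smul_zero]
      · intro i _
        by_cases hik : i = k + 2
        · have h2 : V i = 0 := by
            apply toRat_injective
            rw [← hV, hik, ih (k + 2) (by omega), map_zero, map_zero]
          rw [h2, map_zero]
        · exact (hVn i).homogeneousComponent_eq_zero (by omega)
  rw [← sum_homogeneousComponent W]
  exact Finset.sum_eq_zero fun i _ => hz d i (Nat.le_add_left d i)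

/-- The polynomial `e^{-L/2} q` and its components. -/
theorem exists_toRat_eq_expNegHalfL (hA : A.Locus) {q : Poly N} (hq : q ∈ A.quasi) {d : ℕ}
    (hd : q.IsHomogeneous d) : ∃ H : Poly N, toRat H = expNegHalfL A (toRat q) ∧ H ∈ A.quasi ∧
      HasHermiteForm A d q H := by
  obtain ⟨h, hh⟩ := exists_expNegHalfL_terms hA hq hd
  have h0 : h 0 = q := by
    apply toRat_injective
    rw [(hh 0).2.2]
    simp
  refine ⟨∑ n ∈ Finset.range (d / 2 + 1), h n, ?_, sum_mem fun n _ => (hh n).1, h, ?_, ?_⟩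
  · rw [expNegHalfL_eq_sum hA hq hd, map_sum]
    exact Finset.sum_congr rfl fun n _ => (hh n).2.2
  · intro n _ hn
    refine ⟨quasiInvariant_iff.2 (hh n).1, homZ_natCast.1 ?_⟩
    have h1 := (hh n).2.1
    rwa [show ((d : ℤ) - 2 * n) = ((d - 2 * n : ℕ) : ℤ) by omega] at h1
  · rw [Finset.sum_range_succ', h0, add_comm, Finset.range_eq_Ico,
      Finset.sum_Ico_add' h 0 (d / 2) 1]
    rfl

theorem HasHermiteForm.hasLeadingTerm {d : ℕ} {q H : Poly N} (h : HasHermiteForm A d q H) :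
    HasLeadingTerm d q H := by
  obtain ⟨h, hh, rfl⟩ := h
  intro k hk
  rw [map_add, map_sum, Finset.sum_eq_zero, add_zero]
  intro n hn
  obtain ⟨h1, h2⟩ := Finset.mem_Icc.1 hn
  rw [homogeneousComponent_of_mem ((mem_homogeneousSubmodule _ _).2 (hh n h1 h2).2),
    if_neg (by omega)]

end

end AHermite

end

theorem proposition4p6 {N : ℕ} (A : AHermite.Configuration N)
    (φ : (Fin N → ℂ) → (Fin N → ℂ) → ℂ)
    (hφ : AHermite.IsBakerAkhiezer A φ) (h0 : φ 0 0 ≠ 0) :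
    -- `L` preserves the quasi-invariants and acts on them locally nilpotently
    (∀ p, AHermite.QuasiInvariant A p →
      (∃ p', AHermite.QuasiInvariant A p' ∧
        AHermite.opL A (AHermite.toRat p) = AHermite.toRat p') ∧
      ∃ n : ℕ, (AHermite.opL A ^ n) (AHermite.toRat p) = 0) ∧
    -- `H_q = e^{-L/2} q`, and `H_q` is the unique solution of `L^H H = -d H` with leading term `q`
    ∀ (d : ℕ) (q : MvPolynomial (Fin N) ℂ), AHermite.HomQuasiInvariant A d q →
      ∃ H : MvPolynomial (Fin N) ℂ,
        (∀ x, AHermite.hermite A φ q x = MvPolynomial.eval x H) ∧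
        AHermite.toRat H = AHermite.expNegHalfL A (AHermite.toRat q) ∧
        AHermite.QuasiInvariant A H ∧
        AHermite.HasHermiteForm A d q H ∧
        AHermite.opLH A (AHermite.toRat H) = -(d : ℂ) • AHermite.toRat H ∧
        ∀ G : MvPolynomial (Fin N) ℂ, AHermite.QuasiInvariant A G →
          AHermite.HasLeadingTerm d q G →
          AHermite.opLH A (AHermite.toRat G) = -(d : ℂ) • AHermite.toRat G → G = H := by
  obtain ⟨F, hF⟩ := hφ.exists_expansion
  have hA := hF.locus h0
  refine ⟨fun p hp => ⟨?_, ?_⟩, fun d q ⟨hq, hd⟩ => ?_⟩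
  · obtain ⟨p', hp', h⟩ := AHermite.opL_toRat_mem hA (AHermite.quasiInvariant_iff.1 hp)
    exact ⟨p', AHermite.quasiInvariant_iff.2 hp', h⟩
  · exact AHermite.opL_locally_nilpotent hA (AHermite.quasiInvariant_iff.1 hp)
  · rw [AHermite.quasiInvariant_iff] at hq
    obtain ⟨H, hH, hHq, hform⟩ := AHermite.exists_toRat_eq_expNegHalfL hA hq hd
    have heig : AHermite.opLH A (AHermite.toRat H) = -(d : ℂ) • AHermite.toRat H := by
      rw [hH, AHermite.opLH_expNegHalfL hA hq hd]
    refine ⟨H, hF.hermite_eq_eval h0 hq hd hH, hH, AHermite.quasiInvariant_iff.2 hHq, hform, heig,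
      fun G hG hlead hGeig => ?_⟩
    -- Two solutions with the same leading term differ by an eigenvector with no component in
    -- degrees at least d.
    refine sub_eq_zero.1 (AHermite.eq_zero_of_opLH hA (d := d)
      (sub_mem (AHermite.quasiInvariant_iff.1 hG) hHq) (fun k hk => ?_) ?_)
    · rw [map_sub, hlead k hk, hform.hasLeadingTerm k hk, sub_self]
    · rw [map_sub, map_sub, hGeig, heig, smul_sub]
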